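/- **Definitions.** Let $\lambda\ge 1$. A $2$-$(36,6,\lambda)$ design is a pair $\mathcal D=(\mathcal P,\mathcal B)$ of a set $\mathcal P$ of $36$ points and a set $\mathcal B$ of $6$-element subsets of $\mathcal P$ (blocks), such that every $2$-element subset of $\mathcal P$ lies in exactly $\lambda$ blocks. (It is automatically non-trivial, as $2<6<36$.) An automorphism group of $\mathcal D$ is a group of permutations of $\mathcal P$ that preserve $\mathcal B$; it is block-transitive if it is transitive on $\mathcal B$. Two designs are isomorphic if some bijection between their point sets maps blocks onto blocks. $PSL(2,8)$ and $P\Gamma L(2,8)$ are the groups of permutations of the projective line over $\mathbb F_8$ induced by $SL(2,8)$ and by all invertible semilinear maps of $\mathbb F_8^2$. On $\{1,\dots,36\}$ let $X^*=\langle g_1,g_2\rangle$ and $Y^*=\langle h_1,h_2,h_3\rangle$, where $g_1=(2,3,5,8,13,20,29)(4,7,12,19,11,18,23)(6,10,16,25,28,14,22)(9,15,24,33,26,17,27)(21,31,32,34,36,35,30)$, $g_2=(1,2,4)(3,6,11)(5,9,7)(8,14,23)(10,17,28)(12,13,21)(15,24,34)(16,26,31)(18,29,33)(19,20,30)(22,32,36)(25,35,27)$,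 $h_1=(1,2,4,9,16,24,10)(3,7,6,13,11,19,18)(5,12,20,8,15,14,23)(17,25,22,28,21,29,27)(26,33,30,34,36,35,31)$, $h_2=(1,3,8)(2,5,6)(4,10,7)(9,17,26)(11,19,14)(12,21,30)(13,22,31)(15,23,16)(18,27,34)(20,28,33)(24,29,35)(25,32,36)$, $h_3=(1,3,8)(2,6,5)(4,11,15)(7,14,16)(9,18,12)(10,19,23)(13,20,24)(17,27,21)(22,28,29)(26,34,30)(31,33,35)$. For a group $K$ of permutations of $\{1,\dots,36\}$ and a $6$-subset $B$ of it let $\mathcal D(K,B)$ be the incidence structure with point set $\{1,\dots,36\}$ and block set $B^K=\{B^g: g\in K\}$. Let $T_1$ and $T_2$ be the lists of pairs $(\lambda,B)$ given below; they have $46$ and $330$ entries. **Theorem.** Let $\mathcal D$ be a $2$-$(36,6,\lambda)$ design and let $G$ be a block-transitive automorphism group of $\mathcal D$ which, as an abstract group, is (identified with) a group with $PSL(2,8)\trianglelefteq G\le P\Gamma L(2,8)$. Then one of the following holds: 1. $G=PSL(2,8)$, $\lambda\in\{2,6,12\}$, and $\mathcal D\cong\mathcal D(X^*,B)$ for some entry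 $(\lambda,B)$ of $T_1$; 2. $G=P\Gamma L(2,8)$, $\lambda\in\{2,6,9,12,18,36\}$, and $\mathcal D\cong\mathcal D(Y^*,B)$ for some entry $(\lambda,B)$ of $T_2$. Conversely, $X^*\cong PSL(2,8)$ and $Y^*\cong P\Gamma L(2,8)$. For every entry $(\lambda,B)$ of $T_1$ (of $T_2$) the structure $\mathcal D(X^*,B)$ (respectively $\mathcal D(Y^*,B)$) is a $2$-$(36,6,\lambda)$ design admitting $X^*$ (respectively $Y^*$) as a block-transitive automorphism group, and different entries of the same list give non-isomorphic designs. So, up to isomorphism, there are exactly $46$ designs in case 1 and exactly $330$ designs in case 2. List $T_1$: - $\lambda=2$ (1 block): 1,2,4,16,26,31. - $\lambda=6$ (3 blocks): 1,2,3,16,28,36; 1,2,3,25,27,32; 1,2,6,16,18,36. - $\lambda=12$ (42 blocks): 1,2,3,4,15,16; 1,2,3,4,15,27; 1,2,3,4,16,24; 1,2,3,4,22,34; 1,2,3,4,24,27; 1,2,3,4,25,34; 1,2,3,4,26,35; 1,2,3,4,31,34; 1,2,3,4,32,34; 1,2,3,4,34,36; 1,2,3,6,12,25; 1,2,3,6,15,23;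 1,2,3,6,15,32; 1,2,3,6,17,36; 1,2,3,6,24,26; 1,2,3,6,26,36; 1,2,3,9,10,27; 1,2,3,9,10,32; 1,2,3,9,11,17; 1,2,3,9,12,17; 1,2,3,9,12,34; 1,2,3,9,16,32; 1,2,3,9,17,18; 1,2,3,9,17,30; 1,2,3,9,18,22; 1,2,3,9,18,25; 1,2,3,9,22,27; 1,2,3,9,22,34; 1,2,3,9,25,34; 1,2,3,9,28,35; 1,2,3,10,12,24; 1,2,3,10,12,25; 1,2,3,12,14,22; 1,2,3,12,17,35; 1,2,3,12,32,34; 1,2,3,16,24,30; 1,2,3,16,24,32; 1,2,3,17,24,35; 1,2,3,17,25,31; 1,2,3,17,30,31; 1,2,3,18,30,31; 1,2,6,7,15,17. List $T_2$: - $\lambda=2$ (1 block): 1,2,3,5,6,8. - $\lambda=6$ (4 blocks): 1,2,3,4,27,30; 1,2,3,5,9,29; 1,2,3,10,27,28; 1,2,3,15,22,27. - $\lambda=9$ (1 block): 1,2,3,4,13,32. - $\lambda=12$ (4 blocks): 1,2,3,11,17,22; 1,2,3,12,15,19; 1,2,3,13,26,30; 1,2,7,9,25,26. - $\lambda=18$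 (11 blocks): 1,2,3,4,18,21; 1,2,3,4,20,22; 1,2,3,4,28,31; 1,2,3,5,10,19; 1,2,3,5,13,30; 1,2,3,5,15,16; 1,2,3,5,23,25; 1,2,3,7,21,22; 1,2,3,8,9,18; 1,2,3,10,30,31; 1,2,3,13,16,22. - $\lambda=36$ (309 blocks): 1,2,3,4,5,18; 1,2,3,4,5,20; 1,2,3,4,5,21; 1,2,3,4,5,22; 1,2,3,4,5,24; 1,2,3,4,5,26; 1,2,3,4,5,28; 1,2,3,4,5,31; 1,2,3,4,5,35; 1,2,3,4,6,9; 1,2,3,4,6,20; 1,2,3,4,6,22; 1,2,3,4,6,24; 1,2,3,4,6,27; 1,2,3,4,6,28; 1,2,3,4,6,30; 1,2,3,4,6,31; 1,2,3,4,6,35; 1,2,3,4,7,12; 1,2,3,4,7,17; 1,2,3,4,7,18; 1,2,3,4,7,20; 1,2,3,4,7,21; 1,2,3,4,7,22; 1,2,3,4,7,26; 1,2,3,4,7,34; 1,2,3,4,7,35; 1,2,3,4,8,9; 1,2,3,4,8,12; 1,2,3,4,8,17; 1,2,3,4,8,18; 1,2,3,4,8,21; 1,2,3,4,8,26; 1,2,3,4,8,27;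 1,2,3,4,8,30; 1,2,3,4,8,34; 1,2,3,4,9,10; 1,2,3,4,9,12; 1,2,3,4,9,15; 1,2,3,4,9,16; 1,2,3,4,9,18; 1,2,3,4,9,19; 1,2,3,4,9,20; 1,2,3,4,9,24; 1,2,3,4,9,27; 1,2,3,4,10,12; 1,2,3,4,10,17; 1,2,3,4,10,24; 1,2,3,4,10,27; 1,2,3,4,10,28; 1,2,3,4,10,30; 1,2,3,4,10,31; 1,2,3,4,10,34; 1,2,3,4,11,12; 1,2,3,4,11,17; 1,2,3,4,11,18; 1,2,3,4,11,21; 1,2,3,4,11,24; 1,2,3,4,11,26; 1,2,3,4,11,28; 1,2,3,4,11,31; 1,2,3,4,11,34; 1,2,3,4,12,15; 1,2,3,4,12,17; 1,2,3,4,12,18; 1,2,3,4,12,20; 1,2,3,4,12,24; 1,2,3,4,12,34; 1,2,3,4,15,17; 1,2,3,4,15,20; 1,2,3,4,15,22; 1,2,3,4,15,27; 1,2,3,4,15,30; 1,2,3,4,15,34; 1,2,3,4,15,35; 1,2,3,4,16,18; 1,2,3,4,16,21; 1,2,3,4,16,24; 1,2,3,4,16,26; 1,2,3,4,16,28; 1,2,3,4,16,30;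 1,2,3,4,16,31; 1,2,3,4,17,21; 1,2,3,4,17,22; 1,2,3,4,17,28; 1,2,3,4,17,34; 1,2,3,4,18,19; 1,2,3,4,18,20; 1,2,3,4,18,24; 1,2,3,4,18,26; 1,2,3,4,19,20; 1,2,3,4,19,21; 1,2,3,4,19,22; 1,2,3,4,19,26; 1,2,3,4,19,35; 1,2,3,4,20,24; 1,2,3,4,20,35; 1,2,3,4,21,22; 1,2,3,4,21,27; 1,2,3,4,21,28; 1,2,3,4,22,28; 1,2,3,4,22,35; 1,2,3,4,24,31; 1,2,3,4,25,33; 1,2,3,4,26,31; 1,2,3,4,26,34; 1,2,3,4,26,35; 1,2,3,4,31,34; 1,2,3,4,31,35; 1,2,3,4,34,35; 1,2,3,5,6,9; 1,2,3,5,6,12; 1,2,3,5,6,13; 1,2,3,5,6,17; 1,2,3,5,9,10; 1,2,3,5,9,12; 1,2,3,5,9,15; 1,2,3,5,9,16; 1,2,3,5,9,18; 1,2,3,5,9,19; 1,2,3,5,9,20; 1,2,3,5,9,24; 1,2,3,5,10,13; 1,2,3,5,10,20; 1,2,3,5,10,26; 1,2,3,5,10,30; 1,2,3,5,12,13; 1,2,3,5,12,16;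 1,2,3,5,12,19; 1,2,3,5,13,15; 1,2,3,5,13,16; 1,2,3,5,13,18; 1,2,3,5,13,19; 1,2,3,5,13,20; 1,2,3,5,13,24; 1,2,3,5,15,18; 1,2,3,5,15,21; 1,2,3,5,15,24; 1,2,3,5,15,30; 1,2,3,5,15,31; 1,2,3,5,15,33; 1,2,3,5,17,19; 1,2,3,5,19,30; 1,2,3,5,19,31; 1,2,3,5,23,32; 1,2,3,5,26,30; 1,2,3,5,26,33; 1,2,3,5,30,31; 1,2,3,5,30,34; 1,2,3,7,8,12; 1,2,3,7,8,17; 1,2,3,7,8,25; 1,2,3,7,8,32; 1,2,3,7,8,34; 1,2,3,7,8,36; 1,2,3,7,9,12; 1,2,3,7,9,16; 1,2,3,7,9,21; 1,2,3,7,9,25; 1,2,3,7,9,26; 1,2,3,7,9,36; 1,2,3,7,11,12; 1,2,3,7,11,25; 1,2,3,7,11,34; 1,2,3,7,11,36; 1,2,3,7,12,19; 1,2,3,7,12,24; 1,2,3,7,13,16; 1,2,3,7,13,22; 1,2,3,7,13,25; 1,2,3,7,13,26; 1,2,3,7,13,35; 1,2,3,7,13,36; 1,2,3,7,14,25; 1,2,3,7,14,32;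 1,2,3,7,14,34; 1,2,3,7,14,36; 1,2,3,7,15,17; 1,2,3,7,15,25; 1,2,3,7,15,32; 1,2,3,7,15,34; 1,2,3,7,16,20; 1,2,3,7,16,24; 1,2,3,7,16,29; 1,2,3,7,16,31; 1,2,3,7,16,33; 1,2,3,7,17,19; 1,2,3,7,17,27; 1,2,3,7,17,28; 1,2,3,7,17,29; 1,2,3,7,18,26; 1,2,3,7,18,27; 1,2,3,7,18,28; 1,2,3,7,18,30; 1,2,3,7,18,31; 1,2,3,7,18,33; 1,2,3,7,19,20; 1,2,3,7,19,21; 1,2,3,7,19,22; 1,2,3,7,19,34; 1,2,3,7,20,27; 1,2,3,7,20,29; 1,2,3,7,20,31; 1,2,3,7,20,33; 1,2,3,7,21,24; 1,2,3,7,21,30; 1,2,3,7,22,31; 1,2,3,7,22,33; 1,2,3,7,24,26; 1,2,3,7,24,36; 1,2,3,7,25,27; 1,2,3,7,25,28; 1,2,3,7,25,29; 1,2,3,7,26,27; 1,2,3,7,26,35; 1,2,3,7,27,32; 1,2,3,7,28,32; 1,2,3,7,28,35; 1,2,3,7,29,32; 1,2,3,7,29,35; 1,2,3,7,30,34; 1,2,3,7,30,36;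 1,2,3,7,31,32; 1,2,3,7,31,36; 1,2,3,7,32,33; 1,2,3,7,33,34; 1,2,3,7,33,36; 1,2,3,8,9,28; 1,2,3,8,9,31; 1,2,3,8,10,17; 1,2,3,8,10,25; 1,2,3,8,10,32; 1,2,3,8,10,36; 1,2,3,8,12,13; 1,2,3,8,12,24; 1,2,3,8,13,26; 1,2,3,8,18,33; 1,2,3,9,11,12; 1,2,3,9,11,21; 1,2,3,9,11,25; 1,2,3,9,11,28; 1,2,3,9,11,31; 1,2,3,9,11,36; 1,2,3,9,12,20; 1,2,3,9,13,16; 1,2,3,9,13,19; 1,2,3,9,13,26; 1,2,3,9,13,31; 1,2,3,9,14,16; 1,2,3,9,14,19; 1,2,3,9,14,28; 1,2,3,9,17,23; 1,2,3,9,20,36; 1,2,3,9,23,34; 1,2,3,10,11,12; 1,2,3,10,11,25; 1,2,3,10,11,34; 1,2,3,10,12,13; 1,2,3,10,12,15; 1,2,3,10,12,16; 1,2,3,10,12,20; 1,2,3,10,12,23; 1,2,3,10,13,19; 1,2,3,10,13,28; 1,2,3,10,13,30; 1,2,3,10,13,31; 1,2,3,10,15,34; 1,2,3,10,15,36; 1,2,3,10,16,27;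 1,2,3,10,16,30; 1,2,3,10,16,34; 1,2,3,10,17,23; 1,2,3,10,19,22; 1,2,3,10,19,33; 1,2,3,10,22,24; 1,2,3,10,22,25; 1,2,3,10,23,25; 1,2,3,10,23,32; 1,2,3,10,23,34; 1,2,3,10,23,36; 1,2,3,10,33,34; 1,2,3,11,12,20; 1,2,3,11,14,25; 1,2,3,11,14,32; 1,2,3,11,14,34; 1,2,3,11,14,36; 1,2,3,11,17,29; 1,2,3,11,20,36; 1,2,3,11,22,25; 1,2,3,11,29,32; 1,2,3,11,34,35; 1,2,3,12,13,25; 1,2,3,12,13,36; 1,2,3,12,15,18; 1,2,3,13,16,18; 1,2,3,13,16,24; 1,2,3,13,18,30; 1,2,3,13,18,35; 1,2,3,13,19,20; 1,2,3,13,19,31; 1,2,3,13,20,26; 1,2,3,14,18,32; 1,2,3,14,19,20; 1,2,3,14,20,36; 1,2,3,15,17,29; 1,2,3,15,19,30; 1,2,3,15,20,35; 1,2,3,15,29,35; 1,2,3,18,26,30. -/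

import Mathlib

open scoped LinearAlgebra.Projectivization

/-! ### Designs and their automorphism groups -/

/-- `blocks` is the block set of a `t`-`(v, k, lam)` design on the point set `P` (`lam ≥ 1`):
`P` has `v` points, each block has `k` points, and each `t`-subset of `P` lies in exactly `lam`
blocks. -/
structure IsDesign {P : Type*} [Fintype P] (t v k lam : ℕ) (blocks : Set (Finset P)) : Prop where
  card_points : Fintype.card P = v
  card_block : ∀ B ∈ blocks, B.card = k
  lam_pos : 0 < lam
  balanced : ∀ T : Finset P, T.card = t → {B ∈ blocks | T ⊆ B}.ncard = lam

/-- The image of a point set under a bijection of point sets. -/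
def moveBlock {P Q : Type*} (f : P ≃ Q) (B : Finset P) : Finset Q := B.map f.toEmbedding

/-- `f` is an isomorphism from the design with block set `b₁` to the one with block set `b₂`. -/
def IsDesignIso {P Q : Type*} (f : P ≃ Q) (b₁ : Set (Finset P)) (b₂ : Set (Finset Q)) : Prop :=
  ∀ B : Finset P, moveBlock f B ∈ b₂ ↔ B ∈ b₁

/-- The designs with block sets `b₁` and `b₂` are isomorphic. -/
def DesignIsomorphic {P Q : Type*} (b₁ : Set (Finset P)) (b₂ : Set (Finset Q)) : Prop :=
  ∃ f : P ≃ Q, IsDesignIso f b₁ b₂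

/-- `G` is an automorphism group of the design: each of its elements preserves the block set. -/
def IsAutGroup {P : Type*} (G : Subgroup (Equiv.Perm P)) (blocks : Set (Finset P)) : Prop :=
  ∀ g ∈ G, IsDesignIso g blocks blocks

/-- `G` permutes the blocks transitively. -/
def IsBlockTransitive {P : Type*} (G : Subgroup (Equiv.Perm P)) (blocks : Set (Finset P)) : Prop :=
  ∀ B ∈ blocks, ∀ C ∈ blocks, ∃ g ∈ G, moveBlock g B = C

/-- The block set `B^G` with base block `B`. -/
def orbitBlocks {P : Type*} (G : Subgroup (Equiv.Perm P)) (B : Finset P) : Set (Finset P) :=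
  {C | ∃ g ∈ G, moveBlock g B = C}

/-! ### The groups `PSL(2,8)` and `PΓL(2,8)`, acting on the projective line over `𝔽₈` -/

/-- `PSL(2, K)`, as the group of permutations it induces on the projective line over `K`. -/
def PSL2 (K : Type*) [Field K] : Subgroup (Equiv.Perm (ℙ K (Fin 2 → K))) :=
  (MulAction.toPermHom (Matrix.ProjectiveSpecialLinearGroup (Fin 2) K)
    (ℙ K (Fin 2 → K))).range

/-- The permutation `π` of the projective line is induced by the bijective additive map `f`
of `K²`, semilinear with respect to the field automorphism `σ`. -/
def IsInducedBySemilinear {K : Type*} [Field K] (π : Equiv.Perm (ℙ K (Fin 2 → K)))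
    (σ : K ≃+* K) (f : (Fin 2 → K) ≃+ (Fin 2 → K)) : Prop :=
  (∀ (c : K) (v : Fin 2 → K), f (c • v) = σ c • f v) ∧
    ∀ (v : Fin 2 → K) (hv : v ≠ 0),
      π (Projectivization.mk K v hv) =
        Projectivization.mk K (f v) ((map_ne_zero_iff f f.injective).mpr hv)

/-- `PΓL(2, K)`: the group of permutations of the projective line over `K` that are induced by
invertible semilinear maps of `K²`. -/
def PGammaL2 (K : Type*) [Field K] : Subgroup (Equiv.Perm (ℙ K (Fin 2 → K))) where
  carrier := {π | ∃ (σ : K ≃+* K) (f : (Fin 2 → K) ≃+ (Fin 2 → K)), IsInducedBySemilinear π σ f}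
  one_mem' := ⟨RingEquiv.refl K, AddEquiv.refl _, fun _ _ => rfl, fun _ _ => rfl⟩
  mul_mem' := by
    rintro π₁ π₂ ⟨σ₁, f₁, h₁, k₁⟩ ⟨σ₂, f₂, h₂, k₂⟩
    refine ⟨σ₂.trans σ₁, f₂.trans f₁, fun c v => ?_, fun v hv => ?_⟩
    · simp [h₁, h₂]
    · simp [k₁, k₂]
  inv_mem' := by
    rintro π ⟨σ, f, h, k⟩
    refine ⟨σ.symm, f.symm, fun c v => ?_, fun v hv => ?_⟩
    · apply f.injective
      simp [h]
    · rw [Equiv.Perm.inv_eq_iff_eq, k]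
      simp

/-- The field with eight elements. -/
abbrev F8 : Type := GaloisField 2 3

/-! ### The listed designs

The points `1, …, 36` of the lists below are represented by the elements `0, …, 35` of `Fin 36`. -/

/-- The point with label `n`, for `1 ≤ n ≤ 36`. -/
def pt (n : ℕ) : Fin 36 := Fin.ofNat 36 (n - 1)

/-- The product of the disjoint cycles in a list; the cycle `[a, b, …, c]` maps `a` to `b` and
`c` to `a`. -/
def permOfCycles (L : List (List ℕ)) : Equiv.Perm (Fin 36) :=
  (L.map fun c => (c.map pt).formPerm).prod

/-- The block with the given list of labels. -/
def blockOf (L : List ℕ) : Finset (Fin 36) := (L.map pt).toFinset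

/-- The group `⟨g₁, g₂⟩`, the image of `PSL(2,8)` in its action on 36 points. -/
def permPSL : Subgroup (Equiv.Perm (Fin 36)) :=
  Subgroup.closure
    {permOfCycles
      [[2, 3, 5, 8, 13, 20, 29], [4, 7, 12, 19, 11, 18, 23], [6, 10, 16, 25, 28, 14, 22],
       [9, 15, 24, 33, 26, 17, 27], [21, 31, 32, 34, 36, 35, 30]],
     permOfCycles
      [[1, 2, 4], [3, 6, 11], [5, 9, 7], [8, 14, 23], [10, 17, 28], [12, 13, 21], [15, 24, 34],
       [16, 26, 31], [18, 29, 33], [19, 20, 30], [22, 32, 36], [25, 35, 27]]}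

/-- The group `⟨h₁, h₂, h₃⟩`, the image of `PΓL(2,8)` in its action on 36 points. -/
def permPGammaL : Subgroup (Equiv.Perm (Fin 36)) :=
  Subgroup.closure
    {permOfCycles
      [[1, 2, 4, 9, 16, 24, 10], [3, 7, 6, 13, 11, 19, 18], [5, 12, 20, 8, 15, 14, 23],
       [17, 25, 22, 28, 21, 29, 27], [26, 33, 30, 34, 36, 35, 31]],
     permOfCycles
      [[1, 3, 8], [2, 5, 6], [4, 10, 7], [9, 17, 26], [11, 19, 14], [12, 21, 30], [13, 22, 31],
       [15, 23, 16], [18, 27, 34], [20, 28, 33], [24, 29, 35], [25, 32, 36]],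
     permOfCycles
      [[1, 3, 8], [2, 6, 5], [4, 11, 15], [7, 14, 16], [9, 18, 12], [10, 19, 23], [13, 20, 24],
       [17, 27, 21], [22, 28, 29], [26, 34, 30], [31, 33, 35]]}

/-- The block set of the listed design with base block `e.2`, for the permutation group `G`;
the first entry of `e` is its `λ`. -/
def listedBlocks (G : Subgroup (Equiv.Perm (Fin 36))) (e : ℕ × List ℕ) : Set (Finset (Fin 36)) :=
  orbitBlocks G (blockOf e.2)

/-- The pairs `(λ, base block)` of the designs for `PSL(2,8)`. -/
def pslTable : List (ℕ × List ℕ) :=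
  [(12, [1, 2, 3, 4, 15, 16]), (12, [1, 2, 3, 4, 15, 27]), (12, [1, 2, 3, 4, 16, 24]),
   (12, [1, 2, 3, 4, 22, 34]), (12, [1, 2, 3, 4, 24, 27]), (12, [1, 2, 3, 4, 25, 34]),
   (12, [1, 2, 3, 4, 26, 35]), (12, [1, 2, 3, 4, 31, 34]), (12, [1, 2, 3, 4, 32, 34]),
   (12, [1, 2, 3, 4, 34, 36]), (12, [1, 2, 3, 6, 12, 25]), (12, [1, 2, 3, 6, 15, 23]),
   (12, [1, 2, 3, 6, 15, 32]), (12, [1, 2, 3, 6, 17, 36]), (12, [1, 2, 3, 6, 24, 26]),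
   (12, [1, 2, 3, 6, 26, 36]), (12, [1, 2, 3, 9, 10, 27]), (12, [1, 2, 3, 9, 10, 32]),
   (12, [1, 2, 3, 9, 11, 17]), (12, [1, 2, 3, 9, 12, 17]), (12, [1, 2, 3, 9, 12, 34]),
   (12, [1, 2, 3, 9, 16, 32]), (12, [1, 2, 3, 9, 17, 18]), (12, [1, 2, 3, 9, 17, 30]),
   (12, [1, 2, 3, 9, 18, 22]), (12, [1, 2, 3, 9, 18, 25]), (12, [1, 2, 3, 9, 22, 27]),
   (12, [1, 2, 3, 9, 22, 34]), (12, [1, 2, 3, 9, 25, 34]), (12, [1, 2, 3, 9, 28, 35]),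
   (12, [1, 2, 3, 10, 12, 24]), (12, [1, 2, 3, 10, 12, 25]), (12, [1, 2, 3, 12, 14, 22]),
   (12, [1, 2, 3, 12, 17, 35]), (12, [1, 2, 3, 12, 32, 34]), (12, [1, 2, 3, 16, 24, 30]),
   (12, [1, 2, 3, 16, 24, 32]), (6, [1, 2, 3, 16, 28, 36]), (12, [1, 2, 3, 17, 24, 35]),
   (12, [1, 2, 3, 17, 25, 31]), (12, [1, 2, 3, 17, 30, 31]), (12, [1, 2, 3, 18, 30, 31]),
   (6, [1, 2, 3, 25, 27, 32]), (2, [1, 2, 4, 16, 26, 31]), (12, [1, 2, 6, 7, 15, 17]),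
   (6, [1, 2, 6, 16, 18, 36])]

/-- The pairs `(λ, base block)` of the designs for `PΓL(2,8)`; each base block is the
lexicographically first block of its design. -/
def pgammalTable : List (ℕ × List ℕ) :=
  [(36, [1, 2, 3, 4, 5, 18]), (36, [1, 2, 3, 4, 5, 20]), (36, [1, 2, 3, 4, 5, 21]),
   (36, [1, 2, 3, 4, 5, 22]), (36, [1, 2, 3, 4, 5, 24]), (36, [1, 2, 3, 4, 5, 26]),
   (36, [1, 2, 3, 4, 5, 28]), (36, [1, 2, 3, 4, 5, 31]), (36, [1, 2, 3, 4, 5, 35]),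
   (36, [1, 2, 3, 4, 6, 9]), (36, [1, 2, 3, 4, 6, 20]), (36, [1, 2, 3, 4, 6, 22]),
   (36, [1, 2, 3, 4, 6, 24]), (36, [1, 2, 3, 4, 6, 27]), (36, [1, 2, 3, 4, 6, 28]),
   (36, [1, 2, 3, 4, 6, 30]), (36, [1, 2, 3, 4, 6, 31]), (36, [1, 2, 3, 4, 6, 35]),
   (36, [1, 2, 3, 4, 7, 12]), (36, [1, 2, 3, 4, 7, 17]), (36, [1, 2, 3, 4, 7, 18]),
   (36, [1, 2, 3, 4, 7, 20]), (36, [1, 2, 3, 4, 7, 21]), (36, [1, 2, 3, 4, 7, 22]),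
   (36, [1, 2, 3, 4, 7, 26]), (36, [1, 2, 3, 4, 7, 34]), (36, [1, 2, 3, 4, 7, 35]),
   (36, [1, 2, 3, 4, 8, 9]), (36, [1, 2, 3, 4, 8, 12]), (36, [1, 2, 3, 4, 8, 17]),
   (36, [1, 2, 3, 4, 8, 18]), (36, [1, 2, 3, 4, 8, 21]), (36, [1, 2, 3, 4, 8, 26]),
   (36, [1, 2, 3, 4, 8, 27]), (36, [1, 2, 3, 4, 8, 30]), (36, [1, 2, 3, 4, 8, 34]),
   (36, [1, 2, 3, 4, 9, 10]), (36, [1, 2, 3, 4, 9, 12]), (36, [1, 2, 3, 4, 9, 15]),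
   (36, [1, 2, 3, 4, 9, 16]), (36, [1, 2, 3, 4, 9, 18]), (36, [1, 2, 3, 4, 9, 19]),
   (36, [1, 2, 3, 4, 9, 20]), (36, [1, 2, 3, 4, 9, 24]), (36, [1, 2, 3, 4, 9, 27]),
   (36, [1, 2, 3, 4, 10, 12]), (36, [1, 2, 3, 4, 10, 17]), (36, [1, 2, 3, 4, 10, 24]),
   (36, [1, 2, 3, 4, 10, 27]), (36, [1, 2, 3, 4, 10, 28]), (36, [1, 2, 3, 4, 10, 30]),
   (36, [1, 2, 3, 4, 10, 31]), (36, [1, 2, 3, 4, 10, 34]), (36, [1, 2, 3, 4, 11, 12]),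
   (36, [1, 2, 3, 4, 11, 17]), (36, [1, 2, 3, 4, 11, 18]), (36, [1, 2, 3, 4, 11, 21]),
   (36, [1, 2, 3, 4, 11, 24]), (36, [1, 2, 3, 4, 11, 26]), (36, [1, 2, 3, 4, 11, 28]),
   (36, [1, 2, 3, 4, 11, 31]), (36, [1, 2, 3, 4, 11, 34]), (36, [1, 2, 3, 4, 12, 15]),
   (36, [1, 2, 3, 4, 12, 17]), (36, [1, 2, 3, 4, 12, 18]), (36, [1, 2, 3, 4, 12, 20]),
   (36, [1, 2, 3, 4, 12, 24]), (36, [1, 2, 3, 4, 12, 34]), (9, [1, 2, 3, 4, 13, 32]),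
   (36, [1, 2, 3, 4, 15, 17]), (36, [1, 2, 3, 4, 15, 20]), (36, [1, 2, 3, 4, 15, 22]),
   (36, [1, 2, 3, 4, 15, 27]), (36, [1, 2, 3, 4, 15, 30]), (36, [1, 2, 3, 4, 15, 34]),
   (36, [1, 2, 3, 4, 15, 35]), (36, [1, 2, 3, 4, 16, 18]), (36, [1, 2, 3, 4, 16, 21]),
   (36, [1, 2, 3, 4, 16, 24]), (36, [1, 2, 3, 4, 16, 26]), (36, [1, 2, 3, 4, 16, 28]),
   (36, [1, 2, 3, 4, 16, 30]), (36, [1, 2, 3, 4, 16, 31]), (36, [1, 2, 3, 4, 17, 21]),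
   (36, [1, 2, 3, 4, 17, 22]), (36, [1, 2, 3, 4, 17, 28]), (36, [1, 2, 3, 4, 17, 34]),
   (36, [1, 2, 3, 4, 18, 19]), (36, [1, 2, 3, 4, 18, 20]), (18, [1, 2, 3, 4, 18, 21]),
   (36, [1, 2, 3, 4, 18, 24]), (36, [1, 2, 3, 4, 18, 26]), (36, [1, 2, 3, 4, 19, 20]),
   (36, [1, 2, 3, 4, 19, 21]), (36, [1, 2, 3, 4, 19, 22]), (36, [1, 2, 3, 4, 19, 26]),
   (36, [1, 2, 3, 4, 19, 35]), (18, [1, 2, 3, 4, 20, 22]), (36, [1, 2, 3, 4, 20, 24]),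
   (36, [1, 2, 3, 4, 20, 35]), (36, [1, 2, 3, 4, 21, 22]), (36, [1, 2, 3, 4, 21, 27]),
   (36, [1, 2, 3, 4, 21, 28]), (36, [1, 2, 3, 4, 22, 28]), (36, [1, 2, 3, 4, 22, 35]),
   (36, [1, 2, 3, 4, 24, 31]), (36, [1, 2, 3, 4, 25, 33]), (36, [1, 2, 3, 4, 26, 31]),
   (36, [1, 2, 3, 4, 26, 34]), (36, [1, 2, 3, 4, 26, 35]), (6, [1, 2, 3, 4, 27, 30]),
   (18, [1, 2, 3, 4, 28, 31]), (36, [1, 2, 3, 4, 31, 34]), (36, [1, 2, 3, 4, 31, 35]),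
   (36, [1, 2, 3, 4, 34, 35]), (2, [1, 2, 3, 5, 6, 8]), (36, [1, 2, 3, 5, 6, 9]),
   (36, [1, 2, 3, 5, 6, 12]), (36, [1, 2, 3, 5, 6, 13]), (36, [1, 2, 3, 5, 6, 17]),
   (36, [1, 2, 3, 5, 9, 10]), (36, [1, 2, 3, 5, 9, 12]), (36, [1, 2, 3, 5, 9, 15]),
   (36, [1, 2, 3, 5, 9, 16]), (36, [1, 2, 3, 5, 9, 18]), (36, [1, 2, 3, 5, 9, 19]),
   (36, [1, 2, 3, 5, 9, 20]), (36, [1, 2, 3, 5, 9, 24]), (6, [1, 2, 3, 5, 9, 29]),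
   (36, [1, 2, 3, 5, 10, 13]), (18, [1, 2, 3, 5, 10, 19]), (36, [1, 2, 3, 5, 10, 20]),
   (36, [1, 2, 3, 5, 10, 26]), (36, [1, 2, 3, 5, 10, 30]), (36, [1, 2, 3, 5, 12, 13]),
   (36, [1, 2, 3, 5, 12, 16]), (36, [1, 2, 3, 5, 12, 19]), (36, [1, 2, 3, 5, 13, 15]),
   (36, [1, 2, 3, 5, 13, 16]), (36, [1, 2, 3, 5, 13, 18]), (36, [1, 2, 3, 5, 13, 19]),
   (36, [1, 2, 3, 5, 13, 20]), (36, [1, 2, 3, 5, 13, 24]), (18, [1, 2, 3, 5, 13, 30]),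
   (18, [1, 2, 3, 5, 15, 16]), (36, [1, 2, 3, 5, 15, 18]), (36, [1, 2, 3, 5, 15, 21]),
   (36, [1, 2, 3, 5, 15, 24]), (36, [1, 2, 3, 5, 15, 30]), (36, [1, 2, 3, 5, 15, 31]),
   (36, [1, 2, 3, 5, 15, 33]), (36, [1, 2, 3, 5, 17, 19]), (36, [1, 2, 3, 5, 19, 30]),
   (36, [1, 2, 3, 5, 19, 31]), (18, [1, 2, 3, 5, 23, 25]), (36, [1, 2, 3, 5, 23, 32]),
   (36, [1, 2, 3, 5, 26, 30]), (36, [1, 2, 3, 5, 26, 33]), (36, [1, 2, 3, 5, 30, 31]),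
   (36, [1, 2, 3, 5, 30, 34]), (36, [1, 2, 3, 7, 8, 12]), (36, [1, 2, 3, 7, 8, 17]),
   (36, [1, 2, 3, 7, 8, 25]), (36, [1, 2, 3, 7, 8, 32]), (36, [1, 2, 3, 7, 8, 34]),
   (36, [1, 2, 3, 7, 8, 36]), (36, [1, 2, 3, 7, 9, 12]), (36, [1, 2, 3, 7, 9, 16]),
   (36, [1, 2, 3, 7, 9, 21]), (36, [1, 2, 3, 7, 9, 25]), (36, [1, 2, 3, 7, 9, 26]),
   (36, [1, 2, 3, 7, 9, 36]), (36, [1, 2, 3, 7, 11, 12]), (36, [1, 2, 3, 7, 11, 25]),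
   (36, [1, 2, 3, 7, 11, 34]), (36, [1, 2, 3, 7, 11, 36]), (36, [1, 2, 3, 7, 12, 19]),
   (36, [1, 2, 3, 7, 12, 24]), (36, [1, 2, 3, 7, 13, 16]), (36, [1, 2, 3, 7, 13, 22]),
   (36, [1, 2, 3, 7, 13, 25]), (36, [1, 2, 3, 7, 13, 26]), (36, [1, 2, 3, 7, 13, 35]),
   (36, [1, 2, 3, 7, 13, 36]), (36, [1, 2, 3, 7, 14, 25]), (36, [1, 2, 3, 7, 14, 32]),
   (36, [1, 2, 3, 7, 14, 34]), (36, [1, 2, 3, 7, 14, 36]), (36, [1, 2, 3, 7, 15, 17]),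
   (36, [1, 2, 3, 7, 15, 25]), (36, [1, 2, 3, 7, 15, 32]), (36, [1, 2, 3, 7, 15, 34]),
   (36, [1, 2, 3, 7, 16, 20]), (36, [1, 2, 3, 7, 16, 24]), (36, [1, 2, 3, 7, 16, 29]),
   (36, [1, 2, 3, 7, 16, 31]), (36, [1, 2, 3, 7, 16, 33]), (36, [1, 2, 3, 7, 17, 19]),
   (36, [1, 2, 3, 7, 17, 27]), (36, [1, 2, 3, 7, 17, 28]), (36, [1, 2, 3, 7, 17, 29]),
   (36, [1, 2, 3, 7, 18, 26]), (36, [1, 2, 3, 7, 18, 27]), (36, [1, 2, 3, 7, 18, 28]),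
   (36, [1, 2, 3, 7, 18, 30]), (36, [1, 2, 3, 7, 18, 31]), (36, [1, 2, 3, 7, 18, 33]),
   (36, [1, 2, 3, 7, 19, 20]), (36, [1, 2, 3, 7, 19, 21]), (36, [1, 2, 3, 7, 19, 22]),
   (36, [1, 2, 3, 7, 19, 34]), (36, [1, 2, 3, 7, 20, 27]), (36, [1, 2, 3, 7, 20, 29]),
   (36, [1, 2, 3, 7, 20, 31]), (36, [1, 2, 3, 7, 20, 33]), (18, [1, 2, 3, 7, 21, 22]),
   (36, [1, 2, 3, 7, 21, 24]), (36, [1, 2, 3, 7, 21, 30]), (36, [1, 2, 3, 7, 22, 31]),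
   (36, [1, 2, 3, 7, 22, 33]), (36, [1, 2, 3, 7, 24, 26]), (36, [1, 2, 3, 7, 24, 36]),
   (36, [1, 2, 3, 7, 25, 27]), (36, [1, 2, 3, 7, 25, 28]), (36, [1, 2, 3, 7, 25, 29]),
   (36, [1, 2, 3, 7, 26, 27]), (36, [1, 2, 3, 7, 26, 35]), (36, [1, 2, 3, 7, 27, 32]),
   (36, [1, 2, 3, 7, 28, 32]), (36, [1, 2, 3, 7, 28, 35]), (36, [1, 2, 3, 7, 29, 32]),
   (36, [1, 2, 3, 7, 29, 35]), (36, [1, 2, 3, 7, 30, 34]), (36, [1, 2, 3, 7, 30, 36]),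
   (36, [1, 2, 3, 7, 31, 32]), (36, [1, 2, 3, 7, 31, 36]), (36, [1, 2, 3, 7, 32, 33]),
   (36, [1, 2, 3, 7, 33, 34]), (36, [1, 2, 3, 7, 33, 36]), (18, [1, 2, 3, 8, 9, 18]),
   (36, [1, 2, 3, 8, 9, 28]), (36, [1, 2, 3, 8, 9, 31]), (36, [1, 2, 3, 8, 10, 17]),
   (36, [1, 2, 3, 8, 10, 25]), (36, [1, 2, 3, 8, 10, 32]), (36, [1, 2, 3, 8, 10, 36]),
   (36, [1, 2, 3, 8, 12, 13]), (36, [1, 2, 3, 8, 12, 24]), (36, [1, 2, 3, 8, 13, 26]),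
   (36, [1, 2, 3, 8, 18, 33]), (36, [1, 2, 3, 9, 11, 12]), (36, [1, 2, 3, 9, 11, 21]),
   (36, [1, 2, 3, 9, 11, 25]), (36, [1, 2, 3, 9, 11, 28]), (36, [1, 2, 3, 9, 11, 31]),
   (36, [1, 2, 3, 9, 11, 36]), (36, [1, 2, 3, 9, 12, 20]), (36, [1, 2, 3, 9, 13, 16]),
   (36, [1, 2, 3, 9, 13, 19]), (36, [1, 2, 3, 9, 13, 26]), (36, [1, 2, 3, 9, 13, 31]),
   (36, [1, 2, 3, 9, 14, 16]), (36, [1, 2, 3, 9, 14, 19]), (36, [1, 2, 3, 9, 14, 28]),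
   (36, [1, 2, 3, 9, 17, 23]), (36, [1, 2, 3, 9, 20, 36]), (36, [1, 2, 3, 9, 23, 34]),
   (36, [1, 2, 3, 10, 11, 12]), (36, [1, 2, 3, 10, 11, 25]), (36, [1, 2, 3, 10, 11, 34]),
   (36, [1, 2, 3, 10, 12, 13]), (36, [1, 2, 3, 10, 12, 15]), (36, [1, 2, 3, 10, 12, 16]),
   (36, [1, 2, 3, 10, 12, 20]), (36, [1, 2, 3, 10, 12, 23]), (36, [1, 2, 3, 10, 13, 19]),
   (36, [1, 2, 3, 10, 13, 28]), (36, [1, 2, 3, 10, 13, 30]), (36, [1, 2, 3, 10, 13, 31]),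
   (36, [1, 2, 3, 10, 15, 34]), (36, [1, 2, 3, 10, 15, 36]), (36, [1, 2, 3, 10, 16, 27]),
   (36, [1, 2, 3, 10, 16, 30]), (36, [1, 2, 3, 10, 16, 34]), (36, [1, 2, 3, 10, 17, 23]),
   (36, [1, 2, 3, 10, 19, 22]), (36, [1, 2, 3, 10, 19, 33]), (36, [1, 2, 3, 10, 22, 24]),
   (36, [1, 2, 3, 10, 22, 25]), (36, [1, 2, 3, 10, 23, 25]), (36, [1, 2, 3, 10, 23, 32]),
   (36, [1, 2, 3, 10, 23, 34]), (36, [1, 2, 3, 10, 23, 36]), (6, [1, 2, 3, 10, 27, 28]),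
   (18, [1, 2, 3, 10, 30, 31]), (36, [1, 2, 3, 10, 33, 34]), (36, [1, 2, 3, 11, 12, 20]),
   (36, [1, 2, 3, 11, 14, 25]), (36, [1, 2, 3, 11, 14, 32]), (36, [1, 2, 3, 11, 14, 34]),
   (36, [1, 2, 3, 11, 14, 36]), (12, [1, 2, 3, 11, 17, 22]), (36, [1, 2, 3, 11, 17, 29]),
   (36, [1, 2, 3, 11, 20, 36]), (36, [1, 2, 3, 11, 22, 25]), (36, [1, 2, 3, 11, 29, 32]),
   (36, [1, 2, 3, 11, 34, 35]), (36, [1, 2, 3, 12, 13, 25]), (36, [1, 2, 3, 12, 13, 36]),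
   (36, [1, 2, 3, 12, 15, 18]), (12, [1, 2, 3, 12, 15, 19]), (36, [1, 2, 3, 13, 16, 18]),
   (18, [1, 2, 3, 13, 16, 22]), (36, [1, 2, 3, 13, 16, 24]), (36, [1, 2, 3, 13, 18, 30]),
   (36, [1, 2, 3, 13, 18, 35]), (36, [1, 2, 3, 13, 19, 20]), (36, [1, 2, 3, 13, 19, 31]),
   (36, [1, 2, 3, 13, 20, 26]), (12, [1, 2, 3, 13, 26, 30]), (36, [1, 2, 3, 14, 18, 32]),
   (36, [1, 2, 3, 14, 19, 20]), (36, [1, 2, 3, 14, 20, 36]), (36, [1, 2, 3, 15, 17, 29]),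
   (36, [1, 2, 3, 15, 19, 30]), (36, [1, 2, 3, 15, 20, 35]), (6, [1, 2, 3, 15, 22, 27]),
   (36, [1, 2, 3, 15, 29, 35]), (36, [1, 2, 3, 18, 26, 30]), (12, [1, 2, 7, 9, 25, 26])]

/-- Every entry `(λ, B)` of `L` gives a `2`-`(36, 6, λ)` design with block set `B^G`, which admits
`G` as a block-transitive automorphism group, and designs of different entries are
non-isomorphic. -/
structure IsExactList (G : Subgroup (Equiv.Perm (Fin 36))) (L : List (ℕ × List ℕ)) : Prop where
  isDesign : ∀ e ∈ L, IsDesign 2 36 6 e.1 (listedBlocks G e)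
  isAutGroup : ∀ e ∈ L, IsAutGroup G (listedBlocks G e)
  isBlockTransitive : ∀ e ∈ L, IsBlockTransitive G (listedBlocks G e)
  not_isomorphic : L.Pairwise fun e e' => ¬ DesignIsomorphic (listedBlocks G e) (listedBlocks G e')

/-! The index of PSL(2,8) in PΓL(2,8) is 3, so these are the only two groups to treat. Block's lemma
(`IsDesign.exists_apply_eq`) makes `G` transitive on the 36 points, and the action is then forced. A
point stabilizer has order 14 or 42, hence a normal Sylow 7-subgroup, and an element of order 7
fixes some point because 36 ≡ 1 mod 7. In the action on the 36 pairs of points of the projective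
line such an element fixes exactly one pair, so the point stabilizer fixes that pair, and by orders
it is the stabilizer of that pair (`exists_equivariant_equiv_of_fixed`). One may therefore take `G`
to be X* or Y* on the numbered edges of K₉, and the block set to be one orbit of `G`.

Let `cover G B T` count the `g` in `G` with `T` ⊆ `gB`. It equals the number of blocks of the orbit
through `T` times the order of the stabilizer of `B`. Averaging over the 630 pairs shows that the
orbit of a 6-set is a 2-design exactly when its covers of pairs are all |G|/42, that is 12 or 36.
This needs checking only at representatives of the orbits on pairs, of which there are 4 or 2.

Completeness is a count. The cover of a pair by a 6-set is the sum of its covers by the 15 pairs of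
points of the set, so a search over the 4-subsets of 34 points bounds the number of 6-sets through
{0, 1} with the right covers by 1436 or 11405. Every listed orbit supplies λ such sets, and
different orbits are disjoint. The λ's of T₂ add up to 11405. For T₁ the Frobenius map normalizes
X*, an entry stands for one or three orbits, and with these multiplicities the sum reaches 1436. So
no orbit is missed. Non-isomorphism follows from an invariant built from the covers of subsets of
the base block.

For the numerical checks each group is enumerated by a stabilizer chain, and the images of a point
under all group elements are packed into one number with 36-bit words. A cover is then obtained from
a few bitwise operations and one remainder modulo 2^36 - 1. -/

/-! ### Orbits of blocks and the number of group elements covering a point set -/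

section Cover

variable {P : Type*}

theorem moveBlock_one (B : Finset P) : moveBlock (1 : Equiv.Perm P) B = B := by
  ext x; simp only [moveBlock, Finset.mem_map_equiv]; rfl

theorem moveBlock_mul (g h : Equiv.Perm P) (B : Finset P) :
    moveBlock (g * h) B = moveBlock g (moveBlock h B) := by
  ext x; simp only [moveBlock, Finset.mem_map_equiv]; rfl

theorem moveBlock_trans {Q R : Type*} (f : P ≃ Q) (g : Q ≃ R) (B : Finset P) :
    moveBlock (f.trans g) B = moveBlock g (moveBlock f B) := by
  ext x; simp only [moveBlock, Finset.mem_map_equiv]; rfl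

theorem mem_moveBlock {Q : Type*} (f : P ≃ Q) (B : Finset P) (y : Q) :
    y ∈ moveBlock f B ↔ f.symm y ∈ B := by
  simp only [moveBlock, Finset.mem_map_equiv]

theorem moveBlock_subset_moveBlock {Q : Type*} (f : P ≃ Q) (B C : Finset P) :
    moveBlock f B ⊆ moveBlock f C ↔ B ⊆ C :=
  Finset.map_subset_map

theorem moveBlock_injective {Q : Type*} (f : P ≃ Q) : Function.Injective (moveBlock f) :=
  Finset.map_injective _

theorem card_moveBlock {Q : Type*} (f : P ≃ Q) (B : Finset P) : (moveBlock f B).card = B.card :=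
  Finset.card_map _

theorem moveBlock_symm_moveBlock {Q : Type*} (f : P ≃ Q) (B : Finset P) :
    moveBlock f.symm (moveBlock f B) = B := by
  ext x; simp [mem_moveBlock]

theorem moveBlock_moveBlock_symm {Q : Type*} (f : P ≃ Q) (B : Finset Q) :
    moveBlock f (moveBlock f.symm B) = B := by
  ext x; simp [mem_moveBlock]

theorem moveBlock_inv_subset (g : Equiv.Perm P) (B C : Finset P) :
    moveBlock g⁻¹ B ⊆ C ↔ B ⊆ moveBlock g C := by
  rw [← moveBlock_subset_moveBlock g, ← moveBlock_mul, mul_inv_cancel, moveBlock_one]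

theorem moveBlock_insert {Q : Type*} [DecidableEq P] [DecidableEq Q] (f : P ≃ Q) (x : P)
    (B : Finset P) : moveBlock f (insert x B) = insert (f x) (moveBlock f B) := by
  simp [moveBlock]

theorem self_mem_orbitBlocks (G : Subgroup (Equiv.Perm P)) (B : Finset P) :
    B ∈ orbitBlocks G B := ⟨1, G.one_mem, moveBlock_one B⟩

theorem orbitBlocks_eq_of_mem {G : Subgroup (Equiv.Perm P)} {B C : Finset P}
    (h : C ∈ orbitBlocks G B) : orbitBlocks G C = orbitBlocks G B := by
  obtain ⟨g, hg, rfl⟩ := h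
  ext D
  constructor
  · rintro ⟨k, hk, rfl⟩
    exact ⟨k * g, G.mul_mem hk hg, moveBlock_mul _ _ _⟩
  · rintro ⟨k, hk, rfl⟩
    exact ⟨k * g⁻¹, G.mul_mem hk (G.inv_mem hg), by rw [← moveBlock_mul]; simp⟩

theorem isAutGroup_orbitBlocks (G : Subgroup (Equiv.Perm P)) (B : Finset P) :
    IsAutGroup G (orbitBlocks G B) := by
  intro g hg C
  constructor
  · rintro ⟨k, hk, h⟩
    exact ⟨g⁻¹ * k, G.mul_mem (G.inv_mem hg) hk, by
      rw [moveBlock_mul, h, ← moveBlock_mul, inv_mul_cancel, moveBlock_one]⟩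
  · rintro ⟨k, hk, rfl⟩
    exact ⟨g * k, G.mul_mem hg hk, moveBlock_mul _ _ _⟩

theorem isBlockTransitive_orbitBlocks (G : Subgroup (Equiv.Perm P)) (B : Finset P) :
    IsBlockTransitive G (orbitBlocks G B) := by
  rintro _ ⟨g, hg, rfl⟩ _ ⟨h, hh, rfl⟩
  exact ⟨h * g⁻¹, G.mul_mem hh (G.inv_mem hg), by rw [← moveBlock_mul]; simp⟩

variable [Fintype P] [DecidableEq P]

open Classical in
/-- The elements of `G` that move the block `B` onto a block containing `T`. -/
noncomputable def movers (G : Subgroup (Equiv.Perm P)) (B T : Finset P) :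
    Finset (Equiv.Perm P) :=
  Finset.univ.filter fun g => g ∈ G ∧ T ⊆ moveBlock g B

/-- The number of elements of `G` that move the block `B` onto a block containing `T`. -/
noncomputable def cover (G : Subgroup (Equiv.Perm P)) (B T : Finset P) : ℕ :=
  (movers G B T).card

theorem mem_movers {G : Subgroup (Equiv.Perm P)} {B T : Finset P} {g : Equiv.Perm P} :
    g ∈ movers G B T ↔ g ∈ G ∧ T ⊆ moveBlock g B := by
  simp [movers]

/-- Left multiplication by `h` matches the two sets of movers. A condition on the covers of all
pairs thus reduces to representatives of the orbits on pairs. -/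
theorem cover_move {G : Subgroup (Equiv.Perm P)} {h : Equiv.Perm P} (hh : h ∈ G)
    (B T : Finset P) : cover G B (moveBlock h T) = cover G B T := by
  refine Finset.card_nbij' (fun g => h⁻¹ * g) (fun g => h * g) ?_ ?_ ?_ ?_
  · intro g hg
    obtain ⟨h1, h2⟩ := mem_movers.1 hg
    refine mem_movers.2 ⟨G.mul_mem (G.inv_mem hh) h1, ?_⟩
    rwa [← moveBlock_subset_moveBlock h, ← moveBlock_mul, mul_inv_cancel_left]
  · intro g hg
    obtain ⟨h1, h2⟩ := mem_movers.1 hg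
    refine mem_movers.2 ⟨G.mul_mem hh h1, ?_⟩
    rwa [moveBlock_mul, moveBlock_subset_moveBlock]
  · intro g _; simp
  · intro g _; simp

theorem cover_self_pos (G : Subgroup (Equiv.Perm P)) (B : Finset P) : 0 < cover G B B :=
  Finset.card_pos.2 ⟨1, mem_movers.2 ⟨G.one_mem, by rw [moveBlock_one]⟩⟩

theorem cover_empty (G : Subgroup (Equiv.Perm P)) (B : Finset P) :
    cover G B ∅ = Nat.card G := by
  rw [← SetLike.coe_sort_coe, Nat.card_coe_set_eq, cover, ← Set.ncard_coe_finset]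
  congr 1
  ext g
  simp [mem_movers]

/-- The number of blocks of an orbit that contain `T`, times the order of the stabilizer. -/
theorem ncard_orbitBlocks_mul (G : Subgroup (Equiv.Perm P)) (B T : Finset P) :
    {C ∈ orbitBlocks G B | T ⊆ C}.ncard * cover G B B = cover G B T := by
  have himg : {C ∈ orbitBlocks G B | T ⊆ C} =
      ((movers G B T).image fun g => moveBlock g B : Finset (Finset P)) := by
    ext C
    simp only [Set.mem_ofPred_eq, Finset.coe_image, Set.mem_image, Finset.mem_coe, mem_movers,
      orbitBlocks]
    constructor
    · rintro ⟨⟨g, hg, rfl⟩, hT⟩; exact ⟨g, ⟨hg, hT⟩, rfl⟩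
    · rintro ⟨g, ⟨hg, hT⟩, rfl⟩; exact ⟨⟨g, hg, rfl⟩, hT⟩
  -- The fibre of `g ↦ gB` over `kB` is the coset of the stabilizer of `B` through `k`, so all
  -- fibres have the same size.
  rw [himg, Set.ncard_coe_finset, cover, cover,
    Finset.card_eq_sum_card_image (fun g => moveBlock g B) (movers G B T),
    Finset.sum_const_nat (m := (movers G B B).card)]
  intro C hC
  obtain ⟨k, hk, rfl⟩ := Finset.mem_image.1 hC
  obtain ⟨hkG, hkT⟩ := mem_movers.1 hk
  refine Finset.card_nbij' (fun g => k⁻¹ * g) (fun g => k * g) ?_ ?_ ?_ ?_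
  · intro g hg
    obtain ⟨h1, h2⟩ := Finset.mem_filter.1 hg
    refine mem_movers.2 ⟨G.mul_mem (G.inv_mem hkG) (mem_movers.1 h1).1, ?_⟩
    rw [moveBlock_mul, h2, ← moveBlock_mul, inv_mul_cancel, moveBlock_one]
  · intro g hg
    obtain ⟨h1, h2⟩ := mem_movers.1 hg
    -- A finite set contained in its image under a permutation equals that image, so `cover G B B`
    -- is the order of the stabilizer of `B`.
    have h3 : moveBlock g B = B :=
      (Finset.eq_of_subset_of_card_le h2 (card_moveBlock g B).le).symm
    have h4 : moveBlock (k * g) B = moveBlock k B := by rw [moveBlock_mul, h3]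
    simp only [Finset.coe_filter, Set.mem_ofPred_eq, mem_movers]
    exact ⟨⟨G.mul_mem hkG h1, by rwa [h4]⟩, h4⟩
  · intro g _; simp
  · intro g _; simp

/-- Each block `B^g` contains `k(k-1)/2` pairs. -/
theorem sum_cover_pairs (G : Subgroup (Equiv.Perm P)) (B : Finset P) (t : ℕ) :
    ∑ T ∈ Finset.powersetCard t Finset.univ, cover G B T = Nat.card G * B.card.choose t := by
  classical
  simp only [cover, movers, Finset.card_filter]
  rw [Finset.sum_comm]
  have h : ∀ g : Equiv.Perm P, (∑ T ∈ Finset.powersetCard t Finset.univ,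
      if g ∈ G ∧ T ⊆ moveBlock g B then 1 else 0) = if g ∈ G then B.card.choose t else 0 := by
    intro g
    by_cases hg : g ∈ G
    · simp only [hg, true_and, if_true]
      rw [← Finset.sum_filter, ← Finset.card_eq_sum_ones, ← card_moveBlock g,
        ← Finset.card_powersetCard]
      congr 1
      ext T
      simp [Finset.mem_powersetCard, and_comm]
    · simp [hg]
  simp only [h]
  rw [← Finset.sum_filter, Finset.sum_const, smul_eq_mul]
  congr 1
  rw [← cover_empty G B, cover]
  congr 1
  ext g
  simp [mem_movers]

end Cover

/-! ### Designs formed by one orbit of blocks -/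

/-- An isomorphism between two orbits of blocks can be chosen to match the base blocks. -/
theorem exists_iso_base {P : Type*} {G : Subgroup (Equiv.Perm P)} {B B' : Finset P}
    (h : DesignIsomorphic (orbitBlocks G B) (orbitBlocks G B')) :
    ∃ f : Equiv.Perm P, IsDesignIso f (orbitBlocks G B) (orbitBlocks G B') ∧
      moveBlock f B = B' := by
  obtain ⟨f, hf⟩ := h
  obtain ⟨g, hg, h⟩ := (hf B).2 (self_mem_orbitBlocks G B)
  refine ⟨g⁻¹ * f, fun C => ?_, ?_⟩
  · rw [moveBlock_mul, isAutGroup_orbitBlocks G B' g⁻¹ (G.inv_mem hg), hf]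
  · rw [moveBlock_mul, ← h, ← moveBlock_mul, inv_mul_cancel, moveBlock_one]

theorem IsDesignIso.ncard_eq {P : Type*} {b b' : Set (Finset P)} {f : Equiv.Perm P}
    (hf : IsDesignIso f b b')
    (T : Finset P) : {C ∈ b' | moveBlock f T ⊆ C}.ncard = {C ∈ b | T ⊆ C}.ncard := by
  rw [← Set.ncard_image_of_injective {C ∈ b | T ⊆ C} (moveBlock_injective f)]
  congr 1
  ext C
  simp only [Set.mem_ofPred_eq, Set.mem_image]
  constructor
  · rintro ⟨h1, h2⟩
    refine ⟨moveBlock f.symm C, ⟨(hf _).1 (by rwa [moveBlock_moveBlock_symm]), ?_⟩,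
      moveBlock_moveBlock_symm _ _⟩
    rwa [← moveBlock_subset_moveBlock f, moveBlock_moveBlock_symm]
  · rintro ⟨D, ⟨h1, h2⟩, rfl⟩
    exact ⟨(hf _).2 h1, (moveBlock_subset_moveBlock _ _ _).2 h2⟩

section OrbitDesign

variable {P : Type*} [Fintype P] [DecidableEq P]

theorem isDesign_orbitBlocks {G : Subgroup (Equiv.Perm P)} {B : Finset P} {lam c : ℕ}
    (hP : Fintype.card P = 36) (hB : B.card = 6) (hc : 0 < c)
    (h : ∀ T : Finset P, T.card = 2 → cover G B T = c) (hlam : lam * cover G B B = c) :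
    IsDesign 2 36 6 lam (orbitBlocks G B) where
  card_points := hP
  card_block := by
    rintro _ ⟨g, -, rfl⟩
    rw [card_moveBlock, hB]
  lam_pos := by
    rcases Nat.eq_zero_or_pos lam with h0 | h0
    · simp [h0] at hlam; omega
    · exact h0
  balanced T hT := by
    have := ncard_orbitBlocks_mul G B T
    rw [h T hT, ← hlam] at this
    exact Nat.eq_of_mul_eq_mul_right (cover_self_pos G B) this

/-- The cover has the constant value λ·|G_B| on the 630 pairs, while the total is 15·|G| = 15·42·c.
Hence the constant is `c`, whatever λ is. -/
theorem IsDesign.cover_eq {G : Subgroup (Equiv.Perm P)} {B : Finset P} {lam c : ℕ}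
    (hD : IsDesign 2 36 6 lam (orbitBlocks G B)) (hG : Nat.card G = 42 * c) :
    (∀ T : Finset P, T.card = 2 → cover G B T = c) ∧ lam * cover G B B = c := by
  have hB : B.card = 6 := hD.card_block B (self_mem_orbitBlocks G B)
  have h1 : ∀ T : Finset P, T.card = 2 → cover G B T = lam * cover G B B := fun T hT => by
    rw [← ncard_orbitBlocks_mul, hD.balanced T hT]
  have h2 := sum_cover_pairs G B 2
  rw [Finset.sum_congr rfl fun T hT => h1 T (Finset.mem_powersetCard.1 hT).2, Finset.sum_const,
    Finset.card_powersetCard, Finset.card_univ, hD.card_points, hB, hG] at h2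
  have h3 : Nat.choose 36 2 = 630 := by decide
  have h4 : Nat.choose 6 2 = 15 := by decide
  rw [h3, h4, smul_eq_mul] at h2
  have h5 : lam * cover G B B = c := by omega
  exact ⟨fun T hT => (h1 T hT).trans h5, h5⟩

/-- Isomorphic orbits have equally many blocks, and block number times stabilizer order is |G| (the
case `T = ∅`), so the stabilizers have equal orders. Covers of sets of any size are therefore
preserved, not only numbers of blocks. -/
theorem cover_iso {G : Subgroup (Equiv.Perm P)} {B B' : Finset P} {f : Equiv.Perm P}
    (hf : IsDesignIso f (orbitBlocks G B) (orbitBlocks G B')) (T : Finset P) :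
    cover G B' (moveBlock f T) = cover G B T := by
  have key := hf.ncard_eq
  have h0 := ncard_orbitBlocks_mul G B ∅
  have h0' := ncard_orbitBlocks_mul G B' ∅
  have hE : moveBlock f (∅ : Finset P) = ∅ := by simp [moveBlock]
  have h1 := key ∅
  rw [hE] at h1
  rw [h1, cover_empty, ← cover_empty G B, ← h0] at h0'
  have hpos : 0 < {C ∈ orbitBlocks G B | ∅ ⊆ C}.ncard :=
    (Set.ncard_pos (Set.toFinite _)).2 ⟨B, self_mem_orbitBlocks G B, by simp⟩
  have h2 : cover G B' B' = cover G B B := Nat.eq_of_mul_eq_mul_left hpos h0'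
  rw [← ncard_orbitBlocks_mul G B' (moveBlock f T), key, h2, ncard_orbitBlocks_mul]

/-- A numerical isomorphism invariant of the design `B^G`. -/
noncomputable def orbitInvariant (G : Subgroup (Equiv.Perm P)) (B : Finset P) : ℕ :=
  ∑ x ∈ B, (∑ T ∈ Finset.powersetCard 3 B, cover G B (insert x T) ^ 2) ^ 2

/-- After composition with an element of `G` the isomorphism sends `B` to `B'`, and it preserves
covers, so the two sums agree term by term. The point `x` may lie in `T`; then a triple is covered
instead of a quadruple. -/
theorem orbitInvariant_eq {G : Subgroup (Equiv.Perm P)} {B B' : Finset P}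
    (h : DesignIsomorphic (orbitBlocks G B) (orbitBlocks G B')) :
    orbitInvariant G B = orbitInvariant G B' := by
  obtain ⟨f, hf, rfl⟩ := exists_iso_base h
  have h1 := cover_iso hf
  unfold orbitInvariant
  rw [show moveBlock f B = B.map f.toEmbedding from rfl, Finset.sum_map, Finset.powersetCard_map]
  refine Finset.sum_congr rfl fun x _ => ?_
  rw [Finset.sum_map]
  congr 1
  refine Finset.sum_congr rfl fun T _ => ?_
  congr 1
  rw [← h1, moveBlock_insert]
  rfl

theorem card_foldr_union {α : Type*} [DecidableEq α] :
    ∀ l : List (Finset α), l.Pairwise Disjoint →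
      (l.foldr (· ∪ ·) ∅).card = (l.map Finset.card).sum
  | [], _ => rfl
  | s :: l, h => by
    obtain ⟨h1, h2⟩ := List.pairwise_cons.1 h
    have h3 : Disjoint s (l.foldr (· ∪ ·) ∅) := by
      clear h h2
      induction l with
      | nil => simp
      | cons t l ih =>
        rw [List.foldr_cons, Finset.disjoint_union_right]
        exact ⟨h1 t (by simp), ih fun t' ht' => h1 t' (by simp [ht'])⟩
    rw [List.foldr_cons, Finset.card_union_of_disjoint h3, card_foldr_union l h2]
    simp

theorem mem_foldr_union {α : Type*} [DecidableEq α] {a : α} :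
    ∀ l : List (Finset α), a ∈ l.foldr (· ∪ ·) ∅ ↔ ∃ s ∈ l, a ∈ s
  | [] => by simp
  | s :: l => by simp [mem_foldr_union l]

/-- Designs in different orbits exhaust a set of blocks through a pair as soon as their `λ`s add
up to its size. -/
theorem exists_mem_orbitBlocks_of_card {G : Subgroup (Equiv.Perm P)} {T : Finset P}
    (hT : T.card = 2) (l : List (ℕ × Finset P)) (good : Finset (Finset P))
    (hl : ∀ e ∈ l, IsDesign 2 36 6 e.1 (orbitBlocks G e.2))
    (hp : l.Pairwise fun e e' => orbitBlocks G e.2 ≠ orbitBlocks G e'.2)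
    (hc : good.card ≤ (l.map Prod.fst).sum)
    (hg : ∀ e ∈ l, ∀ C ∈ orbitBlocks G e.2, T ⊆ C → C ∈ good) {S : Finset P} (hS : S ∈ good) :
    ∃ e ∈ l, S ∈ orbitBlocks G e.2 := by
  let D : ℕ × Finset P → Finset (Finset P) := fun e =>
    (Set.toFinite {C ∈ orbitBlocks G e.2 | T ⊆ C}).toFinset
  have hD : ∀ e C, C ∈ D e ↔ C ∈ orbitBlocks G e.2 ∧ T ⊆ C := fun e C => by simp [D]
  have hcard : ∀ e ∈ l, (D e).card = e.1 := fun e he => by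
    rw [← (hl e he).balanced T hT, Set.ncard_eq_toFinset_card _ (Set.toFinite _)]
  have hdisj : (l.map D).Pairwise Disjoint := by
    rw [List.pairwise_map]
    refine hp.imp fun {e e'} hne => Finset.disjoint_left.2 fun C h1 h2 => hne ?_
    rw [← orbitBlocks_eq_of_mem ((hD e C).1 h1).1, ← orbitBlocks_eq_of_mem ((hD e' C).1 h2).1]
  have hsum := card_foldr_union _ hdisj
  have hmap : (l.map D).map Finset.card = l.map Prod.fst := by
    rw [List.map_map]
    exact List.map_congr_left fun e he => hcard e he
  rw [hmap] at hsum
  have hsub : (l.map D).foldr (· ∪ ·) ∅ ⊆ good := by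
    intro C hC
    obtain ⟨s, hs, hCs⟩ := (mem_foldr_union _).1 hC
    obtain ⟨e, he, rfl⟩ := List.mem_map.1 hs
    exact hg e he C ((hD e C).1 hCs).1 ((hD e C).1 hCs).2
  -- The sets `D e` are disjoint subsets of `good` whose sizes, the λ's, add up to at least the size
  -- of `good`; hence they fill it.
  have heq := Finset.eq_of_subset_of_card_le hsub (hsum ▸ hc)
  rw [← heq] at hS
  obtain ⟨s, hs, hCs⟩ := (mem_foldr_union _).1 hS
  obtain ⟨e, he, rfl⟩ := List.mem_map.1 hs
  exact ⟨e, he, ((hD e S).1 hCs).1⟩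

end OrbitDesign

/-! ### Packing a list of 36-bit words into one number -/

section Packing

/-- The number whose digits to base `2 ^ 36` are the values of `m` along `L`. -/
def packed {α : Type*} (L : List α) (m : α → ℕ) : ℕ :=
  L.foldr (fun g s => m g + 2 ^ 36 * s) 0

variable {α β : Type*}

theorem packed_nil (m : α → ℕ) : packed [] m = 0 := rfl

theorem packed_cons (g : α) (L : List α) (m : α → ℕ) :
    packed (g :: L) m = m g + 2 ^ 36 * packed L m := rfl

theorem packed_map (f : β → α) (L : List β) (m : α → ℕ) :
    packed (L.map f) m = packed L (m ∘ f) := by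
  induction L with
  | nil => rfl
  | cons g L ih => rw [List.map_cons, packed_cons, packed_cons, ih]; rfl

theorem packed_append (L L' : List α) (m : α → ℕ) :
    packed (L ++ L') m = packed L m + 2 ^ (36 * L.length) * packed L' m := by
  induction L with
  | nil => simp [packed_nil]
  | cons g L ih =>
    rw [List.cons_append, packed_cons, packed_cons, ih, List.length_cons]
    ring

/-- This is a geometric series with ratio 2^36. -/
theorem packed_const_one (L : List α) :
    packed L (fun _ => 1) = (2 ^ (36 * L.length) - 1) / (2 ^ 36 - 1) := by
  have h : packed L (fun _ => 1) * (2 ^ 36 - 1) + 1 = 2 ^ (36 * L.length) := by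
    induction L with
    | nil => simp [packed_nil]
    | cons g L ih =>
      rw [packed_cons, List.length_cons, Nat.mul_succ, pow_add, ← ih]
      generalize packed L (fun _ => 1) = s
      norm_num
      ring
  rw [← h, Nat.add_sub_cancel, Nat.mul_div_cancel _ (by norm_num)]

/-- Entries below 2^36 occupy disjoint blocks of bits, so a bitwise operation on the packed numbers
acts word by word. -/
theorem packed_lor (L : List α) {m m' : α → ℕ} (h : ∀ g, m g < 2 ^ 36) (h' : ∀ g, m' g < 2 ^ 36) :
    Nat.lor (packed L m) (packed L m') = packed L fun g => m g ||| m' g := by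
  change packed L m ||| packed L m' = _
  induction L with
  | nil => simp [packed_nil]
  | cons g L ih =>
    rw [packed_cons, packed_cons, packed_cons, ← ih]
    refine Nat.eq_of_testBit_eq fun i => ?_
    rw [Nat.testBit_or, Nat.add_comm, Nat.add_comm (m' g), Nat.add_comm (m g ||| m' g),
      Nat.testBit_two_pow_mul_add _ (h g), Nat.testBit_two_pow_mul_add _ (h' g),
      Nat.testBit_two_pow_mul_add _ (Nat.or_lt_two_pow (h g) (h' g))]
    split <;> simp

/-- The shift brings bit `y` of every word to its lowest position. Bits that spill over from the
next word land in higher positions, because `y < 36`, and are masked out. -/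
theorem packed_shiftRight_land (L : List α) {m : α → ℕ} (h : ∀ g, m g < 2 ^ 36) {y : ℕ}
    (hy : y < 36) (p : α → Bool) :
    Nat.land (Nat.shiftRight (packed L m) y) (packed L fun g => (p g).toNat) =
      packed L fun g => ((m g).testBit y && p g).toNat := by
  change (packed L m >>> y) &&& _ = _
  induction L with
  | nil => simp [packed_nil]
  | cons g L ih =>
    rw [packed_cons, packed_cons, packed_cons, ← ih]
    have hb : ∀ b : Bool, b.toNat < 2 ^ 36 := fun b => by cases b <;> norm_num
    have ht : ∀ (b : Bool) (i : ℕ), b.toNat.testBit i = (b && decide (i = 0)) := fun b i => by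
      cases b <;> cases i <;> simp [Nat.testBit_succ]
    refine Nat.eq_of_testBit_eq fun i => ?_
    rw [Nat.testBit_and, Nat.testBit_shiftRight, Nat.add_comm (m g), Nat.add_comm (p g).toNat,
      Nat.add_comm (Bool.toNat _), Nat.testBit_two_pow_mul_add _ (h g),
      Nat.testBit_two_pow_mul_add _ (hb _), Nat.testBit_two_pow_mul_add _ (hb _), ht, ht]
    by_cases hi : i < 36
    · by_cases h0 : i = 0
      · subst h0; simp [hy]
      · simp [hi, h0]
    · have h1 : ¬ y + i < 36 := by omega
      have h2 : y + i - 36 = y + (i - 36) := by omega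
      simp only [hi, h1, if_false, h2, Nat.testBit_and, Nat.testBit_shiftRight]

/-- The modulus is 2^36 - 1, and 2^36 ≡ 1, so the remainder is the sum of the digits, as in casting
out nines. The bound on the length makes the sum smaller than the modulus. -/
theorem packed_mod (L : List α) (p : α → Bool) (hL : L.length < 68719476735) :
    Nat.mod (packed L fun g => (p g).toNat) 68719476735 = L.countP p := by
  have h : packed L (fun g => (p g).toNat) ≡ L.countP p [MOD 68719476735] := by
    clear hL
    induction L with
    | nil => rfl
    | cons g L ih =>
      rw [packed_cons, List.countP_cons, Nat.add_comm]
      have h1 : 2 ^ 36 * packed L (fun g => (p g).toNat) ≡ 1 * L.countP p [MOD 68719476735] :=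
        Nat.ModEq.mul (by decide) ih
      rw [one_mul] at h1
      refine h1.add ?_
      cases p g <;> rfl
  exact (show _ % _ = _ from h).trans (Nat.mod_eq_of_lt (List.countP_le_length.trans_lt hL))

theorem testBit_foldr_lor (l : List ℕ) (y : ℕ) :
    (l.foldr (fun n s => 2 ^ n ||| s) 0).testBit y = decide (y ∈ l) := by
  induction l with
  | nil => simp
  | cons n l ih =>
    rw [List.foldr_cons, Nat.testBit_or, ih, Nat.testBit_two_pow]
    by_cases h : n = y
    · simp [h]
    · simp [h, Ne.symm h]

theorem foldr_lor_lt (l : List ℕ) (hl : ∀ n ∈ l, n < 36) :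
    l.foldr (fun n s => 2 ^ n ||| s) 0 < 2 ^ 36 := by
  induction l with
  | nil => norm_num
  | cons n l ih =>
    rw [List.foldr_cons]
    exact Nat.or_lt_two_pow (Nat.pow_lt_pow_right (by norm_num) (hl n (by simp)))
      (ih fun k hk => hl k (by simp [hk]))

end Packing

/-! ### Evaluation by the kernel -/

section Kernel

/-- Application of `k` to `n`, arranged so that `n` is evaluated first. -/
def forceNat {β : Type*} (n : ℕ) (k : ℕ → β) : β :=
  Nat.rec (k 0) (fun m _ => k (m + 1)) n

theorem forceNat_eq {β : Type*} (n : ℕ) (k : ℕ → β) : forceNat n k = k n := by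
  cases n <;> rfl

/-- Application of `k` to `l`, arranged so that the entries of `l` are evaluated first. -/
def forceList {β : Type*} : List ℕ → (List ℕ → β) → β
  | [], k => k []
  | a :: l, k => forceNat a fun a' => forceList l fun l' => k (a' :: l')

theorem forceList_eq {β : Type*} : ∀ (l : List ℕ) (k : List ℕ → β), forceList l k = k l
  | [], _ => rfl
  | a :: l, k => by rw [forceList, forceNat_eq, forceList_eq l]

/-- The entry of `l` at position `n`, or `0`. -/
def nth : List ℕ → ℕ → ℕ
  | [], _ => 0
  | a :: _, 0 => a
  | _ :: l, n + 1 => nth l n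

theorem nth_map_range (f : ℕ → ℕ) {n x : ℕ} (hx : x < n) : nth ((List.range n).map f) x = f x := by
  have key : ∀ (l : List ℕ) (k : ℕ) (hk : k < l.length), nth l k = l[k] := by
    intro l
    induction l with
    | nil => intro k hk; simp at hk
    | cons a l ih =>
      intro k hk
      cases k with
      | zero => rfl
      | succ k => exact ih k (by simpa using hk)
  rw [key _ x (by simpa using hx)]
  simp

/-- The list of values of a permutation of 36 points. -/
def IsTable (t : List ℕ) (g : Equiv.Perm (Fin 36)) : Prop := ∀ x : Fin 36, nth t x = g x

/-- Composition of tables. -/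
def tableMul (a b : List ℕ) : List ℕ := (List.range 36).map fun x => nth a (nth b x)

theorem IsTable.mul {a b : List ℕ} {g h : Equiv.Perm (Fin 36)} (ha : IsTable a g)
    (hb : IsTable b h) : IsTable (tableMul a b) (g * h) := fun x => by
  rw [tableMul, nth_map_range _ x.2, hb x, ha (h x)]; rfl

theorem isTable_one : IsTable ((List.range 36).map id) 1 := fun x => by
  rw [nth_map_range _ x.2]; rfl

/-- All products of one element from each list, the first list providing the last factor. -/
def factorProducts {G : Type*} [Group G] : List (List G) → List G
  | [] => [1]
  | F :: Fs => F.flatMap fun g => (factorProducts Fs).map (· * g)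

theorem length_factorProducts_cons {G : Type*} [Group G] (F : List G) (Fs : List (List G)) :
    (factorProducts (F :: Fs)).length = (factorProducts Fs).length * F.length := by
  rw [factorProducts, List.length_flatMap]
  simp [mul_comm]

/-- `rows` holds, for each point, the packed list of its images as one-bit words. -/
def IsRows (rows : List ℕ) (L : List (Equiv.Perm (Fin 36))) : Prop :=
  ∀ x : Fin 36, nth rows x = packed L fun g => 2 ^ (g x : ℕ)

/-- The rows for a list of products from those for the first factors. -/
def rowsStep (w : ℕ) (rows : List ℕ) (F : List (List ℕ)) : List ℕ :=
  (List.range 36).map fun x =>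
    F.foldr (fun t s => Nat.add (nth rows (nth t x)) (Nat.mul (Nat.pow 2 w) s)) 0

/-- Since `(h * g) x = h (g x)`, the row of `x` for the products with last factor `g` is the old row
of `g x`; the new row concatenates these over `g`. No product has to be computed as a permutation.
-/
theorem IsRows.step {rows : List ℕ} {Fs : List (List (Equiv.Perm (Fin 36)))}
    (h : IsRows rows (factorProducts Fs)) {F : List (List ℕ)} {F' : List (Equiv.Perm (Fin 36))}
    (hF : List.Forall₂ IsTable F F') :
    IsRows (rowsStep (36 * (factorProducts Fs).length) rows F) (factorProducts (F' :: Fs)) := by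
  intro x
  rw [rowsStep, nth_map_range _ x.2, factorProducts]
  induction hF with
  | nil => rfl
  | @cons t g F F' ht _ ih =>
    rw [List.foldr_cons, ih, List.flatMap_cons, packed_append, packed_map, List.length_map, ht x,
      h (g x)]
    rfl

/-- Application of `k` to the number and the rows of the products of tables from the given lists. -/
def withRows {β : Type*} : List (List (List ℕ)) → (ℕ → List ℕ → β) → β
  | [], k => k 1 ((List.range 36).map fun x => Nat.pow 2 x)
  | F :: Fs, k => withRows Fs fun n rows =>
      forceList (rowsStep (36 * n) rows F) fun rows' => k (n * F.length) rows'

theorem withRows_spec {β : Type*} {Ts : List (List (List ℕ))}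
    {Fs : List (List (Equiv.Perm (Fin 36)))} (h : List.Forall₂ (List.Forall₂ IsTable) Ts Fs) :
    ∃ rows, IsRows rows (factorProducts Fs) ∧
      ∀ k : ℕ → List ℕ → β, withRows Ts k = k (factorProducts Fs).length rows := by
  induction h with
  | nil =>
    refine ⟨(List.range 36).map fun x => Nat.pow 2 x, fun x => ?_, fun k => rfl⟩
    rw [nth_map_range _ x.2]
    simp [factorProducts, packed]
  | @cons F F' Ts Fs hF _ ih =>
    obtain ⟨rows, h1, h2⟩ := ih
    refine ⟨_, h1.step hF, fun k => ?_⟩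
    rw [withRows, h2, forceList_eq, length_factorProducts_cons, hF.length_eq]

/-- The packed list of the images of the block `b`. -/
def packedBlocks (rows b : List ℕ) : ℕ := b.foldr (fun x s => Nat.lor (nth rows x) s) 0

/-- The number of words in which the bits moved to the end in each element of `ms` are set. -/
def packedCount (one : ℕ) (ms : List ℕ) : ℕ := Nat.mod (ms.foldr Nat.land one) 68719476735

/-- The number of group elements that move a block onto one containing `T`, from its images. -/
def coverCode (one acc : ℕ) (T : List ℕ) : ℕ := packedCount one (T.map (Nat.shiftRight acc))

/-- The set of points given by a list of numbers. -/
def pointSet (b : List ℕ) : Finset (Fin 36) := (b.map (Fin.ofNat 36)).toFinset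

theorem blockOf_eq (l : List ℕ) : blockOf l = pointSet (l.map (· - 1)) := by
  rw [blockOf, pointSet, List.map_map]; rfl

theorem mem_pointSet {b : List ℕ} (hb : ∀ x ∈ b, x < 36) {y : Fin 36} :
    y ∈ pointSet b ↔ (y : ℕ) ∈ b := by
  simp only [pointSet, List.mem_toFinset, List.mem_map]
  constructor
  · rintro ⟨x, hx, rfl⟩
    simpa [Nat.mod_eq_of_lt (hb x hx)] using hx
  · intro h
    exact ⟨y, h, Fin.ext (by simp)⟩

theorem packedBlocks_eq {rows : List ℕ} {L : List (Equiv.Perm (Fin 36))} (h : IsRows rows L)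
    {b : List ℕ} (hb : ∀ x ∈ b, x < 36) :
    packedBlocks rows b = packed L fun g =>
      (b.map fun x => (g (Fin.ofNat 36 x) : ℕ)).foldr (fun n s => 2 ^ n ||| s) 0 := by
  induction b with
  | nil =>
    rw [packedBlocks]
    induction L with
    | nil => rfl
    | cons g L ih =>
      have h0 : ∀ L : List (Equiv.Perm (Fin 36)), packed L (fun _ => 0) = 0 := fun L => by
        induction L with
        | nil => rfl
        | cons g L ih => rw [packed_cons, ih, Nat.mul_zero]
      exact (h0 _).symm
  | cons x b ih =>
    have hx : x < 36 := hb x (by simp)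
    have h1 := ih fun y hy => hb y (by simp [hy])
    have h2 : nth rows x = packed L fun g => 2 ^ (g (Fin.ofNat 36 x) : ℕ) := by
      rw [← h (Fin.ofNat 36 x), Fin.val_ofNat, Nat.mod_eq_of_lt hx]
    rw [packedBlocks, List.foldr_cons, ← packedBlocks, h1, h2, packed_lor]
    · rfl
    · exact fun g => Nat.pow_lt_pow_right (by norm_num) (Fin.is_lt _)
    · exact fun g => foldr_lor_lt _ (by simp)

/-- The list `L` enumerates the group `G` without repetitions. -/
structure Enumerates (L : List (Equiv.Perm (Fin 36))) (G : Subgroup (Equiv.Perm (Fin 36))) :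
    Prop where
  nodup : L.Nodup
  mem_iff : ∀ g, g ∈ L ↔ g ∈ G
  length_lt : L.length < 68719476735

theorem Enumerates.natCard {L : List (Equiv.Perm (Fin 36))} {G : Subgroup (Equiv.Perm (Fin 36))}
    (h : Enumerates L G) : Nat.card G = L.length := by
  rw [← SetLike.coe_sort_coe, Nat.card_coe_set_eq, ← List.toFinset_card_of_nodup h.nodup,
    ← Set.ncard_coe_finset]
  congr 1
  ext g
  simp [h.mem_iff]

theorem Enumerates.cover_eq {L : List (Equiv.Perm (Fin 36))} {G : Subgroup (Equiv.Perm (Fin 36))}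
    (h : Enumerates L G) (B T : Finset (Fin 36)) :
    cover G B T = L.countP fun g => decide (T ⊆ moveBlock g B) := by
  rw [cover, List.countP_eq_length_filter, ← List.toFinset_card_of_nodup (h.nodup.filter _)]
  congr 1
  ext g
  simp [mem_movers, h.mem_iff]

/-- Bit `y` of the word of `g` tells whether `y` lies in `gB`. The conjunction over `y ∈ T` leaves
the digit 1 exactly for the `g` with `T ⊆ gB`, and the sum of the digits counts them. -/
theorem Enumerates.coverCode_eq {L : List (Equiv.Perm (Fin 36))}
    {G : Subgroup (Equiv.Perm (Fin 36))} (h : Enumerates L G) {rows : List ℕ}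
    (hr : IsRows rows L) {b T : List ℕ} (hb : ∀ x ∈ b, x < 36) (hT : ∀ x ∈ T, x < 36) :
    coverCode (packed L fun _ => 1) (packedBlocks rows b) T =
      cover G (pointSet b) (pointSet T) := by
  have key : (T.map (Nat.shiftRight (packedBlocks rows b))).foldr Nat.land (packed L fun _ => 1) =
      packed L fun g => (decide (pointSet T ⊆ moveBlock g (pointSet b))).toNat := by
    rw [packedBlocks_eq hr hb]
    induction T with
    | nil => simp [pointSet]
    | cons y T ih =>
      have hy : y < 36 := hT y (by simp)
      rw [List.map_cons, List.foldr_cons, ih fun x hx => hT x (by simp [hx]),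
        packed_shiftRight_land]
      · congr 1
        funext g
        congr 1
        have h1 : pointSet (y :: T) = insert (Fin.ofNat 36 y) (pointSet T) := by
          simp [pointSet]
        rw [testBit_foldr_lor, h1, ← Bool.decide_and, decide_eq_decide, Finset.insert_subset_iff]
        refine and_congr ?_ Iff.rfl
        rw [mem_moveBlock, pointSet, List.mem_toFinset, List.mem_map, List.mem_map]
        refine exists_congr fun x => and_congr Iff.rfl ?_
        rw [Equiv.eq_symm_apply, Fin.ext_iff, Fin.val_ofNat, Nat.mod_eq_of_lt hy]
      · exact fun g => foldr_lor_lt _ (by simp)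
      · exact hy
  rw [coverCode, packedCount, key, packed_mod _ _ h.length_lt, h.cover_eq]

theorem sublistsLen_map {α β : Type*} (f : α → β) : ∀ (n : ℕ) (l : List α),
    List.sublistsLen n (l.map f) = (List.sublistsLen n l).map (List.map f)
  | 0, l => by simp
  | n + 1, [] => by simp
  | n + 1, a :: l => by
    rw [List.map_cons, List.sublistsLen_succ_cons, List.sublistsLen_succ_cons,
      sublistsLen_map f (n + 1) l, sublistsLen_map f n l]
    simp

/-- The invariant of the design with base block `b`, from its packed images. -/
def invariantCode (one acc : ℕ) (b : List ℕ) : ℕ :=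
  ((b.map (Nat.shiftRight acc)).map fun r => Nat.pow
    (((List.sublistsLen 3 (b.map (Nat.shiftRight acc))).map fun T =>
      Nat.pow (packedCount one (r :: T)) 2).foldr Nat.add 0) 2).foldr Nat.add 0

/-- As `b` has no repetitions, its sublists of length 3 correspond to the 3-subsets of the block.
The shifted numbers of the six points are reused for all covers. -/
theorem Enumerates.invariantCode_eq {L : List (Equiv.Perm (Fin 36))}
    {G : Subgroup (Equiv.Perm (Fin 36))} (h : Enumerates L G) {rows : List ℕ}
    (hr : IsRows rows L) {b : List ℕ} (hb : ∀ x ∈ b, x < 36) (hn : b.Nodup) :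
    invariantCode (packed L fun _ => 1) (packedBlocks rows b) b =
      orbitInvariant G (pointSet b) := by
  have hn' : (b.map (Fin.ofNat 36)).Nodup := by
    refine List.Nodup.map_on (fun x hx y hy hxy => ?_) hn
    simpa [Fin.ext_iff, Nat.mod_eq_of_lt (hb x hx), Nat.mod_eq_of_lt (hb y hy)] using hxy
  have hval : (pointSet b).val = (b.map (Fin.ofNat 36) : Multiset (Fin 36)) := by
    rw [pointSet, List.toFinset_val, hn'.dedup]
  have hpow : ∀ f : Finset (Fin 36) → ℕ, ∑ T ∈ Finset.powersetCard 3 (pointSet b), f T =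
      ((List.sublistsLen 3 b).map fun T => f (pointSet T)).sum := by
    intro f
    have h1 : ∀ T ∈ List.sublistsLen 3 (b.map (Fin.ofNat 36)), T.Nodup := fun T hT =>
      (List.mem_sublistsLen.1 hT).1.nodup hn'
    have h2 : (Finset.powersetCard 3 (pointSet b)).val =
        ((List.sublistsLen 3 (b.map (Fin.ofNat 36))).map List.toFinset :
          Multiset (Finset (Fin 36))) := by
      refine Multiset.map_injective Finset.val_injective ?_
      rw [Finset.map_val_val_powersetCard, hval, Multiset.powersetCard_coe, Multiset.map_coe,
        List.map_map]
      refine congrArg _ (List.map_congr_left fun T hT => ?_)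
      simp [(h1 T hT).dedup]
    rw [Finset.sum, h2, Multiset.map_coe, Multiset.sum_coe, List.map_map, sublistsLen_map,
      List.map_map]
    rfl
  rw [orbitInvariant, Finset.sum, hval, Multiset.map_coe, Multiset.sum_coe, List.map_map,
    invariantCode, List.map_map]
  refine congrArg List.sum (List.map_congr_left fun x hx => ?_)
  simp only [Function.comp_apply]
  rw [hpow, sublistsLen_map, List.map_map]
  refine congrArg (fun n : ℕ => n ^ 2) (congrArg List.sum (List.map_congr_left fun T hT => ?_))
  have hT' : ∀ y ∈ T, y < 36 := fun y hy => hb y ((List.mem_sublistsLen.1 hT).1.subset hy)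
  have h3 := h.coverCode_eq hr hb (T := x :: T) (by simpa using ⟨hb x hx, hT'⟩)
  have h4 : pointSet (x :: T) = insert (Fin.ofNat 36 x) (pointSet T) := by simp [pointSet]
  rw [← h4, ← h3]
  rfl

end Kernel

/-! ### Counting the sets of points with a given sum of pair weights -/

section PairWeights

/-- The rows `f y z`, `z` after `y`, of a list of points. -/
def triangle {α : Type*} (f : α → α → ℕ) : List α → List (List ℕ)
  | [] => []
  | y :: ys => ys.map (f y) :: triangle f ys

/-- The number of `k`-subsets of the remaining points for which the sum of `s`, the weights `ws` of
their points, and the weights of their pairs equals `t`. -/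
def countWeighted (t : ℕ) : List (List ℕ) → List ℕ → ℕ → ℕ → ℕ
  | [], _, k, s => match k with
    | 0 => bif Nat.beq s t then 1 else 0
    | _ + 1 => 0
  | row :: rows, ws, k, s => match k with
    | 0 => bif Nat.beq s t then 1 else 0
    | k + 1 => match ws with
      | [] => 0
      | w :: ws => Nat.add (countWeighted t rows ws (k + 1) s)
          (countWeighted t rows (List.zipWith Nat.add ws row) k (Nat.add s w))

variable {α : Type*} [DecidableEq α]

/-- The sum of the weights of the pairs in `S`. -/
def pairSum (v : Finset α → ℕ) (S : Finset α) : ℕ := ∑ q ∈ Finset.powersetCard 2 S, v q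

theorem pairSum_insert (v : Finset α → ℕ) {y : α} {S : Finset α} (hy : y ∉ S) :
    pairSum v (insert y S) = pairSum v S + ∑ z ∈ S, v {y, z} := by
  rw [pairSum, Finset.powersetCard_succ_insert hy, Finset.sum_union, Finset.sum_image, pairSum,
    Finset.powersetCard_one, Finset.sum_map]
  · rfl
  · intro A hA B hB h
    have hA' : y ∉ A := fun h => hy ((Finset.mem_powersetCard.1 hA).1 h)
    have hB' : y ∉ B := fun h => hy ((Finset.mem_powersetCard.1 hB).1 h)
    rw [← Finset.erase_insert hA', ← Finset.erase_insert hB', h]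
  · refine Finset.disjoint_left.2 fun A hA hA' => ?_
    obtain ⟨B, -, rfl⟩ := Finset.mem_image.1 hA'
    exact hy ((Finset.mem_powersetCard.1 hA).1 (Finset.mem_insert_self _ _))

/-- Branch on whether the first point `y` belongs to `S`. If it does, its accumulated weight moves
into `s`, and each later point `z` takes over the weight of the pair `{y, z}`, so every pair is
charged once, when its later point is chosen. -/
theorem countWeighted_eq (v : Finset α → ℕ) (t : ℕ) :
    ∀ (pts : List α) (_ : pts.Nodup) (cur : α → ℕ) (k s : ℕ),
      countWeighted t (triangle (fun y z => v {y, z}) pts) (pts.map cur) k s =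
        ((Finset.powersetCard k pts.toFinset).filter
          fun S => s + ∑ z ∈ S, cur z + pairSum v S = t).card := by
  have h0 : ∀ (A : Finset α) (cur : α → ℕ) (s : ℕ), ((Finset.powersetCard 0 A).filter
      fun S => s + ∑ z ∈ S, cur z + pairSum v S = t).card = bif Nat.beq s t then 1 else 0 := by
    intro A cur s
    have h1 : pairSum v ∅ = 0 := by simp [pairSum]
    rw [Finset.powersetCard_zero, Finset.filter_singleton]
    by_cases h : s = t
    · simp [h, h1]
    · have h2 : Nat.beq s t = false := Bool.eq_false_iff.2 (mt Nat.eq_of_beq_eq_true h)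
      simp [h, h1, h2]
  intro pts
  induction pts with
  | nil =>
    intro _ cur k s
    cases k with
    | zero => rw [h0]; rfl
    | succ k => rw [List.toFinset_nil, Finset.powersetCard_eq_empty.2 (by simp)]; rfl
  | cons y ys ih =>
    intro hn cur k s
    obtain ⟨hy, hn⟩ := List.nodup_cons.1 hn
    cases k with
    | zero => rw [h0]; rfl
    | succ k =>
      have hy' : y ∉ ys.toFinset := by simpa using hy
      have hz : List.zipWith Nat.add (ys.map cur) (ys.map fun z => v {y, z}) =
          ys.map fun z => cur z + v {y, z} := by
        rw [List.zipWith_map, List.zipWith_self]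
        rfl
      rw [List.map_cons, triangle, countWeighted, hz, ih hn, ih hn, List.toFinset_cons,
        Finset.powersetCard_succ_insert hy', Finset.filter_union, Finset.card_union_of_disjoint]
      · rw [Nat.add_eq]
        refine congrArg₂ (· + ·) rfl ?_
        rw [Finset.filter_image, Finset.card_image_of_injOn]
        · congr 1
          refine Finset.filter_congr fun S hS => ?_
          have hyS : y ∉ S := fun h => hy' ((Finset.mem_powersetCard.1 hS).1 h)
          rw [Finset.sum_insert hyS, pairSum_insert v hyS, Finset.sum_add_distrib]
          rw [Nat.add_eq]
          constructor <;> intro h <;> linarith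
        · intro A hA B hB h
          have hA' : y ∉ A := fun h =>
            hy' ((Finset.mem_powersetCard.1 (Finset.mem_filter.1 hA).1).1 h)
          have hB' : y ∉ B := fun h =>
            hy' ((Finset.mem_powersetCard.1 (Finset.mem_filter.1 hB).1).1 h)
          rw [← Finset.erase_insert hA', ← Finset.erase_insert hB', h]
      · refine Finset.disjoint_left.2 fun A hA hA' => ?_
        obtain ⟨B, -, rfl⟩ := Finset.mem_image.1 (Finset.mem_filter.1 hA').1
        exact hy' ((Finset.mem_powersetCard.1 (Finset.mem_filter.1 hA).1).1
          (Finset.mem_insert_self _ _))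

/-- Removing `a` and `b` is injective on the sets containing both. The pairs meeting `{a, b}` are
accounted for by the initial point weights and the initial sum `v {a, b}`. -/
theorem card_filter_pair_le {pts : List α} {a b : α} (hn : (a :: b :: pts).Nodup)
    (hpts : ∀ x, x ∈ a :: b :: pts) [Fintype α] (v : Finset α → ℕ) (t k : ℕ) :
    ((Finset.powersetCard (k + 2) Finset.univ).filter
        fun S : Finset α => {a, b} ⊆ S ∧ pairSum v S = t).card ≤
      countWeighted t (triangle (fun y z => v {y, z}) pts)
        (pts.map fun z => v {a, z} + v {b, z}) k (v {a, b}) := by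
  have ha := List.nodup_cons.1 hn
  have hb := List.nodup_cons.1 ha.2
  rw [countWeighted_eq v t pts hb.2]
  refine Finset.card_le_card_of_injOn (fun S => (S.erase a).erase b) ?_ ?_
  · intro S hS
    obtain ⟨hS1, hS2, hS3⟩ := Finset.mem_filter.1 hS
    have haS : a ∈ S := hS2 (by simp)
    have hbS : b ∈ S.erase a := Finset.mem_erase.2
      ⟨fun h => ha.1 (by simp [h]), hS2 (by simp)⟩
    have hcard : ((S.erase a).erase b).card = k := by
      rw [Finset.card_erase_of_mem hbS, Finset.card_erase_of_mem haS,
        (Finset.mem_powersetCard.1 hS1).2]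
      rfl
    refine Finset.mem_coe.2 (Finset.mem_filter.2 ⟨Finset.mem_powersetCard.2 ⟨?_, hcard⟩, ?_⟩)
    · intro x hx
      have h1 := hpts x
      simp only [Finset.mem_erase] at hx
      simpa [hx.1, hx.2.1] using h1
    · have h1 := pairSum_insert v (Finset.notMem_erase b (S.erase a))
      rw [Finset.insert_erase hbS] at h1
      have h2 := pairSum_insert v (Finset.notMem_erase a S)
      rw [Finset.insert_erase haS, h1, ← Finset.insert_erase hbS,
        Finset.sum_insert (Finset.notMem_erase b (S.erase a)), Finset.erase_insert
          (Finset.notMem_erase b (S.erase a))] at h2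
      rw [Finset.sum_add_distrib]
      linarith
  · intro S hS S' hS' h
    obtain ⟨-, hS2, -⟩ := Finset.mem_filter.1 hS
    obtain ⟨-, hS2', -⟩ := Finset.mem_filter.1 hS'
    have key : ∀ S : Finset α, {a, b} ⊆ S → insert a (insert b ((S.erase a).erase b)) = S := by
      intro S hS
      have haS : a ∈ S := hS (by simp)
      have hbS : b ∈ S.erase a := Finset.mem_erase.2
        ⟨fun h => ha.1 (by simp [h]), hS (by simp)⟩
      rw [Finset.insert_erase hbS, Finset.insert_erase haS]
    rw [← key S hS2, ← key S' hS2']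
    exact congrArg (fun A => insert a (insert b A)) h

/-- The covering numbers of a set are sums over its pairs. -/
theorem cover_eq_pairSum {P : Type*} [Fintype P] [DecidableEq P] (G : Subgroup (Equiv.Perm P))
    {T : Finset P} (hT : T.card = 2) (S : Finset P) :
    cover G S T = pairSum (fun q => cover G q T) S := by
  classical
  have h : ∀ g : Equiv.Perm P, (∑ q ∈ Finset.powersetCard 2 S,
      if g ∈ G ∧ T ⊆ moveBlock g q then 1 else 0) =
        if g ∈ G ∧ T ⊆ moveBlock g S then 1 else 0 := by
    intro g
    by_cases hg : g ∈ G
    · by_cases hTS : T ⊆ moveBlock g S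
      · simp only [hg, hTS, true_and, if_true]
        -- Among the pairs in `S` only the preimage of `T` under `g` is moved onto `T`, so the sum
        -- has a single nonzero term.
        have h1 : moveBlock g⁻¹ T ∈ Finset.powersetCard 2 S :=
          Finset.mem_powersetCard.2 ⟨(moveBlock_inv_subset g T S).2 hTS, by
            rw [card_moveBlock, hT]⟩
        rw [Finset.sum_eq_single_of_mem _ h1]
        · rw [if_pos]
          rw [← moveBlock_mul, mul_inv_cancel, moveBlock_one]
        · intro q hq hne
          refine if_neg fun h2 => hne ?_
          rw [← moveBlock_inv_subset] at h2
          refine (Finset.eq_of_subset_of_card_le h2 ?_).symm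
          rw [card_moveBlock, hT, (Finset.mem_powersetCard.1 hq).2]
      · simp only [hg, hTS, true_and, if_false]
        refine Finset.sum_eq_zero fun q hq => if_neg fun h2 => hTS (h2.trans ?_)
        rw [moveBlock_subset_moveBlock]
        exact (Finset.mem_powersetCard.1 hq).1
    · simp [hg]
  simp only [pairSum, cover, movers, Finset.card_filter]
  rw [Finset.sum_comm]
  simp only [h]

end PairWeights

/-! ### The projective line over the field with eight elements -/

section FieldEight

instance charP_F8 : CharP F8 2 := inferInstanceAs (CharP (GaloisField 2 3) 2)

noncomputable instance fintypeF8 : Fintype F8 := Fintype.ofFinite _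

theorem card_F8 : Fintype.card F8 = 8 := by
  rw [← Nat.card_eq_fintype_card]
  exact (GaloisField.card 2 3 (by norm_num)).trans (by norm_num)

theorem two_eq_zero_F8 : (2 : F8) = 0 := CharTwo.two_eq_zero

/-- In characteristic 2, x^8 - x = x(x - 1)(x^3 + x + 1)(x^3 + x^2 + 1). An element other than 0 and
1 is a root of one of the cubics, and x ↦ x + 1 takes roots of the second to roots of the first. -/
theorem exists_cube_eq_F8 : ∃ a : F8, a ^ 3 = a + 1 := by
  classical
  have h2 := two_eq_zero_F8
  obtain ⟨x, hx⟩ : ∃ x : F8, x ∉ ({0, 1} : Finset F8) := by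
    by_contra h
    push Not at h
    have h1 : (Finset.univ : Finset F8) ⊆ {0, 1} := fun x _ => h x
    have h3 := Finset.card_le_card h1
    rw [Finset.card_univ, card_F8] at h3
    exact absurd (h3.trans Finset.card_le_two) (by norm_num)
  have h0 : x ≠ 0 := fun h => hx (by simp [h])
  have h1 : x - 1 ≠ 0 := fun h => hx (by simp [sub_eq_zero.1 h])
  have h8 : x ^ 8 = x := by
    have := FiniteField.pow_card x
    rwa [card_F8] at this
  have hprod : x * ((x - 1) * ((x ^ 3 + x + 1) * (x ^ 3 + x ^ 2 + 1))) = 0 := by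
    linear_combination h8 + (x ^ 4 * (x - 1)) * h2
  rcases mul_eq_zero.1 hprod with h | h
  · exact absurd h h0
  rcases mul_eq_zero.1 h with h | h
  · exact absurd h h1
  rcases mul_eq_zero.1 h with h | h
  · exact ⟨x, by linear_combination h - (x + 1) * h2⟩
  · exact ⟨x + 1, by linear_combination h + (x ^ 2 + x - 1) * h2⟩

/-- A generator of the field with eight elements. -/
noncomputable def gen : F8 := exists_cube_eq_F8.choose

theorem gen_cube : gen ^ 3 = gen + 1 := exists_cube_eq_F8.choose_spec

theorem gen_ne_zero : gen ≠ 0 := fun h => by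
  have := gen_cube
  simp [h] at this

theorem gen_pow_seven : gen ^ 7 = 1 := by
  have h := gen_cube
  have h2 := two_eq_zero_F8
  grind

theorem gen_ne_one : gen ≠ 1 := fun h => by
  have h1 := gen_cube
  rw [h] at h1
  have : (1 : F8) = 0 := by linear_combination -h1
  exact one_ne_zero this

theorem isPrimitiveRoot_gen : IsPrimitiveRoot gen 7 := by
  have : Fact (Nat.Prime 7) := ⟨by norm_num⟩
  rw [← orderOf_eq_prime gen_pow_seven gen_ne_one]
  exact IsPrimitiveRoot.orderOf gen

theorem exists_gen_pow_eq {x : F8} (hx : x ≠ 0) : ∃ k < 7, gen ^ k = x := by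
  refine isPrimitiveRoot_gen.eq_pow_of_pow_eq_one ?_
  have := FiniteField.pow_card_sub_one_eq_one x hx
  rwa [card_F8] at this

/-- The affine coordinates of the points `1, …, 8` of the line. -/
noncomputable def affine (i : Fin 9) : F8 := if i.1 = 1 then 0 else gen ^ (i.1 + 5)

/-- Representatives of the points of the line; the first one is the point at infinity. -/
noncomputable def lineVec (i : Fin 9) : Fin 2 → F8 := if i = 0 then ![1, 0] else ![affine i, 1]

theorem lineVec_ne_zero (i : Fin 9) : lineVec i ≠ 0 := by
  unfold lineVec
  split
  · exact fun h => one_ne_zero (congrFun h 0)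
  · exact fun h => one_ne_zero (congrFun h 1)

/-- The points of the line. -/
noncomputable def linePoint (i : Fin 9) : ℙ F8 (Fin 2 → F8) :=
  Projectivization.mk F8 (lineVec i) (lineVec_ne_zero i)

theorem affine_injOn {i j : Fin 9} (hi : i ≠ 0) (hj : j ≠ 0) (h : affine i = affine j) : i = j := by
  unfold affine at h
  have h0 : ∀ k, gen ^ k ≠ 0 := fun k => pow_ne_zero k gen_ne_zero
  by_cases h1 : i.1 = 1
  · by_cases h2 : j.1 = 1
    · exact Fin.ext (h1.trans h2.symm)
    · rw [if_pos h1, if_neg h2] at h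
      exact absurd h.symm (h0 _)
  · by_cases h2 : j.1 = 1
    · rw [if_neg h1, if_pos h2] at h
      exact absurd h (h0 _)
    · rw [if_neg h1, if_neg h2] at h
      have hi' : i.1 ≠ 0 := fun h => hi (Fin.ext h)
      have hj' : j.1 ≠ 0 := fun h => hj (Fin.ext h)
      -- The exponent `k + 5` in `affine` stands for `k - 2` modulo 7, so the points 2, …, 8 carry
      -- the powers 0, …, 6 of the generator.
      have key : ∀ k : Fin 9, k.1 ≠ 0 → k.1 ≠ 1 → gen ^ (k.1 + 5) = gen ^ (k.1 - 2) := by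
        intro k h1 h2
        rw [show k.1 + 5 = 7 + (k.1 - 2) by omega, pow_add, gen_pow_seven, one_mul]
      rw [key i hi' h1, key j hj' h2] at h
      have := isPrimitiveRoot_gen.pow_inj (by omega) (by omega) h
      exact Fin.ext (by omega)

theorem linePoint_bijective : Function.Bijective linePoint := by
  constructor
  · intro i j h
    obtain ⟨a, ha⟩ := (Projectivization.mk_eq_mk_iff' _ _ _ _ _).1 h
    unfold lineVec at ha
    by_cases hi : i = 0 <;> by_cases hj : j = 0
    · rw [hi, hj]
    · rw [if_pos hi, if_neg hj] at ha
      have h0 := congrFun ha 0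
      have h1 := congrFun ha 1
      simp at h0 h1
      simp [h1] at h0
    · rw [if_neg hi, if_pos hj] at ha
      have h1 := congrFun ha 1
      simp at h1
    · rw [if_neg hi, if_neg hj] at ha
      have h0 := congrFun ha 0
      have h1 := congrFun ha 1
      simp at h0 h1
      rw [h1, one_mul] at h0
      exact affine_injOn hi hj h0.symm
  · intro p
    induction p using Projectivization.ind with | _ v hv =>
    by_cases h1 : v 1 = 0
    · have h0 : v 0 ≠ 0 := fun h0 => hv (by ext i; fin_cases i <;> simp [h0, h1])
      refine ⟨0, (Projectivization.mk_eq_mk_iff' _ _ _ _ _).2 ⟨(v 0)⁻¹, ?_⟩⟩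
      ext i
      fin_cases i <;> simp [lineVec, h0, h1]
    · have key : ∀ i : Fin 9, i ≠ 0 → affine i = (v 1)⁻¹ * v 0 →
          linePoint i = Projectivization.mk F8 v hv := by
        intro i hi h
        refine (Projectivization.mk_eq_mk_iff' _ _ _ _ _).2 ⟨(v 1)⁻¹, ?_⟩
        ext j
        fin_cases j <;> simp [lineVec, hi, h1, h]
      by_cases h0 : v 0 = 0
      · exact ⟨1, key 1 (by decide) (by simp [affine, h0])⟩
      · obtain ⟨k, hk, hkx⟩ := exists_gen_pow_eq (mul_ne_zero (inv_ne_zero h1) h0)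
        refine ⟨⟨k + 2, by omega⟩, key _ (by simp [Fin.ext_iff]) ?_⟩
        rw [← hkx]
        simp only [affine]
        rw [if_neg (by omega), show k + 2 + 5 = 7 + k by omega, pow_add, gen_pow_seven, one_mul]

/-- The bijection between `Fin 9` and the projective line. -/
noncomputable def lineEquiv : Fin 9 ≃ ℙ F8 (Fin 2 → F8) := Equiv.ofBijective _ linePoint_bijective

theorem lineEquiv_apply (i : Fin 9) : lineEquiv i = linePoint i := rfl

/-! ### Generators of the groups in their action on the line -/

/-- The map `x ↦ x²`. -/
def lineFrob : Equiv.Perm (Fin 9) where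
  toFun := ![0, 1, 2, 4, 6, 8, 3, 5, 7]
  invFun := ![0, 1, 2, 6, 3, 7, 4, 8, 5]
  left_inv := by decide
  right_inv := by decide

/-- Multiplication by the generator. -/
def lineMul : Equiv.Perm (Fin 9) where
  toFun := ![0, 1, 3, 4, 5, 6, 7, 8, 2]
  invFun := ![0, 1, 8, 2, 3, 4, 5, 6, 7]
  left_inv := by decide
  right_inv := by decide

/-- The map `x ↦ x + 1`. -/
def lineAdd : Equiv.Perm (Fin 9) where
  toFun := ![0, 2, 1, 5, 8, 3, 7, 6, 4]
  invFun := ![0, 2, 1, 5, 8, 3, 7, 6, 4]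
  left_inv := by decide
  right_inv := by decide

/-- The map `x ↦ 1 / (x + a)`, where `a` is the generator; it permutes the points cyclically. -/
def lineCycle : Equiv.Perm (Fin 9) where
  toFun := ![1, 8, 6, 0, 5, 2, 7, 3, 4]
  invFun := ![3, 0, 5, 7, 8, 4, 2, 6, 1]
  left_inv := by decide
  right_inv := by decide

/-- The group of permutations of `Fin 9` corresponding to `PSL(2,8)`. -/
noncomputable def linePSL : Subgroup (Equiv.Perm (Fin 9)) :=
  (PSL2 F8).comap lineEquiv.permCongrHom.toMonoidHom

/-- The group of permutations of `Fin 9` corresponding to `PΓL(2,8)`. -/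
noncomputable def linePGammaL : Subgroup (Equiv.Perm (Fin 9)) :=
  (PGammaL2 F8).comap lineEquiv.permCongrHom.toMonoidHom

theorem mem_linePSL_of_matrix {π : Equiv.Perm (Fin 9)} (g : Matrix.SpecialLinearGroup (Fin 2) F8)
    (h : ∀ i, g • linePoint i = linePoint (π i)) : π ∈ linePSL := by
  refine ⟨(g : Matrix.ProjectiveSpecialLinearGroup (Fin 2) F8), ?_⟩
  ext p
  obtain ⟨i, rfl⟩ := lineEquiv.surjective p
  have := h i
  simp only [MulAction.toPermHom_apply, MulAction.toPerm_apply,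
    Matrix.ProjectiveSpecialLinearGroup.smul_proj_mk]
  rw [lineEquiv_apply, this]
  change _ = lineEquiv (π (lineEquiv.symm (lineEquiv i)))
  rw [Equiv.symm_apply_apply, lineEquiv_apply]

theorem smul_linePoint_eq {g : Matrix.SpecialLinearGroup (Fin 2) F8} {i j : Fin 9} (a : F8)
    (h : a • lineVec j = g.1.mulVec (lineVec i)) : g • linePoint i = linePoint j := by
  rw [linePoint, Projectivization.smul_mk]
  exact (Projectivization.mk_eq_mk_iff' _ _ _ _ _).2 ⟨a, h⟩

theorem lineMul_mem : lineMul ∈ linePSL := by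
  have h := gen_cube
  have h2 := two_eq_zero_F8
  have h7 := gen_pow_seven
  -- The diagonal entries have ratio `gen` and product `gen ^ 7 = 1`, so this multiple of
  -- diag(`gen`, 1) has determinant 1.
  refine mem_linePSL_of_matrix ⟨!![gen ^ 4, 0; 0, gen ^ 3], by
    rw [Matrix.det_fin_two_of]; linear_combination h7⟩ fun i => ?_
  refine smul_linePoint_eq (if i = 0 then gen ^ 4 else gen ^ 3) ?_
  ext j
  fin_cases i <;> fin_cases j <;> simp [lineVec, affine, lineMul, Matrix.mulVec, dotProduct] <;>
    grind

theorem lineAdd_mem : lineAdd ∈ linePSL := by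
  have h := gen_cube
  have h2 := two_eq_zero_F8
  have h7 := gen_pow_seven
  refine mem_linePSL_of_matrix ⟨!![1, 1; 0, 1], by simp [Matrix.det_fin_two_of]⟩ fun i => ?_
  refine smul_linePoint_eq 1 ?_
  ext j
  fin_cases i <;> fin_cases j <;> simp [lineVec, affine, lineAdd, Matrix.mulVec, dotProduct] <;>
    grind

theorem lineCycle_mem : lineCycle ∈ linePSL := by
  have h := gen_cube
  have h2 := two_eq_zero_F8
  have h7 := gen_pow_seven
  refine mem_linePSL_of_matrix ⟨!![0, 1; 1, gen], by
    rw [Matrix.det_fin_two_of]; linear_combination -h2⟩ fun i => ?_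
  -- The matrix sends (x, 1) to (1, x + a), where a is the generator. Point 3 has the coordinate x =
  -- a and goes to infinity; elsewhere x + a is the factor to divide out.
  refine smul_linePoint_eq (if i = 0 then 1 else if i = 3 then 1 else affine i + gen) ?_
  ext j
  fin_cases i <;> fin_cases j <;>
    simp [lineVec, affine, lineCycle, Matrix.mulVec, dotProduct] <;> grind

end FieldEight

/-! ### Semilinear maps fixing three points, and the enumeration of both groups by stabilizer
chains. -/

section Semilinear

theorem exists_semilinear_of_mem_PSL2 {K : Type*} [Field K] {π : Equiv.Perm (ℙ K (Fin 2 → K))}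
    (h : π ∈ PSL2 K) : ∃ f, IsInducedBySemilinear π (RingEquiv.refl K) f := by
  obtain ⟨q, rfl⟩ := h
  obtain ⟨g, rfl⟩ := QuotientGroup.mk_surjective q
  refine ⟨g.toLin'_equiv.toLinearEquiv.toAddEquiv, fun c v => ?_, fun v hv => rfl⟩
  exact map_smul g.toLin'_equiv.toLinearEquiv c v

theorem PSL2_le_PGammaL2 (K : Type*) [Field K] : PSL2 K ≤ PGammaL2 K := fun _ h =>
  ⟨_, exists_semilinear_of_mem_PSL2 h⟩

theorem linePSL_le : linePSL ≤ linePGammaL := Subgroup.comap_mono (PSL2_le_PGammaL2 F8)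

/-- The Frobenius automorphism. -/
noncomputable def frobF8 : F8 ≃+* F8 := RingEquiv.ofBijective (frobenius F8 2)
  (Finite.injective_iff_bijective.1 (frobenius F8 2).injective)

theorem frobF8_apply (x : F8) : frobF8 x = x ^ 2 := rfl

theorem lineFrob_mem : lineFrob ∈ linePGammaL := by
  have h7 := gen_pow_seven
  -- Squaring the coordinates maps the chosen representatives to chosen representatives, with no
  -- rescaling.
  have hσ : ∀ i, (fun j => frobF8 (lineVec i j)) = lineVec (lineFrob i) := by
    intro i
    ext j
    fin_cases i <;> fin_cases j <;>
      simp [lineVec, affine, lineFrob, frobF8_apply] <;> grind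
  let f : (Fin 2 → F8) ≃+ (Fin 2 → F8) :=
    { toFun := fun v j => frobF8 (v j)
      invFun := fun v j => frobF8.symm (v j)
      left_inv := fun v => by ext j; simp
      right_inv := fun v => by ext j; simp
      map_add' := fun v w => by ext j; simp }
  refine ⟨frobF8, f, fun c v => ?_, fun v hv => ?_⟩
  · ext j; simp [f]
  · obtain ⟨i, hi⟩ := lineEquiv.surjective (Projectivization.mk F8 v hv)
    rw [← hi]
    change lineEquiv (lineFrob (lineEquiv.symm (lineEquiv i))) = _
    rw [Equiv.symm_apply_apply, lineEquiv_apply]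
    obtain ⟨a, ha⟩ := (Projectivization.mk_eq_mk_iff' _ _ _ _ _).1 hi.symm
    refine (Projectivization.mk_eq_mk_iff' _ _ _ _ _).2 ⟨(frobF8 a)⁻¹, ?_⟩
    have ha0 : a ≠ 0 := fun h => hv (by rw [← ha, h, zero_smul])
    have h0 : frobF8 a ≠ 0 := by simpa using ha0
    rw [← ha, ← hσ i]
    ext j
    simp [f, h0]

/-- A semilinear map that fixes the points `∞`, `0`, `1` acts as a field automorphism. -/
theorem apply_linePoint_of_fix {π : Equiv.Perm (Fin 9)} {σ : F8 ≃+* F8}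
    {f : (Fin 2 → F8) ≃+ (Fin 2 → F8)}
    (h : IsInducedBySemilinear (lineEquiv.permCongrHom π) σ f) (h0 : π 0 = 0) (h1 : π 1 = 1)
    (h2 : π 2 = 2) {i : Fin 9} (hi : i ≠ 0) : affine (π i) = σ (affine i) := by
  have key : ∀ i, ∃ a : F8, a • lineVec (π i) = f (lineVec i) := by
    intro i
    have h3 := h.2 (lineVec i) (lineVec_ne_zero i)
    change lineEquiv (π (lineEquiv.symm (lineEquiv i))) = _ at h3
    rw [Equiv.symm_apply_apply, lineEquiv_apply] at h3
    exact (Projectivization.mk_eq_mk_iff' _ _ _ _ _).1 h3.symm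
  have e0 : lineVec 0 = ![1, 0] := rfl
  have ha1 : affine 1 = 0 := by simp [affine]
  have hv : ∀ i : Fin 9, i ≠ 0 → lineVec i = affine i • lineVec 0 + lineVec 1 := by
    intro i hi
    ext j
    fin_cases j <;> simp [lineVec, hi, ha1]
  obtain ⟨a, ha⟩ := key 0
  obtain ⟨d, hd⟩ := key 1
  obtain ⟨c, hc⟩ := key 2
  obtain ⟨b, hb⟩ := key i
  rw [h0] at ha
  rw [h1] at hd
  rw [h2, hv 2 (by decide), map_add, h.1, ← ha, ← hd] at hc
  have hπi : π i ≠ 0 := fun h => hi (π.injective (h.trans h0.symm))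
  rw [hv i hi, map_add, h.1, ← ha, ← hd, hv _ hπi] at hb
  have ha2 : affine 2 = 1 := by
    simp only [affine]
    rw [if_neg (by decide)]
    exact gen_pow_seven
  have hl1 : lineVec 1 = ![0, 1] := by ext j; fin_cases j <;> simp [lineVec, affine]
  rw [ha2, e0, hl1] at hc
  rw [e0, hl1] at hb
  have hc0 := congrFun hc 0
  have hc1 := congrFun hc 1
  have hb0 := congrFun hb 0
  have hb1 := congrFun hb 1
  simp at hc0 hc1 hb0 hb1
  have ha0 : a ≠ 0 := by
    rintro rfl
    have : f (lineVec 0) = 0 := by rw [← ha, zero_smul]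
    exact lineVec_ne_zero 0 (f.injective (this.trans (map_zero f).symm))
  -- The images of (1,0), (0,1), (1,1) are a(1,0), d(0,1), c(1,1), whence a = c = d. For the
  -- coordinate x of `i` and y of `π i`, the image of (x,1) is (aσ(x), d) = b(y,1), whence b = d = a
  -- and ay = aσ(x).
  have h3 : a * affine (π i) = a * σ (affine i) := by
    rw [← hc0, hc1, ← hb1, hb0, hb1, ← hc1, hc0, mul_comm]
  exact mul_left_cancel₀ ha0 h3

/-- For a linear map the field automorphism is trivial, so all affine coordinates are fixed. -/
theorem eq_one_of_fix {π : Equiv.Perm (Fin 9)} (h : π ∈ linePSL) (h0 : π 0 = 0) (h1 : π 1 = 1)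
    (h2 : π 2 = 2) : π = 1 := by
  obtain ⟨f, hf⟩ := exists_semilinear_of_mem_PSL2 h
  ext i
  by_cases hi : i = 0
  · rw [hi, h0]; rfl
  · have hπi : π i ≠ 0 := fun h => hi (π.injective (h.trans h0.symm))
    rw [affine_injOn hπi hi (apply_linePoint_of_fix hf h0 h1 h2 hi)]
    rfl

theorem affine_pow (k : ℕ) (hk : k < 7) : affine ⟨k + 2, by omega⟩ = gen ^ k := by
  simp only [affine]
  rw [if_neg (by omega), show k + 2 + 5 = 7 + k by omega, pow_add, gen_pow_seven, one_mul]

/-- The permutation acts as a field automorphism σ, which is determined by σ(`gen`) = `gen ^ k`.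
This is again a root of y^3 = y + 1, which leaves k = 1, 2, 4, the three powers of the Frobenius
map. -/
theorem eq_frob_pow_of_fix {π : Equiv.Perm (Fin 9)} (h : π ∈ linePGammaL) (h0 : π 0 = 0)
    (h1 : π 1 = 1) (h2 : π 2 = 2) : ∃ l < 3, π = lineFrob ^ l := by
  obtain ⟨σ, f, hf⟩ := h
  have hσ0 : σ gen ≠ 0 := by simpa using gen_ne_zero
  obtain ⟨k, hk, hgk⟩ := exists_gen_pow_eq hσ0
  have hcube : (gen ^ k) ^ 3 = gen ^ k + 1 := by
    rw [hgk, ← map_pow, gen_cube, map_add, map_one]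
  have h7 := gen_pow_seven
  have hmod : ∀ n, gen ^ n = gen ^ (n % 7) := fun n => by
    conv_lhs => rw [← Nat.div_add_mod n 7, pow_add, pow_mul, h7, one_pow, one_mul]
  have hval : ∀ j < 7, ∀ hj : j + 2 < 9,
      π ⟨j + 2, hj⟩ = ⟨j * k % 7 + 2, by
        have := Nat.mod_lt (j * k) (y := 7) (by omega); omega⟩ := by
    intro j hj hj9
    have hne : (⟨j + 2, hj9⟩ : Fin 9) ≠ 0 := by simp [Fin.ext_iff]
    have hπi : π ⟨j + 2, hj9⟩ ≠ 0 := fun h => hne (π.injective (h.trans h0.symm))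
    refine affine_injOn hπi (by simp [Fin.ext_iff]) ?_
    rw [apply_linePoint_of_fix hf h0 h1 h2 hne, affine_pow j hj,
      affine_pow _ (Nat.mod_lt _ (by omega)), map_pow, ← hgk, ← pow_mul, mul_comm, ← hmod]
  have hext : ∀ ρ : Equiv.Perm (Fin 9), ρ 0 = 0 → ρ 1 = 1 → (∀ j < 7, ∀ hj : j + 2 < 9,
      (ρ ⟨j + 2, hj⟩ : ℕ) = j * k % 7 + 2) → π = ρ := by
    intro ρ hρ0 hρ1 hρ
    ext i
    rcases i with ⟨i, hi⟩
    match i, hi with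
    | 0, _ => exact congrArg Fin.val (h0.trans hρ0.symm)
    | 1, _ => exact congrArg Fin.val (h1.trans hρ1.symm)
    | j + 2, hj => exact (congrArg Fin.val (hval j (by omega) hj)).trans (hρ j (by omega) hj).symm
  have h3 := gen_cube
  have hz := two_eq_zero_F8
  have hne := gen_ne_zero
  have hne1 := gen_ne_one
  interval_cases k
  · grind
  · exact ⟨0, by norm_num, hext _ (by decide) (by decide) (by decide)⟩
  · exact ⟨1, by norm_num, hext _ (by decide) (by decide) (by decide)⟩
  · grind
  · exact ⟨2, by norm_num, hext _ (by decide) (by decide) (by decide)⟩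
  · grind
  · grind

/-- The powers of `g` with exponents less than `n`. -/
def powersBelow {G : Type*} [Group G] (g : G) (n : ℕ) : List G := (List.range n).map (g ^ ·)

/-- The identity and the conjugates of `t` by the powers of an element `m` of order 7. -/
def conjugatesBy {G : Type*} [Group G] (t m : G) : List G :=
  1 :: (List.range 7).map fun k => m ^ k * t * m ^ (7 - k)

/-- The factors of the elements of `PSL(2,8)`. -/
def mobiusFactors {G : Type*} [Group G] (s t m : G) : List (List G) :=
  [powersBelow m 7, conjugatesBy t m, powersBelow s 9]

/-- The factors of the elements of `PΓL(2,8)`. -/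
def semilinearFactors {G : Type*} [Group G] (s t m f : G) : List (List G) :=
  powersBelow f 3 :: mobiusFactors s t m

theorem factorProducts_mem {G : Type*} [Group G] (K : Subgroup G) :
    ∀ Fs : List (List G), (∀ F ∈ Fs, ∀ g ∈ F, g ∈ K) → ∀ g ∈ factorProducts Fs, g ∈ K
  | [], _, g, hg => by
    rw [factorProducts, List.mem_singleton] at hg
    exact hg ▸ K.one_mem
  | F :: Fs, h, g, hg => by
    rw [factorProducts, List.mem_flatMap] at hg
    obtain ⟨a, ha, hg⟩ := hg
    obtain ⟨b, hb, rfl⟩ := List.mem_map.1 hg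
    exact K.mul_mem (factorProducts_mem K Fs (fun F' hF' => h F' (by simp [hF'])) b hb)
      (h F (by simp) a ha)

theorem mem_of_mem_powersBelow {G : Type*} [Group G] {K : Subgroup G} {g : G} (hg : g ∈ K) {n : ℕ}
    {a : G} (ha : a ∈ powersBelow g n) : a ∈ K := by
  obtain ⟨k, -, rfl⟩ := List.mem_map.1 ha
  exact K.pow_mem hg k

theorem mem_of_mem_conjugatesBy {G : Type*} [Group G] {K : Subgroup G} {t m : G} (ht : t ∈ K)
    (hm : m ∈ K) {a : G} (ha : a ∈ conjugatesBy t m) : a ∈ K := by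
  rcases List.mem_cons.1 ha with rfl | ha
  · exact K.one_mem
  · obtain ⟨k, -, rfl⟩ := List.mem_map.1 ha
    exact K.mul_mem (K.mul_mem (K.pow_mem hm _) ht) (K.pow_mem hm _)

theorem mobiusFactors_subset {G : Type*} [Group G] {K : Subgroup G} {s t m : G} (hs : s ∈ K)
    (ht : t ∈ K) (hm : m ∈ K) : ∀ F ∈ mobiusFactors s t m, ∀ g ∈ F, g ∈ K := by
  intro F hF g hg
  simp only [mobiusFactors, List.mem_cons, List.not_mem_nil, or_false] at hF
  rcases hF with rfl | rfl | rfl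
  · exact mem_of_mem_powersBelow hm hg
  · exact mem_of_mem_conjugatesBy ht hm hg
  · exact mem_of_mem_powersBelow hs hg

theorem semilinearFactors_subset {G : Type*} [Group G] {K : Subgroup G} {s t m f : G} (hs : s ∈ K)
    (ht : t ∈ K) (hm : m ∈ K) (hf : f ∈ K) : ∀ F ∈ semilinearFactors s t m f, ∀ g ∈ F, g ∈ K := by
  intro F hF g hg
  rcases List.mem_cons.1 hF with rfl | hF
  · exact mem_of_mem_powersBelow hf hg
  · exact mobiusFactors_subset hs ht hm F hF g hg

/-- Every permutation agrees on `∞`, `0`, `1` with one of the listed elements of `PSL(2,8)`. -/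
theorem exists_mobius_agree (π : Equiv.Perm (Fin 9)) :
    ∃ g ∈ factorProducts (mobiusFactors lineCycle lineAdd lineMul),
      (g⁻¹ * π) 0 = 0 ∧ (g⁻¹ * π) 1 = 1 ∧ (g⁻¹ * π) 2 = 2 := by
  -- The three factors adjust one image each: powers of the 9-cycle move ∞ anywhere, translations
  -- fix ∞ and move 0 anywhere else, and multiplications fix ∞ and 0 and move 1 to any remaining
  -- point.
  have hs : ∀ p : Fin 9, ∃ g ∈ powersBelow lineCycle 9, g 0 = p := by decide
  have ht : ∀ p : Fin 9, p ≠ 0 → ∃ g ∈ conjugatesBy lineAdd lineMul, g 0 = 0 ∧ g 1 = p := by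
    decide
  have hm : ∀ p : Fin 9, p ≠ 0 → p ≠ 1 →
      ∃ g ∈ powersBelow lineMul 7, g 0 = 0 ∧ g 1 = 1 ∧ g 2 = p := by decide
  obtain ⟨a, ha, ha0⟩ := hs (π 0)
  have h1 : (a⁻¹ * π) 1 ≠ 0 := fun h => by
    have : π 1 = π 0 := by rw [← ha0, ← h]; simp
    exact absurd (π.injective this) (by decide)
  obtain ⟨b, hb, hb0, hb1⟩ := ht _ h1
  have hbi : b⁻¹ 0 = 0 := by rw [Equiv.Perm.inv_eq_iff_eq, hb0]
  have ha' : (a⁻¹ * π) 0 = 0 := by rw [Equiv.Perm.mul_apply, ← ha0]; simp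
  have h20 : (b⁻¹ * (a⁻¹ * π)) 2 ≠ 0 := fun h => by
    have : (b⁻¹ * (a⁻¹ * π)) 0 = 0 := by rw [Equiv.Perm.mul_apply, ha', hbi]
    exact absurd ((b⁻¹ * (a⁻¹ * π)).injective (h.trans this.symm)) (by decide)
  have hb' : (b⁻¹ * (a⁻¹ * π)) 1 = 1 := by rw [Equiv.Perm.mul_apply, ← hb1]; simp
  have h21 : (b⁻¹ * (a⁻¹ * π)) 2 ≠ 1 := fun h => by
    exact absurd ((b⁻¹ * (a⁻¹ * π)).injective (h.trans hb'.symm)) (by decide)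
  obtain ⟨c, hc, hc0, hc1, hc2⟩ := hm _ h20 h21
  have hinv : (a * b * c)⁻¹ * π = c⁻¹ * (b⁻¹ * (a⁻¹ * π)) := by group
  refine ⟨a * b * c, ?_, ?_⟩
  · simp only [mobiusFactors, factorProducts, List.mem_flatMap, List.mem_map, List.mem_singleton]
    exact ⟨c, hc, a * b, ⟨b, hb, a, ⟨a, ha, 1, rfl, one_mul a⟩, rfl⟩, rfl⟩
  · rw [hinv]
    refine ⟨?_, ?_, ?_⟩
    · rw [Equiv.Perm.mul_apply, Equiv.Perm.mul_apply b⁻¹, ha', hbi, Equiv.Perm.inv_eq_iff_eq, hc0]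
    · rw [Equiv.Perm.mul_apply, hb', Equiv.Perm.inv_eq_iff_eq, hc1]
    · rw [Equiv.Perm.mul_apply, Equiv.Perm.inv_eq_iff_eq, hc2]

/-- PSL(2,8) is sharply 3-transitive: an element is determined by its images of ∞, 0, 1, and the
listed products already realize all 9·8·7 possibilities. -/
theorem mem_mobius_iff (π : Equiv.Perm (Fin 9)) :
    π ∈ factorProducts (mobiusFactors lineCycle lineAdd lineMul) ↔ π ∈ linePSL := by
  have h := factorProducts_mem linePSL _
    (mobiusFactors_subset lineCycle_mem lineAdd_mem lineMul_mem)
  refine ⟨h π, fun hπ => ?_⟩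
  obtain ⟨g, hg, h0, h1, h2⟩ := exists_mobius_agree π
  have := eq_one_of_fix (linePSL.mul_mem (linePSL.inv_mem (h g hg)) hπ) h0 h1 h2
  rwa [← inv_mul_eq_one.1 this]

/-- After division by the listed element of PSL(2,8) with the same images of ∞, 0, 1, only a power
of the Frobenius map remains. -/
theorem mem_semilinear_iff (π : Equiv.Perm (Fin 9)) :
    π ∈ factorProducts (semilinearFactors lineCycle lineAdd lineMul lineFrob) ↔
      π ∈ linePGammaL := by
  have hle := linePSL_le
  have h := factorProducts_mem linePGammaL _ (semilinearFactors_subset (hle lineCycle_mem)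
    (hle lineAdd_mem) (hle lineMul_mem) lineFrob_mem)
  refine ⟨h π, fun hπ => ?_⟩
  obtain ⟨g, hg, h0, h1, h2⟩ := exists_mobius_agree π
  have hgK := hle ((mem_mobius_iff g).1 hg)
  obtain ⟨l, hl, hpow⟩ :=
    eq_frob_pow_of_fix (linePGammaL.mul_mem (linePGammaL.inv_mem hgK) hπ) h0 h1 h2
  rw [semilinearFactors, factorProducts, List.mem_flatMap]
  refine ⟨_, List.mem_map.2 ⟨l, List.mem_range.2 hl, rfl⟩, List.mem_map.2 ⟨g, hg, ?_⟩⟩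
  rw [← hpow, mul_inv_cancel_left]

/-- Products of factors are determined by the images of suitable base points. -/
theorem factorProducts_cons_nodup {α : Type*} [DecidableEq α] {F : List (Equiv.Perm α)}
    {Fs : List (List (Equiv.Perm α))} {bs : List α} {x : α}
    (h : (factorProducts Fs).Nodup ∧
      ∀ g ∈ factorProducts Fs, ∀ g' ∈ factorProducts Fs, (∀ b ∈ bs, g b = g' b) → g = g')
    (hall : (F.all fun g => bs.all fun b => decide (g b = b)) = true)
    (hF : (F.map fun g => g x).Nodup) :
    (factorProducts (F :: Fs)).Nodup ∧
      ∀ g ∈ factorProducts (F :: Fs), ∀ g' ∈ factorProducts (F :: Fs),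
        (∀ b ∈ x :: bs, g b = g' b) → g = g' := by
  -- The new factor acts first and fixes the earlier base points, so the images of those points
  -- determine the old part of the product; the image of `x` then determines the new factor.
  have hfix : ∀ g ∈ F, ∀ b ∈ bs, g b = b := by simpa using hall
  have hinj := List.inj_on_of_nodup_map hF
  have key : ∀ a ∈ F, ∀ a' ∈ F, ∀ g ∈ factorProducts Fs, ∀ g' ∈ factorProducts Fs,
      (∀ b ∈ bs, (g * a) b = (g' * a') b) → g = g' := by
    intro a ha a' ha' g hg g' hg' hb
    refine h.2 g hg g' hg' fun b hbs => ?_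
    have := hb b hbs
    rwa [Equiv.Perm.mul_apply, Equiv.Perm.mul_apply, hfix a ha b hbs, hfix a' ha' b hbs] at this
  constructor
  · rw [factorProducts, List.nodup_flatMap]
    refine ⟨fun g _ => h.1.map (mul_left_injective g), ?_⟩
    refine (List.Nodup.of_map _ hF).imp_of_mem fun {a a'} ha ha' hne => ?_
    intro k hk hk'
    obtain ⟨g, hg, rfl⟩ := List.mem_map.1 hk
    obtain ⟨g', hg', heq⟩ := List.mem_map.1 hk'
    have := key a ha a' ha' g hg g' hg' fun b _ => by rw [← heq]
    rw [this] at heq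
    exact hne (mul_left_cancel heq).symm
  · intro k hk k' hk' hb
    rw [factorProducts, List.mem_flatMap] at hk hk'
    obtain ⟨a, ha, hk⟩ := hk
    obtain ⟨a', ha', hk'⟩ := hk'
    obtain ⟨g, hg, rfl⟩ := List.mem_map.1 hk
    obtain ⟨g', hg', rfl⟩ := List.mem_map.1 hk'
    have h1 := key a ha a' ha' g hg g' hg' fun b hb' => hb b (by simp [hb'])
    have h2 := hb x (by simp)
    rw [h1] at h2 ⊢
    rw [hinj ha ha' (g'.injective h2)]

theorem nodup_mobius : (factorProducts (mobiusFactors lineCycle lineAdd lineMul)).Nodup ∧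
    ∀ g ∈ factorProducts (mobiusFactors lineCycle lineAdd lineMul),
      ∀ g' ∈ factorProducts (mobiusFactors lineCycle lineAdd lineMul),
        (∀ b ∈ ([2, 1, 0] : List (Fin 9)), g b = g' b) → g = g' := by
  have h0 : (factorProducts ([] : List (List (Equiv.Perm (Fin 9))))).Nodup ∧
      ∀ g ∈ factorProducts ([] : List (List (Equiv.Perm (Fin 9)))),
        ∀ g' ∈ factorProducts [], (∀ b ∈ ([] : List (Fin 9)), g b = g' b) → g = g' := by
    simp [factorProducts]
  have h1 := factorProducts_cons_nodup (F := powersBelow lineCycle 9) (x := 0) h0 (by decide)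
    (by decide)
  have h2 := factorProducts_cons_nodup (F := conjugatesBy lineAdd lineMul) (x := 1) h1 (by decide)
    (by decide)
  have h3 := factorProducts_cons_nodup (F := powersBelow lineMul 7) (x := 2) h2 (by decide)
    (by decide)
  rw [mobiusFactors]
  exact h3

theorem nodup_semilinear :
    (factorProducts (semilinearFactors lineCycle lineAdd lineMul lineFrob)).Nodup := by
  -- The Frobenius powers fix ∞, 0, 1 and are separated by point 3, the generator of the field,
  -- whose images are its powers 1, 2, 4.
  have h := factorProducts_cons_nodup (F := powersBelow lineFrob 3) (x := 3) nodup_mobius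
    (by decide) (by decide)
  rw [semilinearFactors]
  exact h.1

theorem factorProducts_map {G H : Type*} [Group G] [Group H] (θ : G →* H) :
    ∀ Fs : List (List G),
      factorProducts (Fs.map (List.map θ)) = (factorProducts Fs).map θ
  | [] => by simp [factorProducts]
  | F :: Fs => by
    rw [List.map_cons, factorProducts, factorProducts, factorProducts_map θ Fs, List.map_flatMap,
      List.flatMap_map]
    simp [Function.comp_def]

theorem mobiusFactors_map {G H : Type*} [Group G] [Group H] (θ : G →* H) (s t m : G) :
    (mobiusFactors s t m).map (List.map θ) = mobiusFactors (θ s) (θ t) (θ m) := by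
  simp [mobiusFactors, powersBelow, conjugatesBy, Function.comp_def]

theorem semilinearFactors_map {G H : Type*} [Group G] [Group H] (θ : G →* H) (s t m f : G) :
    (semilinearFactors s t m f).map (List.map θ) =
      semilinearFactors (θ s) (θ t) (θ m) (θ f) := by
  rw [semilinearFactors, List.map_cons, mobiusFactors_map]
  simp [semilinearFactors, powersBelow, Function.comp_def]

end Semilinear

/-! ### The actions on 36 points -/

section Edges

/-- The first vertices of the edges of `K₉` that the points of the designs for `PSL(2,8)`
stand for. -/
def pslEdgeFst : List ℕ :=
  [0, 0, 0, 1, 0, 6, 1, 0, 3, 2, 1, 1, 0, 4, 4, 3, 4, 1, 1, 0, 6, 5, 1, 5, 2, 3, 2, 3, 0, 5, 7,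
   2, 2, 2, 4, 3]

/-- The second vertices of these edges. -/
def pslEdgeSnd : List ℕ :=
  [1, 6, 7, 6, 8, 8, 7, 2, 6, 7, 3, 8, 3, 6, 7, 8, 8, 4, 2, 4, 7, 7, 5, 8, 4, 7, 5, 5, 5, 6, 8,
   8, 6, 3, 5, 4]

/-- The action of `lineCycle` on these edges. -/
def pslCycle : List ℕ :=
  [11, 6, 10, 30, 17, 14, 15, 3, 2, 8, 4, 16, 0, 21, 27, 19, 34, 23, 5, 22, 25, 33, 31, 24, 29,
   12, 32, 7, 18, 9, 35, 13, 20, 1, 26, 28]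

/-- The action of `lineAdd` on these edges. -/
def pslAdd : List ℕ :=
  [7, 2, 1, 9, 19, 14, 32, 0, 21, 3, 26, 24, 28, 30, 5, 34, 16, 31, 18, 4, 20, 8, 33, 35, 11,
   29, 10, 27, 12, 25, 13, 17, 6, 22, 15, 23]

/-- The action of `lineMul` on these edges. -/
def pslMul : List ℕ :=
  [0, 2, 4, 6, 7, 9, 11, 12, 14, 15, 17, 18, 19, 21, 23, 24, 26, 22, 10, 28, 30, 5, 3, 32, 27,
   16, 8, 13, 1, 20, 31, 33, 25, 35, 29, 34]

/-- The action of `lineFrob` on these edges. -/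
def pslFrob : List ℕ :=
  [0, 12, 28, 10, 2, 25, 22, 7, 35, 26, 17, 6, 19, 8, 29, 14, 20, 3, 18, 1, 27, 23, 11, 30, 32,
   34, 31, 16, 4, 15, 21, 9, 33, 24, 5, 13]

/-- The first vertices of the edges of `K₉` that the points of the designs for `PΓL(2,8)`
stand for. -/
def pgammalEdgeFst : List ℕ :=
  [5, 6, 4, 2, 2, 2, 5, 4, 3, 4, 4, 2, 3, 6, 5, 2, 1, 3, 2, 3, 1, 1, 7, 3, 1, 0, 1, 1, 1, 0, 0,
   0, 0, 0, 0, 0]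

/-- The second vertices of these edges. -/
def pgammalEdgeSnd : List ℕ :=
  [7, 8, 7, 7, 8, 6, 8, 5, 8, 6, 8, 3, 7, 7, 6, 4, 2, 6, 5, 4, 6, 4, 8, 5, 3, 6, 8, 5, 7, 8, 5,
   1, 7, 2, 4, 3]

/-- The action of `lineCycle` on these edges. -/
def pgammalCycle : List ℕ :=
  [11, 2, 23, 17, 9, 13, 15, 18, 34, 0, 7, 25, 35, 12, 3, 14, 1, 32, 5, 30, 22, 6, 19, 33, 29,
   28, 10, 4, 8, 21, 16, 26, 24, 20, 27, 31]

/-- The action of `lineAdd` on these edges. -/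
def pgammalAdd : List ℕ :=
  [17, 2, 1, 20, 21, 28, 19, 8, 7, 22, 10, 27, 14, 13, 12, 26, 16, 0, 24, 6, 3, 4, 9, 23, 18,
   32, 15, 11, 5, 34, 35, 33, 25, 31, 29, 30]

/-- The action of `lineMul` on these edges. -/
def pgammalMul : List ℕ :=
  [1, 3, 6, 8, 11, 12, 5, 14, 15, 0, 18, 19, 10, 22, 13, 23, 24, 2, 17, 7, 28, 27, 4, 9, 21, 32,
   16, 20, 26, 33, 25, 31, 29, 35, 30, 34]

/-- The action of `lineFrob` on these edges. -/
def pgammalFrob : List ℕ :=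
  [6, 12, 14, 18, 3, 11, 22, 1, 2, 17, 13, 15, 7, 23, 8, 5, 16, 19, 4, 9, 24, 20, 0, 10, 21, 35,
   28, 26, 27, 32, 29, 31, 30, 33, 25, 34]
/-- The edge of `K₉` with the number `x`. -/
def edgeOf (A B : List ℕ) (x : Fin 36) : Finset (Fin 9) :=
  {Fin.ofNat 9 (nth A x), Fin.ofNat 9 (nth B x)}

theorem edgeOf_bijective {A B : List ℕ} (hcard : ∀ x, (edgeOf A B x).card = 2)
    (hinj : Function.Injective (edgeOf A B)) :
    Function.Bijective fun x => (⟨edgeOf A B x, hcard x⟩ : Set.powersetCard (Fin 9) 2) := by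
  have h : Function.Injective fun x => (⟨edgeOf A B x, hcard x⟩ : Set.powersetCard (Fin 9) 2) :=
    fun x y hxy => hinj (congrArg Subtype.val hxy)
  refine (Nat.bijective_iff_injective_and_card _).2 ⟨h, ?_⟩
  rw [Set.powersetCard.card]
  simp only [Nat.card_eq_fintype_card, Fintype.card_fin]
  decide

/-- The numbering of the edges of `K₉` for `PSL(2,8)`. -/
noncomputable def pslEdge : Fin 36 ≃ Set.powersetCard (Fin 9) 2 :=
  Equiv.ofBijective _ (edgeOf_bijective (A := pslEdgeFst) (B := pslEdgeSnd) (by decide +kernel)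
    (by unfold Function.Injective; decide +kernel))

/-- The numbering of the edges of `K₉` for `PΓL(2,8)`. -/
noncomputable def pgammalEdge : Fin 36 ≃ Set.powersetCard (Fin 9) 2 :=
  Equiv.ofBijective _ (edgeOf_bijective (A := pgammalEdgeFst) (B := pgammalEdgeSnd)
    (by decide +kernel) (by unfold Function.Injective; decide +kernel))

/-- The action of permutations of the vertices of `K₉` on the numbers of its edges. -/
noncomputable def edgeHom (e : Fin 36 ≃ Set.powersetCard (Fin 9) 2) :
    Equiv.Perm (Fin 9) →* Equiv.Perm (Fin 36) :=
  e.symm.permCongrHom.toMonoidHom.comp (MulAction.toPermHom _ _)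

theorem edgeHom_injective (e : Fin 36 ≃ Set.powersetCard (Fin 9) 2) :
    Function.Injective (edgeHom e) := by
  have : FaithfulSMul (Equiv.Perm (Fin 9)) (Set.powersetCard (Fin 9) 2) :=
    Set.powersetCard.faithfulSMul (by norm_num) (by simp; norm_num)
  exact e.symm.permCongrHom.injective.comp MulAction.toPerm_injective

/-- Turns the claim that a table describes the induced action on edges into a finite check. The
bound on the entries matters because `Fin.ofNat 36` reduces modulo 36. -/
theorem isTable_edgeHom {e : Fin 36 ≃ Set.powersetCard (Fin 9) 2} {A B : List ℕ}
    (he : ∀ x, (e x : Finset (Fin 9)) = edgeOf A B x) {t : List ℕ} {π : Equiv.Perm (Fin 9)}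
    (h : ∀ x : Fin 36, nth t x < 36 ∧
      edgeOf A B (Fin.ofNat 36 (nth t x)) = (edgeOf A B x).image π) :
    IsTable t (edgeHom e π) := by
  intro x
  obtain ⟨h1, h2⟩ := h x
  have h3 : edgeHom e π x = Fin.ofNat 36 (nth t x) := by
    change e.symm (π • e x) = _
    rw [Equiv.symm_apply_eq, Subtype.ext_iff, Set.powersetCard.coe_smul, he, he, h2]
    rfl
  rw [h3, Fin.val_ofNat, Nat.mod_eq_of_lt h1]

theorem IsTable.ext {t : List ℕ} {g h : Equiv.Perm (Fin 36)} (hg : IsTable t g)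
    (hh : IsTable t h) : g = h :=
  Equiv.ext fun x => Fin.ext ((hg x).symm.trans (hh x))

/-- Powers of a table. -/
def tablePow (a : List ℕ) : ℕ → List ℕ
  | 0 => (List.range 36).map id
  | n + 1 => tableMul (tablePow a n) a

theorem IsTable.pow {a : List ℕ} {g : Equiv.Perm (Fin 36)} (h : IsTable a g) :
    ∀ n, IsTable (tablePow a n) (g ^ n)
  | 0 => by rw [pow_zero]; exact isTable_one
  | n + 1 => by rw [pow_succ]; exact (h.pow n).mul h

/-- Tables of the first powers of a permutation. -/
def tablePowers (a : List ℕ) (n : ℕ) : List (List ℕ) := (List.range n).map (tablePow a)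

/-- Tables of the elements of `conjugatesBy t m`. -/
def tableConjugates (t m : List ℕ) : List (List ℕ) :=
  (List.range 36).map id ::
    (List.range 7).map fun k => tableMul (tableMul (tablePow m k) t) (tablePow m (7 - k))

/-- Tables of the elements of `mobiusFactors s t m`. -/
def tableMobius (s t m : List ℕ) : List (List (List ℕ)) :=
  [tablePowers m 7, tableConjugates t m, tablePowers s 9]

theorem IsTable.powers {a : List ℕ} {g : Equiv.Perm (Fin 36)} (h : IsTable a g) (n : ℕ) :
    List.Forall₂ IsTable (tablePowers a n) (powersBelow g n) := by
  rw [tablePowers, powersBelow, List.forall₂_map_left_iff, List.forall₂_map_right_iff]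
  exact List.forall₂_same.2 fun k _ => h.pow k

theorem isTable_conjugates {t m : List ℕ} {g h : Equiv.Perm (Fin 36)} (ht : IsTable t g)
    (hm : IsTable m h) : List.Forall₂ IsTable (tableConjugates t m) (conjugatesBy g h) := by
  refine List.Forall₂.cons isTable_one ?_
  rw [List.forall₂_map_left_iff, List.forall₂_map_right_iff]
  exact List.forall₂_same.2 fun k _ => ((hm.pow k).mul ht).mul (hm.pow (7 - k))

theorem isTable_mobius {s t m : List ℕ} {a b c : Equiv.Perm (Fin 36)} (hs : IsTable s a)
    (ht : IsTable t b) (hm : IsTable m c) :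
    List.Forall₂ (List.Forall₂ IsTable) (tableMobius s t m) (mobiusFactors a b c) :=
  .cons (hm.powers 7) (.cons (isTable_conjugates ht hm) (.cons (hs.powers 9) .nil))

theorem pslEdge_coe (x : Fin 36) :
    (pslEdge x : Finset (Fin 9)) = edgeOf pslEdgeFst pslEdgeSnd x := rfl

theorem pgammalEdge_coe (x : Fin 36) :
    (pgammalEdge x : Finset (Fin 9)) = edgeOf pgammalEdgeFst pgammalEdgeSnd x := rfl

theorem isTable_pslCycle : IsTable pslCycle (edgeHom pslEdge lineCycle) :=
  isTable_edgeHom pslEdge_coe (by decide +kernel)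

theorem isTable_pslAdd : IsTable pslAdd (edgeHom pslEdge lineAdd) :=
  isTable_edgeHom pslEdge_coe (by decide +kernel)

theorem isTable_pslMul : IsTable pslMul (edgeHom pslEdge lineMul) :=
  isTable_edgeHom pslEdge_coe (by decide +kernel)

theorem isTable_pslFrob : IsTable pslFrob (edgeHom pslEdge lineFrob) :=
  isTable_edgeHom pslEdge_coe (by decide +kernel)

theorem isTable_pgammalCycle : IsTable pgammalCycle (edgeHom pgammalEdge lineCycle) :=
  isTable_edgeHom pgammalEdge_coe (by decide +kernel)

theorem isTable_pgammalAdd : IsTable pgammalAdd (edgeHom pgammalEdge lineAdd) :=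
  isTable_edgeHom pgammalEdge_coe (by decide +kernel)

theorem isTable_pgammalMul : IsTable pgammalMul (edgeHom pgammalEdge lineMul) :=
  isTable_edgeHom pgammalEdge_coe (by decide +kernel)

theorem isTable_pgammalFrob : IsTable pgammalFrob (edgeHom pgammalEdge lineFrob) :=
  isTable_edgeHom pgammalEdge_coe (by decide +kernel)

/-- With the chosen numbering of the edges, g₁ and g₂ are the actions of `lineMul` and of a word `a`
in the generators of PSL(2,8). Conversely, `lineAdd` and `lineCycle` are words in `lineMul` and `a`,
so nothing is lost. -/
theorem permPSL_eq : permPSL = linePSL.map (edgeHom pslEdge) := by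
  set θ := edgeHom pslEdge
  let a : Equiv.Perm (Fin 9) := lineCycle ^ 6 * (lineMul ^ 2 * lineAdd * lineMul ^ 5) * lineMul
  have ha : a ∈ linePSL := linePSL.mul_mem (linePSL.mul_mem (linePSL.pow_mem lineCycle_mem _)
    (linePSL.mul_mem (linePSL.mul_mem (linePSL.pow_mem lineMul_mem _) lineAdd_mem)
      (linePSL.pow_mem lineMul_mem _))) lineMul_mem
  have hta : IsTable (tableMul (tableMul (tablePow pslCycle 6) (tableMul (tableMul
      (tablePow pslMul 2) pslAdd) (tablePow pslMul 5))) pslMul) (θ a) := by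
    simp only [a, map_mul, map_pow]
    exact ((isTable_pslCycle.pow 6).mul (((isTable_pslMul.pow 2).mul isTable_pslAdd).mul
      (isTable_pslMul.pow 5))).mul isTable_pslMul
  rw [permPSL]
  have h1 := isTable_pslMul.ext (h := permOfCycles
      [[2, 3, 5, 8, 13, 20, 29], [4, 7, 12, 19, 11, 18, 23], [6, 10, 16, 25, 28, 14, 22],
       [9, 15, 24, 33, 26, 17, 27], [21, 31, 32, 34, 36, 35, 30]])
    (by unfold IsTable; decide +kernel)
  have h2 := hta.ext (h := permOfCycles
      [[1, 2, 4], [3, 6, 11], [5, 9, 7], [8, 14, 23], [10, 17, 28], [12, 13, 21], [15, 24, 34],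
       [16, 26, 31], [18, 29, 33], [19, 20, 30], [22, 32, 36], [25, 35, 27]])
    (by unfold IsTable; decide +kernel)
  rw [← h1, ← h2]
  apply le_antisymm
  · rw [Subgroup.closure_le]
    rintro g (rfl | rfl)
    · exact ⟨_, lineMul_mem, rfl⟩
    · exact ⟨_, ha, rfl⟩
  · rw [Subgroup.map_le_iff_le_comap]
    intro π hπ
    rw [← mem_mobius_iff] at hπ
    refine factorProducts_mem _ _ ?_ π hπ
    set K := (Subgroup.closure {θ lineMul, θ a}).comap θ
    have hm : lineMul ∈ K := Subgroup.subset_closure (Set.mem_insert _ _)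
    have haK : a ∈ K := Subgroup.subset_closure (Set.mem_insert_of_mem _ rfl)
    -- Explicit words recover the remaining generators; they are verified on the 9 points of the
    -- line instead of the 36 edges.
    have ht : lineAdd = lineMul * a * lineMul * a * a := by decide +kernel
    have hs : lineCycle = lineMul ^ 2 * a ^ 2 * lineMul ^ 3 := by decide +kernel
    refine mobiusFactors_subset ?_ ?_ hm
    · rw [hs]
      exact K.mul_mem (K.mul_mem (K.pow_mem hm _) (K.pow_mem haK _)) (K.pow_mem hm _)
    · rw [ht]
      exact K.mul_mem (K.mul_mem (K.mul_mem (K.mul_mem hm haK) hm) haK) haK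

/-- With this numbering h₁, h₂, h₃ are the actions of `lineMul`, `a` and `b`. Here `b` is the
Frobenius map followed by a multiplication, and words in the three give back all generators of
PΓL(2,8). -/
theorem permPGammaL_eq : permPGammaL = linePGammaL.map (edgeHom pgammalEdge) := by
  set θ := edgeHom pgammalEdge
  let a : Equiv.Perm (Fin 9) := lineCycle ^ 8 * lineMul ^ 5
  let b : Equiv.Perm (Fin 9) := lineMul ^ 6 * lineFrob
  have hmK := linePSL_le lineMul_mem
  have ha : a ∈ linePGammaL := linePGammaL.mul_mem
    (linePGammaL.pow_mem (linePSL_le lineCycle_mem) _) (linePGammaL.pow_mem hmK _)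
  have hb : b ∈ linePGammaL := linePGammaL.mul_mem (linePGammaL.pow_mem hmK _) lineFrob_mem
  have hta : IsTable (tableMul (tablePow pgammalCycle 8) (tablePow pgammalMul 5)) (θ a) := by
    simp only [a, map_mul, map_pow]
    exact (isTable_pgammalCycle.pow 8).mul (isTable_pgammalMul.pow 5)
  have htb : IsTable (tableMul (tablePow pgammalMul 6) pgammalFrob) (θ b) := by
    simp only [b, map_mul, map_pow]
    exact (isTable_pgammalMul.pow 6).mul isTable_pgammalFrob
  rw [permPGammaL]
  have h1 := isTable_pgammalMul.ext (h := permOfCycles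
      [[1, 2, 4, 9, 16, 24, 10], [3, 7, 6, 13, 11, 19, 18], [5, 12, 20, 8, 15, 14, 23],
       [17, 25, 22, 28, 21, 29, 27], [26, 33, 30, 34, 36, 35, 31]])
    (by unfold IsTable; decide +kernel)
  have h2 := hta.ext (h := permOfCycles
      [[1, 3, 8], [2, 5, 6], [4, 10, 7], [9, 17, 26], [11, 19, 14], [12, 21, 30], [13, 22, 31],
       [15, 23, 16], [18, 27, 34], [20, 28, 33], [24, 29, 35], [25, 32, 36]])
    (by unfold IsTable; decide +kernel)
  have h3 := htb.ext (h := permOfCycles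
      [[1, 3, 8], [2, 6, 5], [4, 11, 15], [7, 14, 16], [9, 18, 12], [10, 19, 23], [13, 20, 24],
       [17, 27, 21], [22, 28, 29], [26, 34, 30], [31, 33, 35]])
    (by unfold IsTable; decide +kernel)
  rw [← h1, ← h2, ← h3]
  apply le_antisymm
  · rw [Subgroup.closure_le]
    rintro g (rfl | rfl | rfl)
    · exact ⟨_, hmK, rfl⟩
    · exact ⟨_, ha, rfl⟩
    · exact ⟨_, hb, rfl⟩
  · rw [Subgroup.map_le_iff_le_comap]
    intro π hπ
    rw [← mem_semilinear_iff] at hπ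
    refine factorProducts_mem _ _ ?_ π hπ
    set K := (Subgroup.closure {θ lineMul, θ a, θ b}).comap θ
    have hm : lineMul ∈ K := Subgroup.subset_closure (Set.mem_insert _ _)
    have haK : a ∈ K := Subgroup.subset_closure (Set.mem_insert_of_mem _ (Set.mem_insert _ _))
    have hbK : b ∈ K :=
      Subgroup.subset_closure (Set.mem_insert_of_mem _ (Set.mem_insert_of_mem _ rfl))
    have ht : lineAdd = lineMul ^ 2 * a * lineMul ^ 2 * a ^ 2 := by decide +kernel
    have hs : lineCycle = lineMul ^ 5 * a ^ 2 := by decide +kernel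
    have hf : lineFrob = lineMul * b := by decide +kernel
    refine semilinearFactors_subset ?_ ?_ hm ?_
    · rw [hs]
      exact K.mul_mem (K.pow_mem hm _) (K.pow_mem haK _)
    · rw [ht]
      exact K.mul_mem (K.mul_mem (K.mul_mem (K.pow_mem hm _) haK) (K.pow_mem hm _))
        (K.pow_mem haK _)
    · rw [hf]
      exact K.mul_mem hm hbK

/-- The list of the elements of `PSL(2,8)` on 36 points. -/
noncomputable def pslElements : List (Equiv.Perm (Fin 36)) :=
  factorProducts (mobiusFactors (edgeHom pslEdge lineCycle) (edgeHom pslEdge lineAdd)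
    (edgeHom pslEdge lineMul))

/-- The list of the elements of `PΓL(2,8)` on 36 points. -/
noncomputable def pgammalElements : List (Equiv.Perm (Fin 36)) :=
  factorProducts (semilinearFactors (edgeHom pgammalEdge lineCycle) (edgeHom pgammalEdge lineAdd)
    (edgeHom pgammalEdge lineMul) (edgeHom pgammalEdge lineFrob))

theorem length_pslElements : pslElements.length = 504 := by
  rw [pslElements, mobiusFactors, length_factorProducts_cons, length_factorProducts_cons,
    length_factorProducts_cons]
  simp [factorProducts, powersBelow, conjugatesBy]

theorem length_pgammalElements : pgammalElements.length = 1512 := by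
  rw [pgammalElements, semilinearFactors, mobiusFactors, length_factorProducts_cons,
    length_factorProducts_cons, length_factorProducts_cons, length_factorProducts_cons]
  simp [factorProducts, powersBelow, conjugatesBy]

theorem enumerates_psl : Enumerates pslElements permPSL := by
  have h : pslElements = (factorProducts (mobiusFactors lineCycle lineAdd lineMul)).map
      (edgeHom pslEdge) := by
    rw [← factorProducts_map, mobiusFactors_map]; rfl
  refine ⟨?_, fun g => ?_, by rw [length_pslElements]; norm_num⟩
  · rw [h]; exact nodup_mobius.1.map (edgeHom_injective _)
  · rw [h, List.mem_map, permPSL_eq, Subgroup.mem_map]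
    simp only [mem_mobius_iff]

theorem enumerates_pgammal : Enumerates pgammalElements permPGammaL := by
  have h : pgammalElements = (factorProducts
      (semilinearFactors lineCycle lineAdd lineMul lineFrob)).map (edgeHom pgammalEdge) := by
    rw [← factorProducts_map, semilinearFactors_map]; rfl
  refine ⟨?_, fun g => ?_, by rw [length_pgammalElements]; norm_num⟩
  · rw [h]; exact nodup_semilinear.map (edgeHom_injective _)
  · rw [h, List.mem_map, permPGammaL_eq, Subgroup.mem_map]
    simp only [mem_semilinear_iff]

theorem natCard_permPSL : Nat.card permPSL = 504 := by
  rw [enumerates_psl.natCard, length_pslElements]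

theorem natCard_permPGammaL : Nat.card permPGammaL = 1512 := by
  rw [enumerates_pgammal.natCard, length_pgammalElements]

/-- A subgroup of the permutations of the line, as a subgroup of those of `Fin 9`. -/
noncomputable def comapLineEquiv (H : Subgroup (Equiv.Perm (ℙ F8 (Fin 2 → F8)))) :
    H.comap lineEquiv.permCongrHom.toMonoidHom ≃* H :=
  (Subgroup.equivMapOfInjective _ _ lineEquiv.permCongrHom.injective).trans
    (MulEquiv.subgroupCongr
      (Subgroup.map_comap_eq_self_of_surjective lineEquiv.permCongrHom.surjective H))

theorem nonempty_permPSL_equiv : Nonempty (permPSL ≃* PSL2 F8) :=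
  ⟨((MulEquiv.subgroupCongr permPSL_eq).trans
    (Subgroup.equivMapOfInjective _ _ (edgeHom_injective _)).symm).trans (comapLineEquiv _)⟩

theorem nonempty_permPGammaL_equiv : Nonempty (permPGammaL ≃* PGammaL2 F8) :=
  ⟨((MulEquiv.subgroupCongr permPGammaL_eq).trans
    (Subgroup.equivMapOfInjective _ _ (edgeHom_injective _)).symm).trans (comapLineEquiv _)⟩

theorem natCard_PSL2 : Nat.card (PSL2 F8) = 504 := by
  rw [← Nat.card_congr nonempty_permPSL_equiv.some.toEquiv, natCard_permPSL]

theorem natCard_PGammaL2 : Nat.card (PGammaL2 F8) = 1512 := by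
  rw [← Nat.card_congr nonempty_permPGammaL_equiv.some.toEquiv, natCard_permPGammaL]

/-- The index 1512/504 = 3 is prime, so by Lagrange no order lies strictly between. -/
theorem eq_PSL2_or_eq_PGammaL2 {H : Subgroup (Equiv.Perm (ℙ F8 (Fin 2 → F8)))}
    (h1 : PSL2 F8 ≤ H) (h2 : H ≤ PGammaL2 F8) : H = PSL2 F8 ∨ H = PGammaL2 F8 := by
  have hfin : Finite (PGammaL2 F8) :=
    Nat.finite_of_card_ne_zero (by rw [natCard_PGammaL2]; norm_num)
  have hfinH : Finite H := Finite.of_injective _ (Subgroup.inclusion_injective h2)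
  have d1 := Subgroup.card_dvd_of_le h1
  have d2 := Subgroup.card_dvd_of_le h2
  rw [natCard_PSL2] at d1
  rw [natCard_PGammaL2] at d2
  obtain ⟨c, hc⟩ := d1
  rw [hc, show 1512 = 504 * 3 by norm_num] at d2
  rcases (Nat.dvd_prime Nat.prime_three).1 (Nat.dvd_of_mul_dvd_mul_left (by norm_num) d2) with
    rfl | rfl
  · left
    exact (Subgroup.eq_of_le_of_card_ge h1 (by rw [hc, natCard_PSL2])).symm
  · right
    exact Subgroup.eq_of_le_of_card_ge h2 (by rw [hc, natCard_PGammaL2])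

end Edges

/-! ### Certification of the lists by the kernel -/

section Checks

/-- The packed list of `n` ones. -/
def unitCode (n : ℕ) : ℕ := Nat.div (Nat.sub (Nat.pow 2 (Nat.mul 36 n)) 1) 68719476735

theorem unitCode_length {α : Type*} (L : List α) : unitCode L.length = packed L fun _ => 1 :=
  (packed_const_one L).symm

/-- Application of `k` to the packed list of ones and the rows for the products of tables from the
given lists. -/
def withCodes (Ts : List (List (List ℕ))) (k : ℕ → List ℕ → Bool) : Bool :=
  withRows Ts fun n rows => forceNat (unitCode n) fun one => k one rows

theorem withCodes_spec {Ts : List (List (List ℕ))} {Fs : List (List (Equiv.Perm (Fin 36)))}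
    (h : List.Forall₂ (List.Forall₂ IsTable) Ts Fs) {k : ℕ → List ℕ → Bool}
    (hk : withCodes Ts k = true) :
    ∃ rows, IsRows rows (factorProducts Fs) ∧
      k (packed (factorProducts Fs) fun _ => 1) rows = true := by
  obtain ⟨rows, h1, h2⟩ := withRows_spec (β := Bool) h
  refine ⟨rows, h1, ?_⟩
  rwa [withCodes, h2, forceNat_eq, unitCode_length] at hk

/-- The numbers from zero for the points of the base block of a listed design. -/
def baseOf (e : ℕ × List ℕ) : List ℕ := e.2.map (· - 1)

/-- The base block of a listed design consists of six points. -/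
def IsValidEntry (e : ℕ × List ℕ) : Prop :=
  (baseOf e).Nodup ∧ (∀ x ∈ baseOf e, x < 36) ∧ (baseOf e).length = 6

instance (e : ℕ × List ℕ) : Decidable (IsValidEntry e) := by unfold IsValidEntry; infer_instance

theorem IsValidEntry.card {e : ℕ × List ℕ} (h : IsValidEntry e) : (blockOf e.2).card = 6 := by
  rw [blockOf_eq, pointSet, List.toFinset_card_of_nodup, List.length_map, ← h.2.2, baseOf]
  refine List.Nodup.map_on (fun x hx y hy hxy => ?_) h.1
  simpa [Fin.ext_iff, Nat.mod_eq_of_lt (h.2.1 x hx), Nat.mod_eq_of_lt (h.2.1 y hy)] using hxy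

/-- The base block of `e` is covered `c` times at the representatives `reps`, its stabilizer has
the right order, and `v` is its invariant. -/
structure IsCertified (G : Subgroup (Equiv.Perm (Fin 36))) (c : ℕ) (reps : List (List ℕ))
    (e : ℕ × List ℕ) (v : ℕ) : Prop where
  cover_eq : ∀ T ∈ reps, cover G (blockOf e.2) (pointSet T) = c
  lam_mul : e.1 * cover G (blockOf e.2) (blockOf e.2) = c
  invariant : orbitInvariant G (blockOf e.2) = v

/-- The kernel check for `IsCertified`. -/
def certify (c : ℕ) (reps : List (List ℕ)) (one : ℕ) (rows : List ℕ) (e : ℕ × List ℕ) (v : ℕ) :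
    Bool :=
  forceNat (packedBlocks rows (baseOf e)) fun acc =>
    reps.all (fun T => Nat.beq (coverCode one acc T) c) &&
      (Nat.beq (Nat.mul e.1 (coverCode one acc (baseOf e))) c &&
        Nat.beq (invariantCode one acc (baseOf e)) v)

/-- The kernel check for `IsCertified` along a list. -/
def certifyAll (c : ℕ) (reps : List (List ℕ)) (one : ℕ) (rows : List ℕ) :
    List (ℕ × List ℕ) → List ℕ → Bool
  | [], [] => true
  | e :: es, v :: vs => certify c reps one rows e v && certifyAll c reps one rows es vs
  | _, _ => false

/-- The kernel check that the translates of the pairs in `reps` exhaust the pairs of points. -/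
def checkPairs (reps : List (List ℕ)) (one : ℕ) (rows : List ℕ) : Bool :=
  forceList (reps.map (packedBlocks rows)) fun accs =>
    (List.range 36).all fun x => (List.range 36).all fun y =>
      Nat.beq x y || accs.any fun acc => Nat.blt 0 (coverCode one acc [x, y])

/-- The weight of a pair of points: the numbers of its translates at the representatives, as digits
to base `128`. -/
def pairCode (reps : List (List ℕ)) (one : ℕ) (rows : List ℕ) (x y : ℕ) : ℕ :=
  forceNat (packedBlocks rows [x, y]) fun acc =>
    reps.foldr (fun T s => Nat.add (coverCode one acc T) (Nat.mul 128 s)) 0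

/-- Application of `k` to a list of lists, arranged so that its entries are evaluated first. -/
def forceTable {β : Type*} : List (List ℕ) → (List (List ℕ) → β) → β
  | [], k => k []
  | a :: l, k => forceList a fun a' => forceTable l fun l' => k (a' :: l')

theorem forceTable_eq {β : Type*} : ∀ (l : List (List ℕ)) (k : List (List ℕ) → β),
    forceTable l k = k l
  | [], _ => rfl
  | a :: l, k => by rw [forceTable, forceList_eq, forceTable_eq l]

/-- The kernel check that at most `N` six-element sets contain the points `0` and `1` and are
covered `c` times at each of the representatives. -/
def checkCount (c N : ℕ) (reps : List (List ℕ)) (one : ℕ) (rows : List ℕ) : Bool :=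
  forceTable (triangle (pairCode reps one rows) (List.range' 2 34)) fun tri =>
  forceList ((List.range' 2 34).map fun z =>
    Nat.add (pairCode reps one rows 0 z) (pairCode reps one rows 1 z)) fun ws =>
  forceNat (pairCode reps one rows 0 1) fun s =>
  forceNat (reps.foldr (fun _ s => Nat.add c (Nat.mul 128 s)) 0) fun t =>
    Nat.ble (countWeighted t tri ws 4 s) N

/-- The weight of the set `q` corresponding to `pairCode`. -/
noncomputable def coverWeight (G : Subgroup (Equiv.Perm (Fin 36))) (reps : List (List ℕ))
    (q : Finset (Fin 36)) : ℕ :=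
  reps.foldr (fun T s => cover G q (pointSet T) + 128 * s) 0

theorem triangle_map {α β : Type*} (f : α → α → ℕ) (g : β → α) (l : List β) :
    triangle f (l.map g) = triangle (fun x y => f (g x) (g y)) l := by
  induction l with
  | nil => rfl
  | cons y l ih => rw [List.map_cons, triangle, ih, List.map_map]; rfl

theorem triangle_congr {α : Type*} {f g : α → α → ℕ} {l : List α}
    (h : ∀ x ∈ l, ∀ y ∈ l, f x y = g x y) : triangle f l = triangle g l := by
  induction l with
  | nil => rfl
  | cons y l ih =>
    rw [triangle, triangle, ih fun a ha b hb => h a (by simp [ha]) b (by simp [hb])]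
    congr 1
    exact List.map_congr_left fun z hz => h y (by simp) z (by simp [hz])

variable {G : Subgroup (Equiv.Perm (Fin 36))} {L : List (Equiv.Perm (Fin 36))}
  {rows : List ℕ} {c : ℕ} {reps : List (List ℕ)}

theorem Enumerates.isCertified (h : Enumerates L G) (hr : IsRows rows L)
    (hreps : ∀ T ∈ reps, ∀ x ∈ T, x < 36) {e : ℕ × List ℕ} (he : IsValidEntry e) {v : ℕ}
    (hc : certify c reps (packed L fun _ => 1) rows e v = true) : IsCertified G c reps e v := by
  rw [certify, forceNat_eq, Bool.and_eq_true, Bool.and_eq_true, List.all_eq_true] at hc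
  obtain ⟨h1, h2, h3⟩ := hc
  constructor
  · intro T hT
    rw [blockOf_eq, ← baseOf, ← h.coverCode_eq hr he.2.1 (hreps T hT)]
    exact Nat.eq_of_beq_eq_true (h1 T hT)
  · rw [blockOf_eq, ← baseOf, ← h.coverCode_eq hr he.2.1 he.2.1]
    exact Nat.eq_of_beq_eq_true h2
  · rw [blockOf_eq, ← baseOf, ← h.invariantCode_eq hr he.2.1 he.1]
    exact Nat.eq_of_beq_eq_true h3

theorem Enumerates.forall_isCertified (h : Enumerates L G) (hr : IsRows rows L)
    (hreps : ∀ T ∈ reps, ∀ x ∈ T, x < 36) :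
    ∀ (es : List (ℕ × List ℕ)) (_ : ∀ e ∈ es, IsValidEntry e) (vs : List ℕ)
      (_ : certifyAll c reps (packed L fun _ => 1) rows es vs = true),
      List.Forall₂ (IsCertified G c reps) es vs
  | [], _, [], _ => .nil
  | e :: es, he, v :: vs, hc => by
    rw [certifyAll, Bool.and_eq_true] at hc
    exact .cons (h.isCertified hr hreps (he e (by simp)) hc.1)
      (h.forall_isCertified hr hreps es (fun e' he' => he e' (by simp [he'])) vs hc.2)

/-- A positive cover of a pair by a representative means that a translate of the representative
contains the pair, hence equals it. -/
theorem Enumerates.exists_move_eq (h : Enumerates L G) (hr : IsRows rows L)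
    (hreps : ∀ T ∈ reps, T.length = 2 ∧ ∀ x ∈ T, x < 36)
    (hc : checkPairs reps (packed L fun _ => 1) rows = true) {T : Finset (Fin 36)}
    (hT : T.card = 2) : ∃ R ∈ reps, ∃ g ∈ G, moveBlock g (pointSet R) = T := by
  obtain ⟨x, y, hxy, rfl⟩ := Finset.card_eq_two.1 hT
  rw [checkPairs, forceList_eq, List.all_eq_true] at hc
  have h1 := hc x (List.mem_range.2 x.2)
  rw [List.all_eq_true] at h1
  have h2 := h1 y (List.mem_range.2 y.2)
  rw [Bool.or_eq_true, List.any_eq_true] at h2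
  rcases h2 with h2 | ⟨acc, hacc, h2⟩
  · exact absurd (Fin.ext (Nat.eq_of_beq_eq_true h2)) hxy
  obtain ⟨R, hR, rfl⟩ := List.mem_map.1 hacc
  have h3 : pointSet [(x : ℕ), y] = {x, y} := by simp [pointSet]
  rw [h.coverCode_eq hr (hreps R hR).2 (by simp), h3] at h2
  obtain ⟨g, hg⟩ := Finset.card_pos.1 (show 0 < cover G _ _ from Nat.le_of_ble_eq_true h2)
  obtain ⟨hgG, hsub⟩ := mem_movers.1 hg
  refine ⟨R, hR, g, hgG, (Finset.eq_of_subset_of_card_le hsub ?_).symm⟩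
  rw [card_moveBlock, hT]
  refine (List.toFinset_card_le _).trans ?_
  rw [List.length_map, (hreps R hR).1]

theorem Enumerates.pairCode_eq (h : Enumerates L G) (hr : IsRows rows L)
    (hreps : ∀ T ∈ reps, ∀ x ∈ T, x < 36) {x y : ℕ} (hx : x < 36) (hy : y < 36) :
    pairCode reps (packed L fun _ => 1) rows x y =
      coverWeight G reps {Fin.ofNat 36 x, Fin.ofNat 36 y} := by
  rw [pairCode, forceNat_eq, coverWeight]
  have h3 : pointSet [x, y] = {Fin.ofNat 36 x, Fin.ofNat 36 y} := by simp [pointSet]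
  induction reps with
  | nil => rfl
  | cons T reps ih =>
    rw [List.foldr_cons, List.foldr_cons, ih fun T' hT' => hreps T' (by simp [hT']),
      h.coverCode_eq hr (by simp [hx, hy]) (hreps T (by simp)), h3]
    rfl

/-- Covers of pairs are additive over the pairs in `S`, and the encoding to base 128 is linear in
the covers. No bound on the digits is needed. -/
theorem pairSum_coverWeight (hreps : ∀ T ∈ reps, (pointSet T).card = 2) (S : Finset (Fin 36)) :
    pairSum (coverWeight G reps) S = coverWeight G reps S := by
  unfold coverWeight
  induction reps with
  | nil => simp [pairSum]
  | cons T reps ih =>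
    have h1 := ih fun T' hT' => hreps T' (by simp [hT'])
    simp only [List.foldr_cons]
    rw [← h1, cover_eq_pairSum G (hreps T (by simp)) S]
    simp only [pairSum, Finset.sum_add_distrib, Finset.mul_sum]

/-- The six-element sets containing `{0, 1}` that are covered `c` times at the representatives. -/
noncomputable def goodSets (G : Subgroup (Equiv.Perm (Fin 36))) (c : ℕ) (reps : List (List ℕ)) :
    Finset (Finset (Fin 36)) :=
  (Finset.powersetCard 6 Finset.univ).filter fun S =>
    {0, 1} ⊆ S ∧ ∀ T ∈ reps, cover G S (pointSet T) = c

/-- Every good set has the encoded weight `t`, and the sets of that weight are counted. Only this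
implication is used: if different cover vectors had the same code, the count could only grow, and it
would still be an upper bound. -/
theorem Enumerates.card_goodSets_le (h : Enumerates L G) (hr : IsRows rows L)
    (hreps : ∀ T ∈ reps, (pointSet T).card = 2 ∧ ∀ x ∈ T, x < 36) {N : ℕ}
    (hc : checkCount c N reps (packed L fun _ => 1) rows = true) :
    (goodSets G c reps).card ≤ N := by
  have hreps2 := fun T hT => (hreps T hT).2
  rw [checkCount, forceTable_eq, forceList_eq, forceNat_eq, forceNat_eq] at hc
  refine le_trans ?_ (Nat.le_of_ble_eq_true hc)
  set t := reps.foldr (fun _ s => Nat.add c (Nat.mul 128 s)) 0 with ht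
  have hmem : ∀ x ∈ List.range' 2 34, x < 36 := fun x hx => by
    have := List.mem_range'_1.1 hx
    omega
  have h1 : triangle (pairCode reps (packed L fun _ => 1) rows) (List.range' 2 34) =
      triangle (fun y z => coverWeight G reps {y, z})
        ((List.range' 2 34).map (Fin.ofNat 36)) := by
    rw [triangle_map]
    exact triangle_congr fun x hx y hy => h.pairCode_eq hr hreps2 (hmem x hx) (hmem y hy)
  have h2 : ((List.range' 2 34).map fun z => Nat.add (pairCode reps (packed L fun _ => 1) rows 0 z)
      (pairCode reps (packed L fun _ => 1) rows 1 z)) =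
      ((List.range' 2 34).map (Fin.ofNat 36)).map fun z =>
        coverWeight G reps {0, z} + coverWeight G reps {1, z} := by
    rw [List.map_map]
    refine List.map_congr_left fun z hz => ?_
    rw [h.pairCode_eq hr hreps2 (by norm_num) (hmem z hz),
      h.pairCode_eq hr hreps2 (by norm_num) (hmem z hz)]
    rfl
  rw [h1, h2, h.pairCode_eq hr hreps2 (by norm_num) (by norm_num)]
  -- Besides 0 and 1, a good set has 4 of the 34 points 2, …, 35.
  refine le_trans (Finset.card_le_card ?_) (card_filter_pair_le (a := 0) (b := 1)
    (by decide +kernel) (by decide +kernel) (coverWeight G reps) t 4)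
  intro S hS
  rw [goodSets, Finset.mem_filter] at hS
  refine Finset.mem_filter.2 ⟨hS.1, hS.2.1, ?_⟩
  rw [pairSum_coverWeight fun T hT => (hreps T hT).1, coverWeight, ht]
  have h3 := hS.2.2
  clear_value t
  clear ht hc h1 h2 hreps hreps2 hS
  induction reps with
  | nil => rfl
  | cons T reps ih =>
    rw [List.foldr_cons, List.foldr_cons, ih fun T' hT' => h3 T' (by simp [hT']),
      h3 T (by simp)]
    rfl

end Checks

/-! ### The two lists -/

section Lists

/-- The tables of the factors of the elements of `PSL(2,8)`. -/
def pslFactors : List (List (List ℕ)) := tableMobius pslCycle pslAdd pslMul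

/-- The tables of the factors of the elements of `PΓL(2,8)`. -/
def pgammalFactors : List (List (List ℕ)) :=
  tablePowers pgammalFrob 3 :: tableMobius pgammalCycle pgammalAdd pgammalMul

theorem exists_rows_psl {k : ℕ → List ℕ → Bool} (hk : withCodes pslFactors k = true) :
    ∃ rows, IsRows rows pslElements ∧ k (packed pslElements fun _ => 1) rows = true :=
  withCodes_spec (isTable_mobius isTable_pslCycle isTable_pslAdd isTable_pslMul) hk

theorem exists_rows_pgammal {k : ℕ → List ℕ → Bool} (hk : withCodes pgammalFactors k = true) :
    ∃ rows, IsRows rows pgammalElements ∧ k (packed pgammalElements fun _ => 1) rows = true :=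
  withCodes_spec (.cons (isTable_pgammalFrob.powers 3)
    (isTable_mobius isTable_pgammalCycle isTable_pgammalAdd isTable_pgammalMul)) hk

/-- Representatives of the orbits of `PSL(2,8)` on pairs of points. -/
def pslPairs : List (List ℕ) := [[0, 1], [0, 5], [0, 8], [0, 20]]

/-- Representatives of the orbits of `PΓL(2,8)` on pairs of points. -/
def pgammalPairs : List (List ℕ) := [[0, 1], [0, 2]]

theorem pslPairs_spec : ∀ T ∈ pslPairs, (T.length = 2 ∧ ∀ x ∈ T, x < 36) ∧
    (pointSet T).card = 2 := by
  decide +kernel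

theorem pgammalPairs_spec : ∀ T ∈ pgammalPairs, (T.length = 2 ∧ ∀ x ∈ T, x < 36) ∧
    (pointSet T).card = 2 := by
  decide +kernel

theorem exists_move_eq_psl {T : Finset (Fin 36)} (hT : T.card = 2) :
    ∃ R ∈ pslPairs, ∃ g ∈ permPSL, moveBlock g (pointSet R) = T := by
  obtain ⟨rows, hr, hc⟩ := exists_rows_psl (k := checkPairs pslPairs) (by decide +kernel)
  exact enumerates_psl.exists_move_eq hr (fun R hR => (pslPairs_spec R hR).1) hc hT

theorem exists_move_eq_pgammal {T : Finset (Fin 36)} (hT : T.card = 2) :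
    ∃ R ∈ pgammalPairs, ∃ g ∈ permPGammaL, moveBlock g (pointSet R) = T := by
  obtain ⟨rows, hr, hc⟩ := exists_rows_pgammal (k := checkPairs pgammalPairs) (by decide +kernel)
  exact enumerates_pgammal.exists_move_eq hr (fun R hR => (pgammalPairs_spec R hR).1) hc hT

/-- Here 12 = 504/42. The bound 1436 is met by the listed orbits together with their Frobenius
images, see `le_sum_frobeniusOrbit`. -/
theorem card_goodSets_psl : (goodSets permPSL 12 pslPairs).card ≤ 1436 := by
  obtain ⟨rows, hr, hc⟩ := exists_rows_psl (k := checkCount 12 1436 pslPairs) (by decide +kernel)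
  exact enumerates_psl.card_goodSets_le hr
    (fun R hR => ⟨(pslPairs_spec R hR).2, (pslPairs_spec R hR).1.2⟩) hc

/-- Here 36 = 1512/42, and 11405 = 2 + 4·6 + 9 + 4·12 + 11·18 + 309·36 is the sum of the λ's in
`pgammalTable`. -/
theorem card_goodSets_pgammal : (goodSets permPGammaL 36 pgammalPairs).card ≤ 11405 := by
  obtain ⟨rows, hr, hc⟩ := exists_rows_pgammal (k := checkCount 36 11405 pgammalPairs)
    (by decide +kernel)
  exact enumerates_pgammal.card_goodSets_le hr
    (fun R hR => ⟨(pgammalPairs_spec R hR).2, (pgammalPairs_spec R hR).1.2⟩) hc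

/-- The invariants of the designs listed for `PSL(2,8)`. -/
def pslInvariants : List ℕ :=
  [40049, 57336, 60397, 64131, 87709, 57557, 58296, 37415, 61184, 109306, 85758, 85350, 45633,
   34816, 29808, 31584, 68250, 30189, 38955, 45189, 70235, 128105, 53279, 50083, 57190, 59319,
   57583, 59712, 39265, 17345, 51530, 33324, 34863, 46191, 29304, 39218, 44394, 80736, 105783,
   34626, 38207, 59160, 138624, 4113504, 37236, 161376]

/-- The invariants of the designs listed for `PΓL(2,8)`. -/
def pgammalInvariants : List ℕ :=
  [761607, 406843, 796075, 675719, 415753, 508481, 937706, 461635, 339020, 531594, 393671, 407751,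
   344010, 547475, 1019848, 870704, 1430631, 484205, 561959, 651151, 635319, 566572, 670036,
   389483, 485038, 350666, 407578, 1483849, 910205, 1006489, 1336877, 1406831, 1306527, 1360370,
   1646779, 1051662, 1148459, 538167, 541395, 2591525, 3765886, 2056416, 601279, 802845, 2727941,
   797812, 1401496, 1014980, 1021220, 1613000, 717712, 1719548, 524289, 817615, 996403, 652893,
   584071, 1200872, 418186, 344416, 349122, 859747, 614031, 769846, 380857, 582579, 442787, 659620,
   4549632, 338916, 878266, 1372467, 1701007, 1136998, 2398953, 592142, 1282346, 1631161, 1620818,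
   1268892, 1216351, 2303024, 1272206, 1134656, 877203, 1913454, 767203, 1672736, 374861, 2051008,
   709852, 2383040, 1722183, 1278218, 1226311, 1933627, 877655, 904896, 548859, 510726, 469603,
   3786048, 1442757, 1236839, 406433, 417311, 1843858, 489124, 434533, 499670, 6539616, 863744,
   408752, 1073735, 503510, 333193824, 6647447, 4770925, 7128787, 4873170, 649150, 1760585, 647343,
   613075, 1960928, 630003, 845426, 767923, 11228544, 1224728, 766624, 731530, 836173, 766886,
   1121782, 763667, 553345, 679243, 1265719, 1146914, 412211, 1423837, 1624267, 2279872, 762016,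
   687647, 611587, 397549, 595006, 472967, 399005, 428725, 673283, 689504, 1624448, 1061891,
   1387202, 406520, 1028167, 1422239, 1478231, 871109, 1490198, 2378461, 1473566, 2268263, 332802,
   951101, 386243, 667463, 878471, 637084, 824000, 701294, 445927, 575756, 413885, 965944, 395943,
   383171, 456397, 610163, 548552, 520123, 647185, 660746, 792702, 979975, 1120089, 1448399,
   1172374, 1282052, 387903, 876967, 668672, 472545, 338902, 401741, 570846, 861550, 338450,
   581223, 426664, 338482, 886427, 392572, 428458, 423866, 616899, 389207, 474980, 639616, 400443,
   490703, 480743, 696096, 546428, 811372, 417459, 390881, 546986, 1144899, 541904, 924078, 345074,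
   432901, 710078, 959497, 428747, 774518, 344806, 908850, 675758, 708965, 693423, 959547, 448291,
   559602, 470963, 24758368, 1525295, 1321885, 900355, 1855378, 2256723, 1857691, 1440445, 1653896,
   1290328, 1452089, 980679, 999532, 760551, 848243, 671229, 640570, 612395, 613241, 665507,
   852179, 1411363, 398672, 326846, 333548, 561812, 615904, 400247, 1727870, 1237073, 1813125,
   1472823, 802436, 1000920, 798899, 787674, 678387, 979308, 665258, 1275020, 795544, 780228,
   1033904, 544526, 1198602, 464483, 410839, 418046, 970451, 1179251, 458147, 752134, 460942,
   567767, 13071456, 1428032, 592534, 950458, 626417, 662493, 814021, 610823, 4791960, 1368011,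
   1175973, 486703, 375825, 1051491, 680336, 323876, 726779, 2823903, 2746137, 1147392, 2444731,
   1166987, 1268604, 1724181, 413052, 1999619, 8568423, 696588, 1252512, 786687, 1135526, 1507370,
   983076, 13141440, 757371, 2018570, 6913350]

theorem isValidEntry_psl : ∀ e ∈ pslTable, IsValidEntry e := by decide +kernel

theorem isValidEntry_pgammal : ∀ e ∈ pgammalTable, IsValidEntry e := by decide +kernel

theorem isCertified_psl :
    List.Forall₂ (IsCertified permPSL 12 pslPairs) pslTable pslInvariants := by
  obtain ⟨rows, hr, hc⟩ := exists_rows_psl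
    (k := fun one rows => certifyAll 12 pslPairs one rows pslTable pslInvariants)
    (by decide +kernel)
  exact enumerates_psl.forall_isCertified hr (fun R hR => (pslPairs_spec R hR).1.2) _
    isValidEntry_psl _ hc

/-- Lets the 330 entries for PΓL(2,8) be certified in 10 separate computations of 33 entries each.
-/
theorem forall₂_of_chunks {α β : Type*} {R : α → β → Prop} (n : ℕ) :
    ∀ (m : ℕ) (l : List α) (l' : List β) (_ : l.length ≤ n * m) (_ : l'.length ≤ n * m)
      (_ : ∀ k < m, List.Forall₂ R ((l.drop (n * k)).take n) ((l'.drop (n * k)).take n)),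
      List.Forall₂ R l l'
  | 0, l, l', h, h', _ => by
    rw [Nat.mul_zero, Nat.le_zero, List.length_eq_zero_iff] at h h'
    subst h h'
    exact .nil
  | m + 1, l, l', h, h', hk => by
    rw [← List.take_append_drop n l, ← List.take_append_drop n l']
    refine List.rel_append (hk 0 m.succ_pos) (forall₂_of_chunks n m _ _ ?_ ?_ fun k hkm => ?_)
    · rw [List.length_drop]; rw [Nat.mul_succ] at h; omega
    · rw [List.length_drop]; rw [Nat.mul_succ] at h'; omega
    · rw [List.drop_drop, List.drop_drop, Nat.add_comm, ← Nat.mul_succ]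
      exact hk (k + 1) (Nat.succ_lt_succ hkm)

theorem isCertified_pgammal :
    List.Forall₂ (IsCertified permPGammaL 36 pgammalPairs) pgammalTable pgammalInvariants := by
  have key : ∀ k < 10, withCodes pgammalFactors (fun one rows => certifyAll 36 pgammalPairs one rows
      ((pgammalTable.drop (33 * k)).take 33)
      ((pgammalInvariants.drop (33 * k)).take 33)) = true := by
    intro k hk
    interval_cases k
    · decide +kernel
    · decide +kernel
    · decide +kernel
    · decide +kernel
    · decide +kernel
    · decide +kernel
    · decide +kernel
    · decide +kernel
    · decide +kernel
    · decide +kernel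
  refine forall₂_of_chunks 33 10 _ _ (by decide +kernel) (by decide +kernel) fun k hk => ?_
  obtain ⟨rows, hr, hc⟩ := exists_rows_pgammal (key k hk)
  exact enumerates_pgammal.forall_isCertified hr (fun R hR => (pgammalPairs_spec R hR).1.2) _
    (fun e he => isValidEntry_pgammal e (List.mem_of_mem_drop (List.mem_of_mem_take he))) _ hc

end Lists

/-! ### Completeness of the lists -/

section Isomorphism

variable {P Q R : Type*}

theorem DesignIsomorphic.of_eq {b b' : Set (Finset P)} (h : b = b') : DesignIsomorphic b b' :=
  ⟨1, fun B => by rw [moveBlock_one, h]⟩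

theorem DesignIsomorphic.symm {b : Set (Finset P)} {b' : Set (Finset Q)}
    (h : DesignIsomorphic b b') : DesignIsomorphic b' b := by
  obtain ⟨f, hf⟩ := h
  refine ⟨f.symm, fun B => ?_⟩
  rw [← hf, moveBlock_moveBlock_symm]

theorem DesignIsomorphic.trans {b : Set (Finset P)} {b' : Set (Finset Q)} {b'' : Set (Finset R)}
    (h : DesignIsomorphic b b') (h' : DesignIsomorphic b' b'') : DesignIsomorphic b b'' := by
  obtain ⟨f, hf⟩ := h
  obtain ⟨f', hf'⟩ := h'
  refine ⟨f.trans f', fun B => ?_⟩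
  rw [moveBlock_trans, hf', hf]

theorem IsDesign.of_isomorphic [Fintype P] [Fintype Q] {t v k lam : ℕ} {b : Set (Finset P)}
    {b' : Set (Finset Q)} (hD : IsDesign t v k lam b) (h : DesignIsomorphic b b') :
    IsDesign t v k lam b' := by
  obtain ⟨f, hf⟩ := h
  refine ⟨by rw [← Fintype.card_congr f, hD.card_points], fun B hB => ?_, hD.lam_pos,
    fun T hT => ?_⟩
  · rw [← moveBlock_moveBlock_symm f B, hf] at hB
    rw [← card_moveBlock f.symm, hD.card_block _ hB]
  · rw [← hD.balanced (moveBlock f.symm T) (by rw [card_moveBlock, hT]),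
      ← Set.ncard_image_of_injective _ (moveBlock_injective f)]
    congr 1
    ext C
    constructor
    · rintro ⟨hC, hTC⟩
      refine ⟨moveBlock f.symm C, ⟨?_, ?_⟩, moveBlock_moveBlock_symm f C⟩
      · rwa [← hf, moveBlock_moveBlock_symm]
      · rwa [moveBlock_subset_moveBlock]
    · rintro ⟨D, ⟨hD', hTD⟩, rfl⟩
      refine ⟨(hf D).2 hD', ?_⟩
      rwa [← moveBlock_subset_moveBlock f.symm, moveBlock_symm_moveBlock]

theorem IsDesign.lam_unique [Fintype P] {v k v' k' lam lam' : ℕ} {b : Set (Finset P)}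
    (h : IsDesign 2 v k lam b) (h' : IsDesign 2 v' k' lam' b) (x y : P) (hxy : x ≠ y) :
    lam = lam' := by
  classical
  rw [← h.balanced {x, y} (Finset.card_pair hxy), ← h'.balanced {x, y} (Finset.card_pair hxy)]

/-- The map `f` carries the orbit of `B` under `G` to the orbit of `fB` under the conjugate of `G`
by `f`, which is `G` itself. -/
theorem designIsomorphic_of_mem_normalizer {G : Subgroup (Equiv.Perm P)} {f : Equiv.Perm P}
    (hf : f ∈ Subgroup.normalizer (G : Set (Equiv.Perm P))) (B : Finset P) :
    DesignIsomorphic (orbitBlocks G B) (orbitBlocks G (moveBlock f B)) := by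
  refine ⟨f, fun C => ⟨?_, ?_⟩⟩
  · rintro ⟨g, hg, h⟩
    refine ⟨f⁻¹ * g * f, (Subgroup.mem_normalizer_iff''.1 hf g).1 hg, ?_⟩
    rw [mul_assoc, moveBlock_mul, moveBlock_mul, h, ← moveBlock_mul, inv_mul_cancel, moveBlock_one]
  · rintro ⟨g, hg, rfl⟩
    refine ⟨f * g * f⁻¹, (Subgroup.mem_normalizer_iff.1 hf g).1 hg, ?_⟩
    rw [← moveBlock_mul, ← moveBlock_mul, inv_mul_cancel_right]

theorem move_mem_orbitBlocks {G : Subgroup (Equiv.Perm P)} {f : Equiv.Perm P}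
    (hf : f ∈ Subgroup.normalizer (G : Set (Equiv.Perm P))) {B C : Finset P}
    (h : C ∈ orbitBlocks G B) : moveBlock f C ∈ orbitBlocks G (moveBlock f B) := by
  obtain ⟨g, hg, rfl⟩ := h
  refine ⟨f * g * f⁻¹, (Subgroup.mem_normalizer_iff.1 hf g).1 hg, ?_⟩
  rw [← moveBlock_mul, ← moveBlock_mul, inv_mul_cancel_right]

end Isomorphism

/-! ### Exhausting the candidate blocks through {0, 1}. -/

section Completeness

variable {G : Subgroup (Equiv.Perm (Fin 36))} {c : ℕ} {reps : List (List ℕ)}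

theorem IsCertified.isDesign {e : ℕ × List ℕ} {v : ℕ} (h : IsCertified G c reps e v)
    (he : IsValidEntry e) (hc : 0 < c)
    (hreps : ∀ T : Finset (Fin 36), T.card = 2 →
      ∃ R ∈ reps, ∃ g ∈ G, moveBlock g (pointSet R) = T) :
    IsDesign 2 36 6 e.1 (listedBlocks G e) := by
  refine isDesign_orbitBlocks (Fintype.card_fin 36) he.card hc (fun T hT => ?_) h.lam_mul
  obtain ⟨R, hR, g, hg, rfl⟩ := hreps T hT
  rw [cover_move hg, h.cover_eq R hR]

theorem pairwise_not_isomorphic {L : List (ℕ × List ℕ)} {vs : List ℕ}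
    (h : List.Forall₂ (IsCertified G c reps) L vs) (hvs : vs.Nodup) :
    L.Pairwise fun e e' => ¬ DesignIsomorphic (listedBlocks G e) (listedBlocks G e') := by
  have hmap : L.map (fun e => orbitInvariant G (blockOf e.2)) = vs := by
    induction h with
    | nil => rfl
    | cons h _ ih => rw [List.map_cons, h.invariant, ih (List.nodup_cons.1 hvs).2]
  rw [← hmap, List.Nodup, List.pairwise_map] at hvs
  exact hvs.imp fun hne hiso => hne (orbitInvariant_eq hiso)

theorem forall_isDesign {L : List (ℕ × List ℕ)} {vs : List ℕ}
    (h : List.Forall₂ (IsCertified G c reps) L vs) (hL : ∀ e ∈ L, IsValidEntry e) (hc : 0 < c)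
    (hreps : ∀ T : Finset (Fin 36), T.card = 2 →
      ∃ R ∈ reps, ∃ g ∈ G, moveBlock g (pointSet R) = T) :
    ∀ e ∈ L, IsDesign 2 36 6 e.1 (listedBlocks G e) := by
  induction h with
  | nil => simp
  | cons h _ ih =>
    intro e he
    rcases List.mem_cons.1 he with rfl | he
    · exact h.isDesign (hL _ (by simp)) hc hreps
    · exact ih (fun e he => hL e (by simp [he])) e he

theorem IsDesign.mem_goodSets {lam : ℕ} {B C : Finset (Fin 36)}
    (hD : IsDesign 2 36 6 lam (orbitBlocks G B)) (hG : Nat.card G = 42 * c)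
    (hreps : ∀ T ∈ reps, (pointSet T).card = 2) (hC : C ∈ orbitBlocks G B) (h01 : {0, 1} ⊆ C) :
    C ∈ goodSets G c reps := by
  refine Finset.mem_filter.2 ⟨Finset.mem_powersetCard_univ.2 (hD.card_block C hC), h01,
    fun T hT => ?_⟩
  -- Any block of the orbit may serve as its base block, so the constancy of the cover applies to
  -- `C`.
  rw [← orbitBlocks_eq_of_mem hC] at hD
  exact (hD.cover_eq hG).1 _ (hreps T hT)

theorem IsDesign.exists_block_through {lam : ℕ} {B : Finset (Fin 36)}
    (hD : IsDesign 2 36 6 lam (orbitBlocks G B)) : ∃ C ∈ orbitBlocks G B, {0, 1} ⊆ C := by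
  have h := hD.balanced {0, 1} (by decide)
  obtain ⟨C, hC⟩ := Set.nonempty_of_ncard_ne_zero (h.trans_ne hD.lam_pos.ne')
  exact ⟨C, hC.1, hC.2⟩

/-- A list of base blocks whose orbits are different designs is complete if the sum of its `λ`s
is at least the number of sets that can be blocks through `{0, 1}`. -/
theorem IsDesign.exists_mem_list {lam : ℕ} {B : Finset (Fin 36)}
    (hD : IsDesign 2 36 6 lam (orbitBlocks G B)) (hG : Nat.card G = 42 * c)
    (hreps : ∀ T ∈ reps, (pointSet T).card = 2) (l : List (ℕ × Finset (Fin 36)))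
    (hl : ∀ e ∈ l, IsDesign 2 36 6 e.1 (orbitBlocks G e.2))
    (hp : l.Pairwise fun e e' => orbitBlocks G e.2 ≠ orbitBlocks G e'.2)
    (hc : (goodSets G c reps).card ≤ (l.map Prod.fst).sum) :
    ∃ e ∈ l, e.1 = lam ∧ orbitBlocks G e.2 = orbitBlocks G B := by
  obtain ⟨C, hC, h01⟩ := hD.exists_block_through
  obtain ⟨e, he, hCe⟩ := exists_mem_orbitBlocks_of_card (T := {0, 1}) (by decide) l _ hl hp hc
    (fun e he C hC h01 => (hl e he).mem_goodSets hG hreps hC h01)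
    (hD.mem_goodSets hG hreps hC h01)
  have h : orbitBlocks G e.2 = orbitBlocks G B :=
    (orbitBlocks_eq_of_mem hCe).symm.trans (orbitBlocks_eq_of_mem hC)
  refine ⟨e, he, ?_, h⟩
  have hde := hl e he
  rw [h] at hde
  exact hde.lam_unique hD 0 1 (by decide)

theorem isExactList_of_certified {L : List (ℕ × List ℕ)} {vs : List ℕ}
    (h : List.Forall₂ (IsCertified G c reps) L vs) (hL : ∀ e ∈ L, IsValidEntry e) (hc : 0 < c)
    (hreps : ∀ T : Finset (Fin 36), T.card = 2 →
      ∃ R ∈ reps, ∃ g ∈ G, moveBlock g (pointSet R) = T) (hvs : vs.Nodup) :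
    IsExactList G L where
  isDesign := forall_isDesign h hL hc hreps
  isAutGroup _ _ := isAutGroup_orbitBlocks _ _
  isBlockTransitive _ _ := isBlockTransitive_orbitBlocks _ _
  not_isomorphic := pairwise_not_isomorphic h hvs

/-- The kernel check that the numbers of a list are different. -/
def checkNodup : List ℕ → Bool
  | [] => true
  | a :: l => l.all (fun b => !Nat.beq a b) && checkNodup l

theorem nodup_of_checkNodup : ∀ l : List ℕ, checkNodup l = true → l.Nodup
  | [], _ => List.nodup_nil
  | a :: l, h => by
    rw [checkNodup, Bool.and_eq_true, List.all_eq_true] at h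
    refine List.nodup_cons.2 ⟨fun ha => ?_, nodup_of_checkNodup l h.2⟩
    have h1 : a.beq a = true := Nat.beq_refl a
    simpa [h1] using h.1 a ha

theorem isExactList_psl : IsExactList permPSL pslTable :=
  isExactList_of_certified isCertified_psl isValidEntry_psl (by norm_num)
    (fun _ hT => exists_move_eq_psl hT) (nodup_of_checkNodup _ (by decide +kernel))

theorem isExactList_pgammal : IsExactList permPGammaL pgammalTable :=
  isExactList_of_certified isCertified_pgammal isValidEntry_pgammal (by norm_num)
    (fun _ hT => exists_move_eq_pgammal hT) (nodup_of_checkNodup _ (by decide +kernel))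

/-- For PΓL(2,8) the λ's of the list alone reach the bound for the good sets, so every design orbit
is literally one of the listed orbits. -/
theorem exists_listed_pgammal {lam : ℕ} {B : Finset (Fin 36)}
    (hD : IsDesign 2 36 6 lam (orbitBlocks permPGammaL B)) :
    ∃ e ∈ pgammalTable, e.1 = lam ∧
      DesignIsomorphic (listedBlocks permPGammaL e) (orbitBlocks permPGammaL B) := by
  obtain ⟨_, he, hlam, h⟩ := hD.exists_mem_list (c := 36) natCard_permPGammaL
    (fun T hT => (pgammalPairs_spec T hT).2) (pgammalTable.map fun e => (e.1, blockOf e.2))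
    (fun _ he => by
      obtain ⟨e, he', rfl⟩ := List.mem_map.1 he
      exact isExactList_pgammal.isDesign e he')
    (by
      rw [List.pairwise_map]
      exact isExactList_pgammal.not_isomorphic.imp fun hne heq => hne (.of_eq heq))
    (card_goodSets_pgammal.trans (by rw [List.map_map]; decide +kernel))
  obtain ⟨e, he', rfl⟩ := List.mem_map.1 he
  exact ⟨e, he', hlam, .of_eq h⟩

/-! ### Frobenius conjugates of the designs for PSL(2,8). -/

/-- The Frobenius automorphism, acting on the points of the designs for `PSL(2,8)`. -/
noncomputable def pslFrobenius : Equiv.Perm (Fin 36) := edgeHom pslEdge lineFrob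

theorem pslFrobenius_pow_three : pslFrobenius ^ 3 = 1 := by
  rw [pslFrobenius, ← map_pow, show lineFrob ^ 3 = 1 by decide +kernel, map_one]

/-- The conjugate is x ↦ 1/(x + a²), where a is the generator. Since a² = a + a⁴, it is x ↦ 1/(x +
a) after the translation by a⁴, and that translation is a conjugate of `lineAdd`. -/
theorem lineFrob_conj_cycle : lineFrob * lineCycle * lineFrob⁻¹ =
    lineCycle * (lineMul ^ 4 * lineAdd * lineMul ^ 3) := by
  decide +kernel

theorem lineFrob_conj_add : lineFrob * lineAdd * lineFrob⁻¹ = lineAdd := by decide +kernel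

theorem lineFrob_conj_mul : lineFrob * lineMul * lineFrob⁻¹ = lineMul ^ 2 := by decide +kernel

/-- Conjugation is a homomorphism, so the three generators suffice. -/
theorem lineFrob_conj_mem {π : Equiv.Perm (Fin 9)} (h : π ∈ linePSL) :
    lineFrob * π * lineFrob⁻¹ ∈ linePSL := by
  have key : ∀ ρ, ρ ∈ linePSL.comap (MulAut.conj lineFrob).toMonoidHom ↔
      lineFrob * ρ * lineFrob⁻¹ ∈ linePSL := fun ρ => by
    rw [Subgroup.mem_comap, MulEquiv.coe_toMonoidHom, MulAut.conj_apply]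
  rw [← mem_mobius_iff] at h
  rw [← key]
  refine factorProducts_mem _ _ (mobiusFactors_subset ?_ ?_ ?_) π h
  · rw [key, lineFrob_conj_cycle]
    exact linePSL.mul_mem lineCycle_mem (linePSL.mul_mem (linePSL.mul_mem
      (linePSL.pow_mem lineMul_mem 4) lineAdd_mem) (linePSL.pow_mem lineMul_mem 3))
  · rw [key, lineFrob_conj_add]
    exact lineAdd_mem
  · rw [key, lineFrob_conj_mul]
    exact linePSL.pow_mem lineMul_mem 2

theorem pslFrobenius_mem_normalizer :
    pslFrobenius ∈ Subgroup.normalizer (permPSL : Set (Equiv.Perm (Fin 36))) := by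
  have h1 : ∀ g ∈ permPSL, pslFrobenius * g * pslFrobenius⁻¹ ∈ permPSL := by
    rw [permPSL_eq]
    rintro _ ⟨π, hπ, rfl⟩
    exact ⟨_, lineFrob_conj_mem hπ, by simp [pslFrobenius]⟩
  refine Subgroup.mem_normalizer_iff.2 fun g => ⟨h1 g, fun h => ?_⟩
  -- The Frobenius map has cube 1, so two further conjugations undo the first; this gives the
  -- converse inclusion.
  have h2 := h1 _ (h1 _ h)
  have h3 : pslFrobenius * (pslFrobenius * (pslFrobenius * g * pslFrobenius⁻¹) * pslFrobenius⁻¹) *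
      pslFrobenius⁻¹ = pslFrobenius ^ 3 * g * (pslFrobenius ^ 3)⁻¹ := by
    simp only [pow_three, mul_inv_rev, mul_assoc]
  rwa [h3, pslFrobenius_pow_three, one_mul, inv_one, mul_one] at h2

/-- The number of designs conjugate to that of `e` under the Frobenius automorphism. -/
noncomputable def frobeniusOrbit (e : ℕ × List ℕ) : ℕ :=
  if cover permPSL (blockOf e.2) (moveBlock pslFrobenius (blockOf e.2)) = 0 then 3 else 1

/-- The kernel's version of `frobeniusOrbit`. -/
def frobeniusCode (one : ℕ) (rows : List ℕ) (e : ℕ × List ℕ) : ℕ :=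
  bif Nat.beq (forceNat (packedBlocks rows (baseOf e)) fun acc =>
    coverCode one acc ((baseOf e).map (nth pslFrob))) 0 then 3 else 1

theorem frobeniusCode_eq {rows : List ℕ} (hr : IsRows rows pslElements) {e : ℕ × List ℕ}
    (he : IsValidEntry e) :
    frobeniusCode (packed pslElements fun _ => 1) rows e = frobeniusOrbit e := by
  have h1 : ∀ x ∈ baseOf e, nth pslFrob x = pslFrobenius (Fin.ofNat 36 x) := fun x hx => by
    rw [pslFrobenius, ← isTable_pslFrob, Fin.val_ofNat, Nat.mod_eq_of_lt (he.2.1 x hx)]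
  have h2 : ∀ y ∈ (baseOf e).map (nth pslFrob), y < 36 := by
    intro y hy
    obtain ⟨x, hx, rfl⟩ := List.mem_map.1 hy
    rw [h1 x hx]
    exact Fin.is_lt _
  have h3 : pointSet ((baseOf e).map (nth pslFrob)) = moveBlock pslFrobenius (blockOf e.2) := by
    rw [blockOf_eq, ← baseOf]
    ext y
    rw [mem_pointSet h2, mem_moveBlock, mem_pointSet he.2.1, List.mem_map]
    constructor
    · rintro ⟨x, hx, hxy⟩
      rw [h1 x hx, ← Fin.ext_iff] at hxy
      rw [← hxy, Equiv.symm_apply_apply, Fin.val_ofNat, Nat.mod_eq_of_lt (he.2.1 x hx)]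
      exact hx
    · intro h
      refine ⟨_, h, ?_⟩
      rw [h1 _ h, Fin.ofNat_val_eq_self, Equiv.apply_symm_apply]
  rw [frobeniusCode, forceNat_eq, enumerates_psl.coverCode_eq hr he.2.1 h2, h3, baseOf,
    ← blockOf_eq, frobeniusOrbit]
  by_cases h : cover permPSL (blockOf e.2) (moveBlock pslFrobenius (blockOf e.2)) = 0
  · rw [if_pos h, h]; rfl
  · rw [if_neg h, show Nat.beq _ 0 = false from
      Bool.eq_false_iff.2 fun h0 => h (Nat.eq_of_beq_eq_true h0)]
    rfl

/-- The counterpart of `card_goodSets_psl`: counted with the one or three orbits for which each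
entry stands, the λ's reach the upper bound for the number of good sets. -/
theorem le_sum_frobeniusOrbit :
    1436 ≤ (pslTable.map fun e => frobeniusOrbit e * e.1).sum := by
  obtain ⟨rows, hr, hc⟩ := exists_rows_psl (k := fun one rows => Nat.ble 1436
    ((pslTable.map fun e => Nat.mul (frobeniusCode one rows e) e.1).foldr Nat.add 0))
    (by decide +kernel)
  refine (Nat.le_of_ble_eq_true hc).trans (le_of_eq (congrArg List.sum (List.map_congr_left
    fun e he => ?_)))
  rw [frobeniusCode_eq hr (isValidEntry_psl e he)]
  rfl

/-- The images of a listed block under the Frobenius automorphism that are in different orbits. -/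
noncomputable def frobeniusImages (e : ℕ × List ℕ) : List (ℕ × Finset (Fin 36)) :=
  (List.range (frobeniusOrbit e)).map fun i => (e.1, moveBlock (pslFrobenius ^ i) (blockOf e.2))

theorem listed_isomorphic_frobenius (e : ℕ × List ℕ) (i : ℕ) :
    DesignIsomorphic (listedBlocks permPSL e)
      (orbitBlocks permPSL (moveBlock (pslFrobenius ^ i) (blockOf e.2))) :=
  designIsomorphic_of_mem_normalizer (Subgroup.pow_mem _ pslFrobenius_mem_normalizer i) _

/-- The Frobenius map permutes the orbits and its cube is 1. If it moves the orbit of `B`, any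
coincidence among the three images would, after further applications of the map, identify the orbit
with its image. -/
theorem pairwise_frobeniusImages (e : ℕ × List ℕ) :
    (frobeniusImages e).Pairwise fun a b => orbitBlocks permPSL a.2 ≠ orbitBlocks permPSL b.2 := by
  rw [frobeniusImages, List.pairwise_map, frobeniusOrbit]
  split
  · rename_i h
    set B := blockOf e.2
    have hφ := pslFrobenius_mem_normalizer
    have hB : moveBlock pslFrobenius B ∉ orbitBlocks permPSL B := by
      rintro ⟨g, hg, hgB⟩
      exact (Finset.card_pos.2 ⟨g, mem_movers.2 ⟨hg, hgB.ge⟩⟩).ne' h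
    have hpow : moveBlock pslFrobenius (moveBlock pslFrobenius (moveBlock pslFrobenius B)) = B := by
      rw [← moveBlock_mul, ← moveBlock_mul, ← pow_three', pslFrobenius_pow_three,
        moveBlock_one]
    have h01 : orbitBlocks permPSL B ≠ orbitBlocks permPSL (moveBlock pslFrobenius B) :=
      fun h => hB (h ▸ self_mem_orbitBlocks _ _)
    have h02 : orbitBlocks permPSL B ≠
        orbitBlocks permPSL (moveBlock pslFrobenius (moveBlock pslFrobenius B)) := fun h => by
      have h1 := move_mem_orbitBlocks hφ
        (h ▸ self_mem_orbitBlocks _ _ : moveBlock pslFrobenius (moveBlock pslFrobenius B) ∈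
          orbitBlocks permPSL B)
      rw [hpow] at h1
      exact h01 (orbitBlocks_eq_of_mem h1)
    have h12 : orbitBlocks permPSL (moveBlock pslFrobenius B) ≠
        orbitBlocks permPSL (moveBlock pslFrobenius (moveBlock pslFrobenius B)) := fun h => by
      have h1 := move_mem_orbitBlocks hφ
        (h ▸ self_mem_orbitBlocks _ _ : moveBlock pslFrobenius (moveBlock pslFrobenius B) ∈
          orbitBlocks permPSL (moveBlock pslFrobenius B))
      rw [hpow] at h1
      exact h02 (orbitBlocks_eq_of_mem h1)
    have h2 : ∀ C : Finset (Fin 36), moveBlock (pslFrobenius ^ 2) C =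
        moveBlock pslFrobenius (moveBlock pslFrobenius C) := fun C => by
      rw [pow_two, moveBlock_mul]
    simp [List.range_succ, moveBlock_one, h2, h01, h02, h12]
  · simp

/-- The table lists isomorphism classes, whereas the counting argument needs orbits. Adding the
Frobenius images supplies the missing orbits, and each of them is isomorphic to its entry; images of
different entries are different because the entries are non-isomorphic. -/
theorem exists_listed_psl {lam : ℕ} {B : Finset (Fin 36)}
    (hD : IsDesign 2 36 6 lam (orbitBlocks permPSL B)) :
    ∃ e ∈ pslTable, e.1 = lam ∧
      DesignIsomorphic (listedBlocks permPSL e) (orbitBlocks permPSL B) := by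
  have hmem : ∀ e, ∀ a ∈ frobeniusImages e, a.1 = e.1 ∧
      DesignIsomorphic (listedBlocks permPSL e) (orbitBlocks permPSL a.2) := by
    intro e a ha
    obtain ⟨i, -, rfl⟩ := List.mem_map.1 ha
    exact ⟨rfl, listed_isomorphic_frobenius e i⟩
  obtain ⟨a, ha, hlam, h⟩ := hD.exists_mem_list (c := 12) natCard_permPSL
    (fun T hT => (pslPairs_spec T hT).2) (pslTable.flatMap frobeniusImages)
    (fun a ha => by
      obtain ⟨e, he, ha⟩ := List.mem_flatMap.1 ha
      rw [(hmem e a ha).1]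
      exact (isExactList_psl.isDesign e he).of_isomorphic (hmem e a ha).2)
    (List.pairwise_flatMap.2 ⟨fun e _ => pairwise_frobeniusImages e,
      isExactList_psl.not_isomorphic.imp fun {e e'} hne a ha b hb heq =>
        hne (((hmem e a ha).2.trans (.of_eq heq)).trans (hmem e' b hb).2.symm)⟩)
    (card_goodSets_psl.trans (le_sum_frobeniusOrbit.trans (le_of_eq (by
      rw [List.map_flatMap, List.flatMap, List.sum_flatten, List.map_map]
      refine congrArg List.sum (List.map_congr_left fun e _ => ?_)
      simp [frobeniusImages, Function.comp_def]))))
  obtain ⟨e, he, ha⟩ := List.mem_flatMap.1 ha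
  exact ⟨e, he, (hmem e a ha).1.symm.trans hlam, (hmem e a ha).2.trans (.of_eq h)⟩

end Completeness

/-! ### Point-transitivity and identification of the action -/

section Transitivity

variable {P : Type*} [Fintype P] [DecidableEq P]

/-- Double counting of the triples (x, y, B) with x ∈ A, y ∈ C, x ≠ y and both points in B.
Truncated subtraction is harmless: `C ∩ B = ∅` forces `A ∩ B = ∅`. -/
theorem IsDesign.sum_card_inter {v k lam : ℕ} {blocks : Set (Finset P)}
    (hD : IsDesign 2 v k lam blocks) (F : Finset (Finset P)) (hF : ∀ B, B ∈ F ↔ B ∈ blocks)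
    {A C : Finset P} (hAC : A ⊆ C) :
    ∑ B ∈ F, (A ∩ B).card * ((C ∩ B).card - 1) = A.card * (C.card - 1) * lam := by
  have h1 : ∀ B : Finset P, (A ∩ B).card * ((C ∩ B).card - 1) =
      ∑ x ∈ A, ∑ y ∈ C.erase x, if {x, y} ⊆ B then 1 else 0 := by
    intro B
    have h2 : ∀ x ∈ A, (∑ y ∈ C.erase x, if {x, y} ⊆ B then 1 else 0) =
        if x ∈ B then (C ∩ B).card - 1 else 0 := by
      intro x hx
      rw [← Finset.card_filter]
      split_ifs with hxB
      · rw [← Finset.card_erase_of_mem (Finset.mem_inter.2 ⟨hAC hx, hxB⟩)]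
        congr 1
        ext y
        simp [Finset.insert_subset_iff, hxB, and_assoc]
      · rw [Finset.card_eq_zero, Finset.filter_eq_empty_iff]
        exact fun y _ h => hxB (h (Finset.mem_insert_self x _))
    rw [Finset.sum_congr rfl h2, ← Finset.sum_filter, Finset.sum_const, smul_eq_mul,
      Finset.filter_mem_eq_inter]
  have h3 : ∀ x ∈ A, ∀ y ∈ C.erase x, (∑ B ∈ F, if {x, y} ⊆ B then 1 else 0) = lam := by
    intro x _ y hy
    rw [← Finset.card_filter, ←
      hD.balanced {x, y} (Finset.card_pair (Finset.ne_of_mem_erase hy).symm),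
      ← Set.ncard_coe_finset]
    congr 1
    ext B
    simp [hF]
  rw [Finset.sum_congr rfl fun B _ => h1 B, Finset.sum_comm]
  have h4 : ∀ x ∈ A, (∑ B ∈ F, ∑ y ∈ C.erase x, if {x, y} ⊆ B then 1 else 0) =
      (C.card - 1) * lam := by
    intro x hx
    rw [Finset.sum_comm, Finset.sum_congr rfl (h3 x hx), Finset.sum_const, smul_eq_mul,
      Finset.card_erase_of_mem (hAC hx)]
  rw [Finset.sum_congr rfl h4, Finset.sum_const, smul_eq_mul, mul_assoc]

/-- **Block's lemma** for `2`-`(36, 6, λ)` designs. -/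
theorem IsDesign.exists_apply_eq {lam : ℕ} {blocks : Set (Finset P)}
    (hD : IsDesign 2 36 6 lam blocks) {G : Subgroup (Equiv.Perm P)}
    (hT : IsBlockTransitive G blocks) (x y : P) : ∃ g ∈ G, g x = y := by
  classical
  let F : Finset (Finset P) := Finset.univ.filter fun B => B ∈ blocks
  have hF : ∀ B, B ∈ F ↔ B ∈ blocks := fun B => by simp [F]
  let D : Finset P := Finset.univ.filter fun z => ∃ g ∈ G, g x = z
  have hxD : x ∈ D := Finset.mem_filter.2 ⟨Finset.mem_univ _, 1, G.one_mem, rfl⟩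
  have hmove : ∀ g ∈ G, moveBlock g D = D := by
    intro g hg
    refine Finset.eq_of_subset_of_card_le (fun z hz => ?_) (card_moveBlock g D).ge
    obtain ⟨w, hw, rfl⟩ := Finset.mem_map.1 hz
    obtain ⟨h, hh, rfl⟩ := (Finset.mem_filter.1 hw).2
    exact Finset.mem_filter.2 ⟨Finset.mem_univ _, g * h, G.mul_mem hg hh, rfl⟩
  have hne : F.Nonempty := by
    rw [Finset.nonempty_iff_ne_empty]
    intro h
    have h1 := hD.sum_card_inter F hF (Finset.subset_univ (Finset.univ : Finset P))
    rw [h, Finset.sum_empty, Finset.card_univ, hD.card_points] at h1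
    have := hD.lam_pos
    omega
  obtain ⟨B₀, hB₀⟩ := hne
  -- `D` is the point orbit of `x`; as it is `G`-invariant and `G` is transitive on blocks, every
  -- block meets it in the same number μ of points.
  set μ := (D ∩ B₀).card with hμ
  have hconst : ∀ B ∈ F, (D ∩ B).card = μ := by
    intro B hB
    obtain ⟨g, hg, rfl⟩ := hT B₀ ((hF _).1 hB₀) B ((hF _).1 hB)
    have h1 : moveBlock g (D ∩ B₀) = moveBlock g D ∩ moveBlock g B₀ := Finset.map_inter _ _
    rw [hμ, ← card_moveBlock g (D ∩ B₀), h1, hmove g hg]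
  -- The three counts, for the pairs of sets (P, P), (D, P), (D, D), give 42λ blocks, |D| = 6μ, and
  -- an equation for μ.
  have h1 := hD.sum_card_inter F hF (Finset.subset_univ (Finset.univ : Finset P))
  have h2 := hD.sum_card_inter F hF (Finset.subset_univ D)
  have h3 := hD.sum_card_inter F hF (Finset.Subset.refl D)
  have hblock : ∀ B ∈ F, B.card = 6 := fun B hB => hD.card_block B ((hF B).1 hB)
  rw [Finset.sum_congr rfl fun B hB => by rw [Finset.univ_inter, hblock B hB], Finset.sum_const,
    smul_eq_mul, Finset.card_univ, hD.card_points] at h1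
  rw [Finset.sum_congr rfl fun B hB => by rw [Finset.univ_inter, hblock B hB, hconst B hB],
    Finset.sum_const, smul_eq_mul, Finset.card_univ, hD.card_points] at h2
  rw [Finset.sum_congr rfl fun B hB => by rw [hconst B hB], Finset.sum_const, smul_eq_mul] at h3
  have hlam := hD.lam_pos
  have hb : F.card = 42 * lam := by omega
  have hδ : 0 < D.card := Finset.card_pos.2 ⟨x, hxD⟩
  rw [hb] at h2 h3
  have h4 : D.card = 6 * μ := by
    have : lam * (35 * D.card) = lam * (35 * (6 * μ)) := by
      calc lam * (35 * D.card) = D.card * (36 - 1) * lam := by ring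
        _ = 42 * lam * (μ * (6 - 1)) := h2.symm
        _ = lam * (35 * (6 * μ)) := by ring
    have := Nat.eq_of_mul_eq_mul_left hlam this
    omega
  have hμ0 : 0 < μ := by omega
  -- The only positive solution is μ = 6, that is |D| = 36.
  have h5 : 7 * (μ - 1) = 6 * μ - 1 := by
    have : (6 * μ * lam) * (7 * (μ - 1)) = (6 * μ * lam) * (6 * μ - 1) := by
      calc (6 * μ * lam) * (7 * (μ - 1)) = 42 * lam * (μ * (μ - 1)) := by ring
        _ = D.card * (D.card - 1) * lam := h3
        _ = (6 * μ * lam) * (6 * μ - 1) := by rw [h4]; ring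
    exact Nat.eq_of_mul_eq_mul_left (by positivity) this
  have h6 : D = Finset.univ :=
    Finset.eq_univ_of_card D (by rw [hD.card_points]; omega)
  exact (Finset.mem_filter.1 (h6 ▸ Finset.mem_univ y : y ∈ D)).2

end Transitivity

/-! ### Uniqueness of the transitive action on 36 points. -/

section Actions

/-- The number of Sylow 7-subgroups divides `n ≤ 6` and is 1 modulo 7, so it is 1. -/
theorem normal_of_card_eq_seven {K : Type*} [Group K] {n : ℕ} (hn : n < 8) (hn0 : 0 < n)
    (hn7 : n ≠ 7) (hK : Nat.card K = 7 * n) (Z : Subgroup K) (hZ : Nat.card Z = 7) : Z.Normal := by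
  have : Fact (Nat.Prime 7) := ⟨by norm_num⟩
  have : Finite K := Nat.finite_of_card_ne_zero (by omega)
  have hfac : (7 * n).factorization 7 = 1 := by
    rw [Nat.factorization_mul (by norm_num) (by omega), Finsupp.add_apply,
      Nat.Prime.factorization_self (by norm_num),
      Nat.factorization_eq_zero_of_not_dvd (by omega)]
  let S : Sylow 7 K := Sylow.ofCard Z (by rw [hK, hfac, hZ, pow_one])
  have h1 := card_sylow_modEq_one 7 K
  have h2 : Nat.card (Sylow 7 K) ∣ Z.index := S.card_dvd_index
  have h3 : Z.index = n := by
    have := Z.card_mul_index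
    rw [hZ, hK] at this
    omega
  rw [h3] at h2
  have h4 := Nat.le_of_dvd hn0 h2
  have h5 : Nat.card (Sylow 7 K) = 1 := by
    have h6 : Nat.card (Sylow 7 K) % 7 = 1 := h1
    omega
  have : Subsingleton (Sylow 7 K) := (Nat.card_eq_one_iff_unique.1 h5).1
  exact Sylow.normal_of_subsingleton S

variable {A P Q : Type*} [Group A] [MulAction A P] [MulAction A Q]

/-- Both actions are the action on cosets of the common stabilizer; the map `g • p ↦ g • q` is well
defined and equivariant. -/
theorem exists_equivariant_equiv [Finite P] [Finite Q] (hcard : Nat.card P = Nat.card Q)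
    {p : P} {q : Q} (hP : ∀ x : P, ∃ g : A, g • p = x) (hQ : ∀ y : Q, ∃ g : A, g • q = y)
    (hstab : MulAction.stabilizer A p = MulAction.stabilizer A q) :
    ∃ f : P ≃ Q, ∀ (g : A) (x : P), f (g • x) = g • f x := by
  choose s hs using hP
  have key : ∀ g h : A, g • p = h • p ↔ g • q = h • q := by
    intro g h
    have := congrArg (fun S => h⁻¹ * g ∈ S) hstab
    simpa only [MulAction.mem_stabilizer_iff, mul_smul, eq_iff_iff, inv_smul_eq_iff] using this
  have hf : ∀ g : A, s (g • p) • q = g • q := fun g => (key _ _).1 (hs _)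
  refine ⟨Equiv.ofBijective (fun x => s x • q) ?_, fun g x => ?_⟩
  · refine (Nat.bijective_iff_surjective_and_card _).2 ⟨fun y => ?_, hcard⟩
    obtain ⟨g, rfl⟩ := hQ y
    exact ⟨g • p, hf g⟩
  · change s (g • x) • q = g • s x • q
    conv_lhs => rw [← hs x, ← mul_smul, hf, mul_smul]

theorem card_stabilizer_of_transitive {m : ℕ} (hcP : Nat.card P = 36)
    (hA : Nat.card A = 36 * m) (hP : ∀ x y : P, ∃ g : A, g • x = y) (x : P) :
    Nat.card (MulAction.stabilizer A x) = m := by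
  have : MulAction.IsPretransitive A P := ⟨hP⟩
  have h1 := MulAction.index_stabilizer_of_transitive A x
  have h2 := (MulAction.stabilizer A x).card_mul_index
  rw [h1, hcP, hA] at h2
  omega

/-- A group of order `36 * 7 * n` with `n < 7` has at most one transitive action on 36 points in
which a given element of order 7 has a single fixed point. -/
theorem exists_equivariant_equiv_of_fixed [Finite P] [Finite Q] (hcP : Nat.card P = 36)
    (hcQ : Nat.card Q = 36) {n : ℕ} (hn0 : 0 < n) (hn : n < 7) (hA : Nat.card A = 36 * (7 * n))
    (hP : ∀ x y : P, ∃ g : A, g • x = y) (hQ : ∀ x y : Q, ∃ g : A, g • x = y)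
    (z : A) (hz : orderOf z = 7) (q : Q) (hq : ∀ y : Q, z • y = y ↔ y = q) :
    ∃ f : P ≃ Q, ∀ (g : A) (x : P), f (g • x) = g • f x := by
  have : Fact (Nat.Prime 7) := ⟨by norm_num⟩
  have hAfin : Finite A := Nat.finite_of_card_ne_zero (by omega)
  have hstabQ := card_stabilizer_of_transitive hcQ hA hQ q
  have hpg : IsPGroup 7 (Subgroup.zpowers z) := IsPGroup.of_card (n := 1) (by
    rw [Nat.card_zpowers, hz, pow_one])
  obtain ⟨p, hp⟩ : ∃ p : P, z • p = p := by
    -- The number of fixed points of a group of order 7 is congruent to 36 ≡ 1 modulo 7, so it is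
    -- not zero.
    have h1 := hpg.card_modEq_card_fixedPoints P
    have h2 : (MulAction.fixedPoints (Subgroup.zpowers z) P).Nonempty := by
      by_contra hne
      rw [Set.not_nonempty_iff_eq_empty] at hne
      rw [hne, hcP, Nat.card_eq_fintype_card, Fintype.card_eq_zero] at h1
      exact absurd h1 (by decide)
    obtain ⟨p, hp⟩ := h2
    exact ⟨p, hp ⟨z, Subgroup.mem_zpowers z⟩⟩
  refine exists_equivariant_equiv (hcP.trans hcQ.symm) (hP p) (hQ q) ?_
  have hstabP := card_stabilizer_of_transitive hcP hA hP p
  set K := MulAction.stabilizer A p with hK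
  let z' : K := ⟨z, hp⟩
  have hz' : orderOf z' = 7 := by rw [← hz, ← Subgroup.orderOf_coe]
  have hnormal : (Subgroup.zpowers z').Normal :=
    normal_of_card_eq_seven (by omega) hn0 (by omega) hstabP _
      (by rw [Nat.card_zpowers, hz'])
  have hzq : z ∈ MulAction.stabilizer A q := (hq q).2 rfl
  refine Subgroup.eq_of_le_of_card_ge (fun k hk => ?_)
    (hstabQ.trans hstabP.symm).le
  -- As ⟨z⟩ is normal in the stabilizer of `p`, the element `k⁻¹zk` is a power of `z` and fixes `q`.
  -- So `z` fixes `k • q`, which must be its only fixed point `q`.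
  rw [MulAction.mem_stabilizer_iff, ← hq]
  have h1 := hnormal.conj_mem z' (Subgroup.mem_zpowers z') (⟨k, hk⟩ : K)⁻¹
  obtain ⟨i, hi⟩ := Subgroup.mem_zpowers_iff.1 h1
  have h2 : z ^ i = k⁻¹ * z * k := by simpa [z'] using congrArg Subtype.val hi
  have h3 : k⁻¹ * z * k ∈ MulAction.stabilizer A q := h2 ▸ Subgroup.zpow_mem _ hzq i
  rw [MulAction.mem_stabilizer_iff, mul_smul, mul_smul, inv_smul_eq_iff] at h3
  exact h3

end Actions

/-! ### Transport of designs along an equivalence of actions. -/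

section Transport

variable {P Q : Type*} [Fintype P]

/-- A block-transitive design whose group acts as a group `G₀` on another point set is isomorphic
to an orbit of `G₀`. -/
theorem exists_isomorphic_orbitBlocks {blocks : Set (Finset P)} {lam : ℕ}
    (hD : IsDesign 2 36 6 lam blocks) {G : Subgroup (Equiv.Perm P)} (hG : IsAutGroup G blocks)
    (hT : IsBlockTransitive G blocks) {G₀ : Subgroup (Equiv.Perm Q)} (ψ : G ≃* G₀) (f : P ≃ Q)
    (hf : ∀ (g : G) (x : P), f ((g : Equiv.Perm P) x) = (ψ g : Equiv.Perm Q) (f x)) :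
    ∃ B, DesignIsomorphic blocks (orbitBlocks G₀ B) := by
  obtain ⟨B₀, hB₀⟩ : blocks.Nonempty := by
    rw [Set.nonempty_iff_ne_empty]
    intro h
    obtain ⟨T, -, hT⟩ := Finset.exists_subset_card_eq
      (show 2 ≤ (Finset.univ : Finset P).card by rw [Finset.card_univ, hD.card_points]; norm_num)
    have h1 := hD.balanced T hT
    rw [h] at h1
    simp at h1
    exact hD.lam_pos.ne h1
  have hmove : ∀ (g : G) (B : Finset P), moveBlock f (moveBlock (g : Equiv.Perm P) B) =
      moveBlock (ψ g : Equiv.Perm Q) (moveBlock f B) := by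
    intro g B
    rw [← moveBlock_trans, ← moveBlock_trans]
    congr 1
    exact Equiv.ext fun x => hf g x
  refine ⟨moveBlock f B₀, f, fun B => ⟨?_, fun hB => ?_⟩⟩
  · rintro ⟨g, hg, h⟩
    obtain ⟨k, hk⟩ := ψ.surjective ⟨g, hg⟩
    have h1 := hmove k B₀
    rw [hk, h] at h1
    rw [← moveBlock_injective f h1]
    exact (hG k k.2 B₀).2 hB₀
  · obtain ⟨g, hg, rfl⟩ := hT B₀ hB₀ B hB
    exact ⟨ψ ⟨g, hg⟩, SetLike.coe_mem _, (hmove ⟨g, hg⟩ B₀).symm⟩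

/-- A block-transitive group isomorphic to a block-transitive group on 36 points that has order
`36 * 7 * n`, and an element of order 7 with a single fixed point, acts in the same way. -/
theorem exists_isomorphic_orbitBlocks_of_mulEquiv {blocks : Set (Finset P)} {lam : ℕ}
    (hD : IsDesign 2 36 6 lam blocks) {G : Subgroup (Equiv.Perm P)} (hG : IsAutGroup G blocks)
    (hT : IsBlockTransitive G blocks) [Fintype Q] {blocks₀ : Set (Finset Q)} {lam₀ : ℕ}
    (hD₀ : IsDesign 2 36 6 lam₀ blocks₀) {G₀ : Subgroup (Equiv.Perm Q)}
    (hT₀ : IsBlockTransitive G₀ blocks₀) (ψ : G ≃* G₀) {n : ℕ}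
    (hn0 : 0 < n) (hn : n < 7) (hcard : Nat.card G₀ = 36 * (7 * n)) {z : Equiv.Perm Q}
    (hzG : z ∈ G₀) (hz : orderOf z = 7) (q : Q) (hq : ∀ y, z y = y ↔ y = q) :
    ∃ B, DesignIsomorphic blocks (orbitBlocks G₀ B) := by
  classical
  -- Through the inverse of `ψ` the same abstract group acts on `P` and on `Q`, so the uniqueness of
  -- the action applies.
  let _ : MulAction G₀ P := MulAction.compHom P ψ.symm.toMonoidHom
  obtain ⟨f, hf⟩ := exists_equivariant_equiv_of_fixed (A := G₀) (P := P) (Q := Q)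
    (by rw [Nat.card_eq_fintype_card, hD.card_points])
    (by rw [Nat.card_eq_fintype_card, hD₀.card_points]) hn0 hn hcard
    (fun x y => by
      obtain ⟨g, hg, h⟩ := hD.exists_apply_eq hT x y
      refine ⟨ψ ⟨g, hg⟩, ?_⟩
      change (ψ.symm (ψ ⟨g, hg⟩) : Equiv.Perm P) x = y
      rw [ψ.symm_apply_apply]
      exact h)
    (fun x y => by
      obtain ⟨g, hg, h⟩ := hD₀.exists_apply_eq hT₀ x y
      exact ⟨⟨g, hg⟩, h⟩)
    ⟨z, hzG⟩ (by rw [← Subgroup.orderOf_coe, hz]) q hq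
  refine exists_isomorphic_orbitBlocks hD hG hT ψ f fun g x => ?_
  have h := hf (ψ g) x
  change f ((ψ.symm (ψ g) : Equiv.Perm P) x) = _ at h
  rwa [ψ.symm_apply_apply] at h

end Transport

/-! ### The classification -/

section Classification

theorem orderOf_lineMul : orderOf lineMul = 7 :=
  orderOf_eq_prime (hp := ⟨by norm_num⟩) (by decide +kernel) (by decide +kernel)

theorem IsTable.apply_eq_iff {t : List ℕ} {g : Equiv.Perm (Fin 36)} (h : IsTable t g) {q : Fin 36}
    (hq : ∀ y : Fin 36, nth t y = y ↔ y = q) (y : Fin 36) : g y = y ↔ y = q := by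
  rw [← hq, h, Fin.ext_iff]

/-- Multiplication by the generator fixes ∞ and 0 and permutes the other 7 points of the line
cyclically, so it fixes only the edge joining ∞ and 0, here number 0. The order is 504 = 36·(7·2).
-/
theorem exists_isomorphic_orbitBlocks_psl {P : Type*} [Fintype P] {blocks : Set (Finset P)}
    {lam : ℕ} (hD : IsDesign 2 36 6 lam blocks) {G : Subgroup (Equiv.Perm P)}
    (hG : IsAutGroup G blocks) (hT : IsBlockTransitive G blocks) (ψ : G ≃* permPSL) :
    ∃ B, DesignIsomorphic blocks (orbitBlocks permPSL B) := by
  -- Any entry would do: by Block's lemma one listed design already makes `permPSL` transitive on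
  -- points.
  have he : (12, [1, 2, 3, 4, 15, 16]) ∈ pslTable := by decide +kernel
  refine exists_isomorphic_orbitBlocks_of_mulEquiv hD hG hT (isExactList_psl.isDesign _ he)
    (isExactList_psl.isBlockTransitive _ he) ψ (n := 2)
    (by norm_num) (by norm_num) natCard_permPSL (z := edgeHom pslEdge lineMul) ?_ ?_ 0
    (isTable_pslMul.apply_eq_iff (by decide +kernel))
  · rw [permPSL_eq]
    exact ⟨_, lineMul_mem, rfl⟩
  · rw [orderOf_injective _ (edgeHom_injective _), orderOf_lineMul]

/-- The same element of order 7 serves; in this numbering its fixed edge is number 31, and 1512 =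
36·(7·6). -/
theorem exists_isomorphic_orbitBlocks_pgammal {P : Type*} [Fintype P] {blocks : Set (Finset P)}
    {lam : ℕ} (hD : IsDesign 2 36 6 lam blocks) {G : Subgroup (Equiv.Perm P)}
    (hG : IsAutGroup G blocks) (hT : IsBlockTransitive G blocks) (ψ : G ≃* permPGammaL) :
    ∃ B, DesignIsomorphic blocks (orbitBlocks permPGammaL B) := by
  have he : (36, [1, 2, 3, 4, 5, 18]) ∈ pgammalTable := by decide +kernel
  refine exists_isomorphic_orbitBlocks_of_mulEquiv hD hG hT (isExactList_pgammal.isDesign _ he)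
    (isExactList_pgammal.isBlockTransitive _ he) ψ (n := 6)
    (by norm_num) (by norm_num) natCard_permPGammaL (z := edgeHom pgammalEdge lineMul) ?_ ?_ 31
    (isTable_pgammalMul.apply_eq_iff (by decide +kernel))
  · rw [permPGammaL_eq]
    exact ⟨_, linePSL_le lineMul_mem, rfl⟩
  · rw [orderOf_injective _ (edgeHom_injective _), orderOf_lineMul]

theorem lam_mem_psl : ∀ e ∈ pslTable, e.1 = 2 ∨ e.1 = 6 ∨ e.1 = 12 := by decide +kernel

theorem lam_mem_pgammal : ∀ e ∈ pgammalTable,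
    e.1 = 2 ∨ e.1 = 6 ∨ e.1 = 9 ∨ e.1 = 12 ∨ e.1 = 18 ∨ e.1 = 36 := by decide +kernel

end Classification

/-- **Block-transitive `2`-`(36, 6, λ)` designs with `PSL(2,8) ⊴ G ≤ PΓL(2,8)`.**
The group `G` is isomorphic to a group `H` between `PSL(2,8)` and `PΓL(2,8)`. -/
theorem theorem1p2 :
    (∀ (P : Type*) [Fintype P] (blocks : Set (Finset P)) (lam : ℕ)
      (_ : IsDesign 2 36 6 lam blocks)
      (G : Subgroup (Equiv.Perm P)) (_ : IsAutGroup G blocks) (_ : IsBlockTransitive G blocks)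
      (H : Subgroup (Equiv.Perm (ℙ F8 (Fin 2 → F8))))
      (_ : PSL2 F8 ≤ H) (_ : ((PSL2 F8).subgroupOf H).Normal) (_ : H ≤ PGammaL2 F8)
      (_ : G ≃* H),
      (H = PSL2 F8 ∧ lam ∈ ({2, 6, 12} : Set ℕ) ∧
        ∃ e ∈ pslTable, e.1 = lam ∧ DesignIsomorphic (listedBlocks permPSL e) blocks) ∨
      (H = PGammaL2 F8 ∧ lam ∈ ({2, 6, 9, 12, 18, 36} : Set ℕ) ∧
        ∃ e ∈ pgammalTable, e.1 = lam ∧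
          DesignIsomorphic (listedBlocks permPGammaL e) blocks)) ∧
    (pslTable.length = 46 ∧ Nonempty (permPSL ≃* PSL2 F8) ∧ IsExactList permPSL pslTable) ∧
    (pgammalTable.length = 330 ∧ Nonempty (permPGammaL ≃* PGammaL2 F8) ∧
      IsExactList permPGammaL pgammalTable) := by
  refine ⟨?_, ⟨by decide +kernel, nonempty_permPSL_equiv, isExactList_psl⟩,
    by decide +kernel, nonempty_permPGammaL_equiv, isExactList_pgammal⟩
  intro P _ blocks lam hD G hG hT H h1 _ h2 ψ
  rcases eq_PSL2_or_eq_PGammaL2 h1 h2 with rfl | rfl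
  · left
    obtain ⟨B, hB⟩ := exists_isomorphic_orbitBlocks_psl hD hG hT
      (ψ.trans nonempty_permPSL_equiv.some.symm)
    obtain ⟨e, he, rfl, hiso⟩ := exists_listed_psl (hD.of_isomorphic hB)
    exact ⟨rfl, lam_mem_psl e he, e, he, rfl, hiso.trans hB.symm⟩
  · right
    obtain ⟨B, hB⟩ := exists_isomorphic_orbitBlocks_pgammal hD hG hT
      (ψ.trans nonempty_permPGammaL_equiv.some.symm)
    obtain ⟨e, he, rfl, hiso⟩ := exists_listed_pgammal (hD.of_isomorphic hB)
    exact ⟨rfl, lam_mem_pgammal e he, e, he, rfl, hiso.trans hB.symm⟩
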